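/- Setting. Let $N\ge 1$ and let $\Omega\subset\mathbb R^N$ be a bounded open set with Lipschitz boundary (near each boundary point, after a rotation, $\Omega$ is the set lying strictly above the graph of a Lipschitz function). Let $\sigma(x)=\mathrm{dist}(x,\partial\Omega)$. Let $\rho\in C_c^\infty(\mathbb R^N)$ be radially symmetric with $0\le\rho\le 1$, $\rho(x)=0\iff |x|\ge 1$, and $\rho(x)\ge\rho(y)$ whenever $|x|<1/2=|y|$. For a step function $\eta\geq 0$ with $\eta\le\sigma$ on $\Omega$ and $f\in L^1_{loc}(\Omega)$, let $$Tf(x)=\Big(\int_{B_1(0)}\rho(z)\,dz\Big)^{-1}\int_{B_1(0)}\rho(z)\,f(x-\eta(x)z)\,dz,\qquad x\in\Omega .$$ For $f\in W^{1,p}(\Omega)$, $1\le p<\infty$, the trace $\tau f\in L^p(\partial\Omega)$ (with respect to the $(N-1)$-dimensional Hausdorff measure) is the limit in $L^p(\partial\Omega)$ of $u_n|_{\partial\Omega}$ for functions $u_n\in C^\infty(\overline\Omega)$ (restrictions of functions in $C^\infty(\mathbb R^N)$) with $u_n\to f$ in $W^{1,p}(\Omega)$. For $0<s<1$, $W^{s,p}(\partial\Omega)$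 is the space of $g\in L^p(\partial\Omega)$ with $$\iint_{\partial\Omega\times\partial\Omega}\frac{|g(x)-g(y)|^p}{|x-y|^{N-1+sp}}\,d\mathcal H^{N-1}(x)\,d\mathcal H^{N-1}(y)<\infty .$$ Statement. (a) Let $1<p<\infty$, and let $\eta\in C^\infty(\mathbb R^N)$ be non-negative with $\eta^{-1}(\{0\})=\partial\Omega$, with all derivatives of $\eta$ vanishing on $\partial\Omega$, and with $\eta(x)<\mathrm{dist}(x,\partial\Omega)$ for all $x\in\mathbb R^N\setminus\partial\Omega$. Then for every $f\in W^{1,p}(\Omega)$ one has $Tf\in W^{1,p}(\Omega)$; the traces $\tau f$ and $\tau(Tf)$ exist, are uniquely determined almost everywhere on $\partial\Omega$, belong to $W^{1-1/p,p}(\partial\Omega)$, and $$\tau f=\tau(Tf)\quad\text{in } W^{1-1/p,p}(\partial\Omega).$$ (b) Let $\eta\in C^\infty(\Omega)$ have bounded gradient on $\Omega$ and satisfy $\eta\le\sigma$ and $\kappa\,\sigma^2\le\eta\le\sigma^2$ on $\Omega$ for some $\kappa>0$. Then for every $f\in W^{1,1}(\Omega)$ one has $Tf\in W^{1,1}(\Omega)$;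 the traces $\tau f$ and $\tau(Tf)$ exist, are uniquely determined almost everywhere on $\partial\Omega$, belong to $L^1(\partial\Omega)$, and $\tau f=\tau(Tf)$ in $L^1(\partial\Omega)$. -/

import Mathlib

open MeasureTheory Filter Topology
open scoped ENNReal NNReal ContDiff

/-- Admissible mollifying kernels: smooth, with values in `[0, 1]`, vanishing exactly outside the open
unit ball (hence compactly supported), radially symmetric, and bounded below on the ball of radius
`1/2` by the (common) value on the sphere of radius `1/2`. -/
structure IsMollifierKernel {N : ℕ} (ρ : EuclideanSpace ℝ (Fin N) → ℝ) : Prop where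
  smooth : ContDiff ℝ ∞ ρ
  nonneg : ∀ x, 0 ≤ ρ x
  le_one : ∀ x, ρ x ≤ 1
  eq_zero_iff : ∀ x, ρ x = 0 ↔ 1 ≤ ‖x‖
  radial : ∀ x y, ‖x‖ = ‖y‖ → ρ x = ρ y
  half_le : ∀ x y, ‖x‖ < 1 / 2 → ‖y‖ = 1 / 2 → ρ y ≤ ρ x

/-- Smooth non-negative functions on the whole space whose zero set is exactly `Θ`, all of whose
derivatives vanish on `Θ`, and which lie strictly below the distance to `Θ` off `Θ`. -/
structure IsWhitneyStep {N : ℕ} (Θ : Set (EuclideanSpace ℝ (Fin N)))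
    (η : EuclideanSpace ℝ (Fin N) → ℝ) : Prop where
  smooth : ContDiff ℝ ∞ η
  nonneg : ∀ x, 0 ≤ η x
  eq_zero_iff : ∀ x, η x = 0 ↔ x ∈ Θ
  deriv_eq_zero : ∀ k : ℕ, ∀ x ∈ Θ, iteratedFDeriv ℝ k η x = 0
  lt_infDist : ∀ x, x ∉ Θ → η x < Metric.infDist x Θ

/-- Step functions of quadratic decay, used for exponent one: `η` is smooth in `Ω` with bounded
gradient, `η ≤ σ`, and `κ σ² ≤ η ≤ σ²` in `Ω` for some `κ > 0`, where `σ` is the distance to `∂Ω`. -/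
structure IsQuadraticStep {N : ℕ} (Ω : Set (EuclideanSpace ℝ (Fin N)))
    (η : EuclideanSpace ℝ (Fin N) → ℝ) : Prop where
  smooth : ContDiffOn ℝ ∞ η Ω
  bounded_gradient : ∃ L : ℝ, ∀ x ∈ Ω, ‖gradient η x‖ ≤ L
  le_infDist : ∀ x ∈ Ω, η x ≤ Metric.infDist x (frontier Ω)
  quadratic_lower : ∃ κ : ℝ, 0 < κ ∧ ∀ x ∈ Ω, κ * Metric.infDist x (frontier Ω) ^ 2 ≤ η x
  quadratic_upper : ∀ x ∈ Ω, η x ≤ Metric.infDist x (frontier Ω) ^ 2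

/-- The variable step mollifier `T f(x) = M_ρ ∫_{B_1(0)} ρ(z) f(x - η(x) z) dz`, with
`M_ρ = (∫_{B_1(0)} ρ)⁻¹`.  Only its values at points of `Ω` are of interest. -/
noncomputable def variableStepMollifier {N : ℕ} (ρ η f : EuclideanSpace ℝ (Fin N) → ℝ)
    (x : EuclideanSpace ℝ (Fin N)) : ℝ :=
  (∫ z in Metric.ball (0 : EuclideanSpace ℝ (Fin N)) 1, ρ z)⁻¹ *
    ∫ z in Metric.ball (0 : EuclideanSpace ℝ (Fin N)) 1, ρ z * f (x - η x • z)

/-- `Ω` has Lipschitz boundary: near each boundary point `ξ` there are an axis (unit vector) `ν` and a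
Lipschitz function `γ` such that, in a ball around `ξ`, the set `Ω` is the part lying strictly above the
graph of `γ`, a function of the component of the point orthogonal to `ν`. -/
def HasLipschitzBoundary {N : ℕ} (Ω : Set (EuclideanSpace ℝ (Fin N))) : Prop :=
  ∀ ξ ∈ frontier Ω, ∃ (ν : EuclideanSpace ℝ (Fin N)) (K : ℝ≥0)
    (γ : EuclideanSpace ℝ (Fin N) → ℝ) (r : ℝ),
    ‖ν‖ = 1 ∧ LipschitzWith K γ ∧ 0 < r ∧
    ∀ x ∈ Metric.ball ξ r, x ∈ Ω ↔ γ (x - inner ℝ ν x • ν) < inner ℝ ν x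

/-- Surface measure on `∂Ω`: the `(N-1)`-dimensional Hausdorff measure (up to a constant factor that
depends only on `N`) restricted to the topological boundary. -/
noncomputable def surfaceMeasure {N : ℕ} (Ω : Set (EuclideanSpace ℝ (Fin N))) :
    Measure (EuclideanSpace ℝ (Fin N)) :=
  (Measure.hausdorffMeasure ((N : ℝ) - 1)).restrict (frontier Ω)

/-- `G` is a weak gradient of `f` in `Ω`. -/
def HasWeakGradient {N : ℕ} (Ω : Set (EuclideanSpace ℝ (Fin N)))
    (f : EuclideanSpace ℝ (Fin N) → ℝ)
    (G : EuclideanSpace ℝ (Fin N) → EuclideanSpace ℝ (Fin N)) : Prop :=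
  LocallyIntegrableOn f Ω ∧ LocallyIntegrableOn G Ω ∧
  ∀ φ : EuclideanSpace ℝ (Fin N) → ℝ, ContDiff ℝ ∞ φ → HasCompactSupport φ → tsupport φ ⊆ Ω →
    ∫ x in Ω, f x • gradient φ x = - ∫ x in Ω, φ x • G x

/-- `f` belongs to the Sobolev space `W^{1,p}(Ω)`. -/
def MemW1p {N : ℕ} (Ω : Set (EuclideanSpace ℝ (Fin N))) (p : ℝ≥0∞)
    (f : EuclideanSpace ℝ (Fin N) → ℝ) : Prop :=
  MemLp f p (volume.restrict Ω) ∧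
  ∃ G, HasWeakGradient Ω f G ∧ MemLp G p (volume.restrict Ω)

/-- `g` is a boundary trace of `f ∈ W^{1,p}(Ω)`: there are functions `u n` in `C^∞(closure Ω)`
(restrictions of smooth functions on the whole space) which converge to `f` in `W^{1,p}(Ω)` and whose
restrictions to `∂Ω` converge to `g` in `L^p(∂Ω)`. -/
def HasTrace {N : ℕ} (Ω : Set (EuclideanSpace ℝ (Fin N))) (p : ℝ≥0∞)
    (f g : EuclideanSpace ℝ (Fin N) → ℝ) : Prop :=
  MemLp f p (volume.restrict Ω) ∧ MemLp g p (surfaceMeasure Ω) ∧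
  ∃ G, HasWeakGradient Ω f G ∧ MemLp G p (volume.restrict Ω) ∧
  ∃ u : ℕ → EuclideanSpace ℝ (Fin N) → ℝ, (∀ n, ContDiff ℝ ∞ (u n)) ∧
    Tendsto (fun n => eLpNorm (fun x => u n x - f x) p (volume.restrict Ω)) atTop (𝓝 0) ∧
    Tendsto (fun n => eLpNorm (fun x => gradient (u n) x - G x) p (volume.restrict Ω))
      atTop (𝓝 0) ∧
    Tendsto (fun n => eLpNorm (fun x => u n x - g x) p (surfaceMeasure Ω)) atTop (𝓝 0)

/-- `g` belongs to the fractional Sobolev space `W^{s,p}(∂Ω)` on the `(N-1)`-dimensional set `∂Ω`: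
`g ∈ L^p(∂Ω)` and `∬ |g x - g y|^p / |x - y|^{(N-1) + s p} < ∞` over `∂Ω × ∂Ω`. -/
def MemBoundaryWsp {N : ℕ} (Ω : Set (EuclideanSpace ℝ (Fin N))) (s : ℝ) (p : ℝ≥0∞)
    (g : EuclideanSpace ℝ (Fin N) → ℝ) : Prop :=
  MemLp g p (surfaceMeasure Ω) ∧
  ∫⁻ x, ∫⁻ y, ENNReal.ofReal (|g x - g y| ^ p.toReal / dist x y ^ ((N : ℝ) - 1 + s * p.toReal))
    ∂(surfaceMeasure Ω) ∂(surfaceMeasure Ω) < ⊤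

/-! ### Distance to the boundary, interior cones and surface measure -/

section Geometry

/-! The mollification cannot change boundary values because the step vanishes on `∂Ω`: for smooth
`u` one has `Tu = u` there. If `T` is bounded on `W^{1,p}(Ω)`, then smooth `u n → f` gives `T(u n) →
Tf` with the boundary values of `u n`, so `f` and `Tf` have the same trace. Three ingredients make
this rigorous.

Trace theory. Near each boundary point the Lipschitz graph gives a translation-uniform cone inside
`Ω` (`HasLipschitzBoundary.exists_isInteriorCone`) and the bound `surfaceMeasure (ball x ρ) ≤ C
ρ^(N-1)`. Integrating `∇u` along rays of the cone bounds `u x - u w` for boundary points `x`.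
Averaging over `w` and applying Tonelli gives the `L^p` trace inequality
(`HasLipschitzBoundary.exists_lintegral_boundary_le`). Comparing two boundary points at distance `d`
through a common ball at height proportional to `d` gives the Gagliardo bound
(`HasLipschitzBoundary.exists_gagliardo_le`) when `p > 1`. The cones also yield density of smooth
functions: shift into the cone, mollify, and glue with a partition of unity
(`HasWeakGradient.exists_smooth_approx`). Hence the trace exists, is unique and can be computed from
any one smooth approximation; Fatou's lemma transfers the fractional regularity to it.

Boundedness of `T`. Differentiating `Tu` gives averages of `∇u` over `ball x (η x)` with bounded
coefficients (`stepGradient`). Such averages are bounded on `L^p` because, near the boundary, `η` is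
comparable to `η x` on that ball (`IsAdmissibleStep.exists_lintegral_average_le`); away from the
boundary `η` is bounded below.

Smoothness up to the boundary. `Tu` must be approximated by functions smooth on the whole space. In
case (a) it is one itself. In case (b) the quadratic decay makes the extension of `η` by zero
differentiable with bounded derivative, so it is a limit of smooth steps `ζ k`, and the
mollifications of `u` with step `ζ k` serve as approximants. `IsAdmissibleStep` isolates what both
cases share, and `IsAdmissibleStep.exists_trace` concludes. -/

theorem exists_mem_segment_frontier {V : Type*} [NormedAddCommGroup V] [NormedSpace ℝ V] {Ω : Set V}
    {x y : V} (hy : y ∈ Ω) (hx : x ∉ Ω) : ∃ b ∈ segment ℝ y x, b ∈ frontier Ω := by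
  by_contra! h
  have hpre : IsPreconnected (segment ℝ y x) := (convex_segment y x).isPreconnected
  have hsub : segment ℝ y x ⊆ interior Ω ∪ (closure Ω)ᶜ := by
    intro b hb
    by_cases hbc : b ∈ closure Ω
    · left
      by_contra hbi
      exact h b hb ⟨hbc, hbi⟩
    · exact Or.inr hbc
  have hyi : y ∈ interior Ω := by
    rcases hsub (left_mem_segment ℝ y x) with h1 | h1
    · exact h1
    · exact absurd (subset_closure hy) h1
  -- A connected segment covered by two disjoint open sets and meeting the interior stays in it,
  -- contrary to `x ∉ Ω`.
  have := hpre.subset_left_of_subset_union isOpen_interior isClosed_closure.isOpen_compl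
    (Set.disjoint_left.2 fun b hb hb' => hb' (subset_closure (interior_subset hb))) hsub
    ⟨y, left_mem_segment ℝ y x, hyi⟩
  exact hx (interior_subset (this (right_mem_segment ℝ y x)))

theorem infDist_frontier_le_dist {V : Type*} [NormedAddCommGroup V] [NormedSpace ℝ V] {Ω : Set V}
    {x y : V} (hy : y ∈ Ω) (hx : x ∉ Ω) : Metric.infDist y (frontier Ω) ≤ dist y x := by
  obtain ⟨b, hb, hbf⟩ := exists_mem_segment_frontier hy hx
  refine (Metric.infDist_le_dist_of_mem hbf).trans ?_
  have := dist_add_dist_of_mem_segment hb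
  linarith [dist_nonneg (x := b) (y := x)]

theorem ball_infDist_frontier_subset {V : Type*} [NormedAddCommGroup V] [NormedSpace ℝ V]
    {Ω : Set V} {y : V} {r : ℝ} (hy : y ∈ Ω) (hr : r ≤ Metric.infDist y (frontier Ω)) :
    Metric.ball y r ⊆ Ω := by
  intro z hz
  by_contra hzΩ
  have := infDist_frontier_le_dist hy hzΩ
  rw [Metric.mem_ball, dist_comm] at hz
  linarith

theorem infDist_frontier_ge_of_ball_subset {V : Type*} [NormedAddCommGroup V] [NormedSpace ℝ V]
    {Ω : Set V} (hΩ : IsOpen Ω) (hne : (frontier Ω).Nonempty) {z : V} {r : ℝ}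
    (h : Metric.ball z r ⊆ Ω) : r ≤ Metric.infDist z (frontier Ω) := by
  refine (Metric.le_infDist hne).2 fun b hb => ?_
  by_contra! hlt
  have : b ∈ Ω := h (by rwa [Metric.mem_ball, dist_comm])
  exact (hΩ.frontier_eq ▸ hb).2 this

variable {N : ℕ}

/-- Near `ξ`, each point `x` of `closure Ω` is the vertex of a cone `⋃ t, ball (x + t ν) (c t)` of
height `h` contained in `Ω`. -/
structure IsInteriorCone (Ω : Set (EuclideanSpace ℝ (Fin N))) (ξ ν : EuclideanSpace ℝ (Fin N))
    (r c h : ℝ) : Prop where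
  norm_le : ‖ν‖ ≤ 1
  r_pos : 0 < r
  c_pos : 0 < c
  c_le : c ≤ 1
  h_pos : 0 < h
  ball_subset : ∀ x ∈ closure Ω, x ∈ Metric.ball ξ r → ∀ t, 0 < t → t < h →
    Metric.ball (x + t • ν) (c * t) ⊆ Ω

theorem graph_le_of_mem_closure {Ω : Set (EuclideanSpace ℝ (Fin N))}
    {ξ ν : EuclideanSpace ℝ (Fin N)} {K : ℝ≥0} {γ : EuclideanSpace ℝ (Fin N) → ℝ} {r : ℝ}
    (hγ : LipschitzWith K γ)
    (hΩ : ∀ x ∈ Metric.ball ξ r, x ∈ Ω ↔ γ (x - inner ℝ ν x • ν) < inner ℝ ν x)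
    {x : EuclideanSpace ℝ (Fin N)} (hx : x ∈ closure Ω) (hxr : x ∈ Metric.ball ξ r) :
    γ (x - inner ℝ ν x • ν) ≤ inner ℝ ν x := by
  have h1 : x ∈ closure (Metric.ball ξ r ∩ Ω) := Metric.isOpen_ball.inter_closure ⟨hxr, hx⟩
  have hcl : IsClosed {x : EuclideanSpace ℝ (Fin N) |
      γ (x - inner ℝ ν x • ν) ≤ inner ℝ ν x} := by
    apply isClosed_le
    · exact hγ.continuous.comp (by fun_prop)
    · fun_prop
  exact closure_minimal (fun z hz => ((hΩ z hz.1).1 hz.2).le) hcl h1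

theorem norm_sub_inner_smul_le {ν : EuclideanSpace ℝ (Fin N)} (hν : ‖ν‖ = 1)
    (v : EuclideanSpace ℝ (Fin N)) : ‖v - inner ℝ ν v • ν‖ ≤ ‖v‖ := by
  refine le_of_sq_le_sq ?_ (norm_nonneg _)
  rw [norm_sub_sq_real, inner_smul_right, norm_smul, hν, real_inner_comm]
  simp only [Real.norm_eq_abs, mul_one, sq_abs]
  nlinarith [sq_nonneg (inner ℝ ν v)]

/-- Moving by `t` along the axis raises the height by `t`, while a perturbation `w` costs at most
`‖w‖` in height and `K ‖w‖` in the graph; a radius `t / (1 + K)` is therefore affordable. Interior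
points receive the degenerate axis `0`, so that one notion covers the whole closure. -/
theorem HasLipschitzBoundary.exists_isInteriorCone {Ω : Set (EuclideanSpace ℝ (Fin N))}
    (hopen : IsOpen Ω) (hlip : HasLipschitzBoundary Ω) {ξ : EuclideanSpace ℝ (Fin N)}
    (hξ : ξ ∈ closure Ω) : ∃ ν r c h, IsInteriorCone Ω ξ ν r c h := by
  by_cases hξΩ : ξ ∈ Ω
  · obtain ⟨ε, hε, hb⟩ := Metric.isOpen_iff.1 hopen ξ hξΩ
    refine ⟨0, ε / 2, 1, ε / 2, by simp, by linarith, by norm_num, le_rfl, by linarith, ?_⟩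
    intro x _ hx t _ ht z hz
    apply hb
    simp only [smul_zero, add_zero, one_mul, Metric.mem_ball] at *
    linarith [dist_triangle z x ξ]
  obtain ⟨ν, K, γ, r, hν, hγ, hr, hΩ⟩ := hlip ξ ⟨hξ, by rwa [hopen.interior_eq]⟩
  -- Starting within `r / 2` of `ξ`, a shift and a perturbation of size below `r / 4` each stay in
  -- the ball where the graph description holds.
  refine ⟨ν, r / 2, 1 / (1 + K), r / 4, hν.le, by linarith, by positivity, ?_, by linarith, ?_⟩
  · rw [div_le_one (by positivity)]; simp
  intro x hx hxr t ht hth z hz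
  have hc1 : 1 / (1 + (K : ℝ)) ≤ 1 := by
    rw [div_le_one (by positivity)]; simp
  have hxr' : x ∈ Metric.ball ξ r := Metric.ball_subset_ball (by linarith) hxr
  have hzx : ‖z - (x + t • ν)‖ < 1 / (1 + K) * t := by rwa [Metric.mem_ball, dist_eq_norm] at hz
  have hct : 1 / (1 + (K : ℝ)) * t ≤ t := by nlinarith
  have hzr : z ∈ Metric.ball ξ r := by
    rw [Metric.mem_ball, dist_eq_norm] at *
    have : z - ξ = (z - (x + t • ν)) + t • ν + (x - ξ) := by abel
    rw [this]
    have h2 : ‖t • ν‖ = t := by rw [norm_smul, hν, Real.norm_eq_abs, abs_of_pos ht, mul_one]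
    have := norm_add₃_le (a := z - (x + t • ν)) (b := t • ν) (c := x - ξ)
    linarith
  rw [hΩ z hzr]
  have hle := graph_le_of_mem_closure hγ hΩ hx hxr'
  set w := z - (x + t • ν) with hw
  have hz' : z = x + t • ν + w := by rw [hw]; abel
  have hνν : inner ℝ ν ν = (1 : ℝ) := by rw [real_inner_self_eq_norm_sq, hν]; norm_num
  have hin : inner ℝ ν z = inner ℝ ν x + t + inner ℝ ν w := by
    rw [hz', inner_add_right, inner_add_right, inner_smul_right, hνν, mul_one]
  have hproj : (z - inner ℝ ν z • ν) - (x - inner ℝ ν x • ν) = w - inner ℝ ν w • ν := by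
    rw [hin, hz']
    module
  have h3 : γ (z - inner ℝ ν z • ν) - γ (x - inner ℝ ν x • ν) ≤ K * ‖w‖ := by
    refine (le_abs_self _).trans ?_
    rw [← Real.dist_eq]
    refine (hγ.dist_le_mul _ _).trans ?_
    rw [dist_eq_norm, hproj]
    exact mul_le_mul_of_nonneg_left (norm_sub_inner_smul_le hν w) K.2
  have h4 : -‖w‖ ≤ inner ℝ ν w := by
    have := abs_real_inner_le_norm ν w
    rw [hν, one_mul] at this
    linarith [neg_abs_le (inner ℝ ν w)]
  have h5 : (1 + (K : ℝ)) * ‖w‖ < t := by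
    have : (1 + (K : ℝ)) * ‖w‖ < (1 + K) * (1 / (1 + K) * t) :=
      mul_lt_mul_of_pos_left hzx (by positivity)
    have e : (1 + (K : ℝ)) * (1 / (1 + K) * t) = t := by field_simp
    linarith
  rw [hin] at h3 ⊢
  linarith

/-- The boundary piece is the Lipschitz image of its projection to the hyperplane orthogonal to `ν`.
The projection of a ball of radius `ρ` has comparable radius, and in `N - 1` coordinates with the
sup norm Hausdorff measure is Lebesgue measure. The centre is arbitrary, because the cone estimates
use balls centred at interior points. -/
theorem HasLipschitzBoundary.exists_hausdorffMeasure_le (hN : 1 ≤ N)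
    {Ω : Set (EuclideanSpace ℝ (Fin N))}
    (hopen : IsOpen Ω) (hlip : HasLipschitzBoundary Ω) {ξ : EuclideanSpace ℝ (Fin N)}
    (hξ : ξ ∈ frontier Ω) : ∃ r > 0, ∃ C : ℝ≥0, ∀ x ρ, 0 < ρ →
      Measure.hausdorffMeasure ((N : ℝ) - 1) (frontier Ω ∩ Metric.ball ξ r ∩ Metric.ball x ρ)
        ≤ C * ENNReal.ofReal ρ ^ (N - 1) := by
  obtain ⟨ν, K, γ, r, hν, hγ, hr, hΩ⟩ := hlip ξ hξ
  have hν0 : ν ≠ 0 := by rintro rfl; simp at hν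
  let F := (ℝ ∙ ν)ᗮ
  have hfin : Module.finrank ℝ F = Module.finrank ℝ (Fin (N - 1) → ℝ) := by
    have h1 := Submodule.finrank_add_finrank_orthogonal (ℝ ∙ ν)
    rw [finrank_span_singleton hν0, finrank_euclideanSpace_fin] at h1
    rw [Module.finrank_fin_fun]
    change Module.finrank ℝ (ℝ ∙ ν)ᗮ = _
    omega
  let e : F ≃L[ℝ] (Fin (N - 1) → ℝ) := ContinuousLinearEquiv.ofFinrankEq hfin
  let A : EuclideanSpace ℝ (Fin N) →L[ℝ] (Fin (N - 1) → ℝ) :=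
    e.toContinuousLinearMap.comp F.orthogonalProjectionOnto
  let B : (Fin (N - 1) → ℝ) →L[ℝ] EuclideanSpace ℝ (Fin N) :=
    F.subtypeL.comp e.symm.toContinuousLinearMap
  have hBA : ∀ x, B (A x) = x - inner ℝ ν x • ν := by
    intro x
    have h1 : B (A x) = F.orthogonalProjectionOnto x := by simp [A, B]
    rw [h1]
    exact (Submodule.starProjection_orthogonal_val x).trans
      (by rw [Submodule.starProjection_unit_singleton ℝ hν])
  let Γ : (Fin (N - 1) → ℝ) → EuclideanSpace ℝ (Fin N) := fun y => B y + γ (B y) • ν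
  have hΓ : LipschitzWith (‖B‖₊ + K * ‖B‖₊) Γ := by
    refine B.lipschitz.add ?_
    have h2 := hγ.comp B.lipschitz
    refine LipschitzWith.of_dist_le_mul fun a b => ?_
    rw [dist_eq_norm, ← sub_smul, norm_smul, hν, mul_one, ← dist_eq_norm]
    exact h2.dist_le_mul a b
  refine ⟨r, hr, (‖B‖₊ + K * ‖B‖₊) ^ (N - 1) * (2 * (‖A‖₊ + 1)) ^ (N - 1), fun x ρ hρ => ?_⟩
  set s := frontier Ω ∩ Metric.ball ξ r ∩ Metric.ball x ρ with hs
  have hNc : (N : ℝ) - 1 = ((N - 1 : ℕ) : ℝ) := by rw [Nat.cast_sub hN]; simp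
  have hsub : s ⊆ Γ '' (Metric.ball (A x) ((‖A‖ + 1) * ρ)) := by
    rintro y ⟨⟨hyf, hyr⟩, hyx⟩
    refine ⟨A y, ?_, ?_⟩
    · rw [Metric.mem_ball] at hyx ⊢
      have h1 := A.lipschitz.dist_le_mul y x
      have h2 : (0:ℝ) ≤ dist y x := dist_nonneg
      rw [coe_nnnorm] at h1
      nlinarith [norm_nonneg A]
    -- A frontier point lies in the closure but not in the open set `Ω`, so both inequalities hold
    -- and it is on the graph.
    · have h1 := graph_le_of_mem_closure hγ hΩ hyf.1 hyr
      have h2 : ¬ (γ (y - inner ℝ ν y • ν) < inner ℝ ν y) := by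
        rw [← hΩ y hyr]
        exact (hopen.frontier_eq ▸ hyf).2
      have h3 : γ (y - inner ℝ ν y • ν) = inner ℝ ν y := le_antisymm h1 (not_lt.1 h2)
      simp only [Γ, hBA, h3]
      abel
  refine (measure_mono hsub).trans ?_
  rw [hNc]
  refine (hΓ.hausdorffMeasure_image_le (by positivity) _).trans ?_
  have hvol : (Measure.hausdorffMeasure ((N - 1 : ℕ) : ℝ) : Measure (Fin (N - 1) → ℝ)) = volume := by
    have := hausdorffMeasure_pi_real (ι := Fin (N - 1))
    rwa [Fintype.card_fin] at this
  rw [hvol, Real.volume_pi_ball _ (by positivity), Fintype.card_fin, ENNReal.rpow_natCast]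
  have h2 : ENNReal.ofReal ((2 * ((‖A‖ + 1) * ρ)) ^ (N - 1))
      = ((2 * (‖A‖₊ + 1) : ℝ≥0) : ℝ≥0∞) ^ (N - 1) * ENNReal.ofReal ρ ^ (N - 1) := by
    rw [ENNReal.ofReal_pow (by positivity), ← mul_assoc, ENNReal.ofReal_mul (by positivity), mul_pow]
    congr 2
    rw [← ENNReal.ofReal_coe_nnreal]
    simp
  rw [h2]
  push_cast
  rw [mul_assoc]

theorem isCompact_frontier_of_isBounded {Ω : Set (EuclideanSpace ℝ (Fin N))}
    (hbdd : Bornology.IsBounded Ω) : IsCompact (frontier Ω) :=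
  Metric.isCompact_of_isClosed_isBounded isClosed_frontier
    (hbdd.closure.subset frontier_subset_closure)

theorem HasLipschitzBoundary.exists_surfaceMeasure_ball_le (hN : 1 ≤ N)
    {Ω : Set (EuclideanSpace ℝ (Fin N))} (hopen : IsOpen Ω) (hbdd : Bornology.IsBounded Ω)
    (hlip : HasLipschitzBoundary Ω) : ∃ C : ℝ≥0, ∀ x ρ, 0 < ρ →
      surfaceMeasure Ω (Metric.ball x ρ) ≤ C * ENNReal.ofReal ρ ^ (N - 1) := by
  let μ : Measure (EuclideanSpace ℝ (Fin N)) := Measure.hausdorffMeasure ((N : ℝ) - 1)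
  have key : ∃ C : ℝ≥0, ∀ x ρ, 0 < ρ →
      μ (frontier Ω ∩ Metric.ball x ρ) ≤ C * ENNReal.ofReal ρ ^ (N - 1) := by
    refine (isCompact_frontier_of_isBounded hbdd).induction_on
      (p := fun s => ∃ C : ℝ≥0, ∀ x ρ, 0 < ρ →
        μ (s ∩ Metric.ball x ρ) ≤ C * ENNReal.ofReal ρ ^ (N - 1)) ?_ ?_ ?_ ?_
    · exact ⟨0, by simp⟩
    · rintro s t hst ⟨C, hC⟩
      exact ⟨C, fun x ρ hρ => (measure_mono (by gcongr)).trans (hC x ρ hρ)⟩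
    · rintro s t ⟨C, hC⟩ ⟨D, hD⟩
      refine ⟨C + D, fun x ρ hρ => ?_⟩
      rw [Set.union_inter_distrib_right, ENNReal.coe_add, add_mul]
      exact (measure_union_le _ _).trans (add_le_add (hC x ρ hρ) (hD x ρ hρ))
    · intro ξ hξ
      obtain ⟨r, hr, C, hC⟩ := hlip.exists_hausdorffMeasure_le hN hopen hξ
      exact ⟨frontier Ω ∩ Metric.ball ξ r,
        inter_mem_nhdsWithin _ (Metric.ball_mem_nhds ξ hr), C, hC⟩
  obtain ⟨C, hC⟩ := key
  refine ⟨C, fun x ρ hρ => ?_⟩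
  rw [surfaceMeasure, Measure.restrict_apply Metric.isOpen_ball.measurableSet, Set.inter_comm]
  exact hC x ρ hρ

theorem HasLipschitzBoundary.isFiniteMeasure_surfaceMeasure (hN : 1 ≤ N)
    {Ω : Set (EuclideanSpace ℝ (Fin N))} (hopen : IsOpen Ω) (hbdd : Bornology.IsBounded Ω)
    (hlip : HasLipschitzBoundary Ω) : IsFiniteMeasure (surfaceMeasure Ω) := by
  obtain ⟨C, hC⟩ := hlip.exists_surfaceMeasure_ball_le hN hopen hbdd
  obtain ⟨R, hR⟩ := (isCompact_frontier_of_isBounded hbdd).isBounded.subset_ball_lt 0 0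
  refine ⟨?_⟩
  have h1 : surfaceMeasure Ω Set.univ = surfaceMeasure Ω (Metric.ball 0 R) := by
    rw [surfaceMeasure, Measure.restrict_apply MeasurableSet.univ,
      Measure.restrict_apply Metric.isOpen_ball.measurableSet, Set.univ_inter,
      Set.inter_eq_right.2 hR.2]
  rw [h1]
  refine (hC 0 R hR.1).trans_lt ?_
  exact ENNReal.mul_lt_top ENNReal.coe_lt_top (ENNReal.pow_lt_top ENNReal.ofReal_lt_top)

end Geometry

/-! ### Scaling, integration along rays and Hölder inequalities on the unit interval -/

section Calculus

variable {N : ℕ}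

theorem lintegral_comp_add_smul (F : EuclideanSpace ℝ (Fin N) → ℝ≥0∞) (x : EuclideanSpace ℝ (Fin N))
    {a : ℝ} (ha : a ≠ 0) : ∫⁻ z, F (x + a • z) = ENNReal.ofReal |(a ^ N)⁻¹| * ∫⁻ z, F z := by
  let e : EuclideanSpace ℝ (Fin N) ≃ᵐ EuclideanSpace ℝ (Fin N) :=
    (Homeomorph.smulOfNeZero a ha).toMeasurableEquiv
  have h1 : ∫⁻ z, F (x + a • z) = ∫⁻ z, F (x + z) ∂(Measure.map e volume) := by
    rw [lintegral_map_equiv]; rfl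
  have h2 : Measure.map e volume =
      ENNReal.ofReal |(a ^ N)⁻¹| • (volume : Measure (EuclideanSpace ℝ (Fin N))) := by
    have := Measure.map_addHaar_smul (volume : Measure (EuclideanSpace ℝ (Fin N))) ha
    rwa [finrank_euclideanSpace_fin] at this
  rw [h1, h2, lintegral_smul_measure, lintegral_add_left_eq_self, smul_eq_mul]

theorem norm_gradient_eq (u : EuclideanSpace ℝ (Fin N) → ℝ) (x : EuclideanSpace ℝ (Fin N)) :
    ‖gradient u x‖ = ‖fderiv ℝ u x‖ := by
  rw [gradient, LinearIsometryEquiv.norm_map]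

theorem enorm_gradient_eq (u : EuclideanSpace ℝ (Fin N) → ℝ) (x : EuclideanSpace ℝ (Fin N)) :
    ‖gradient u x‖ₑ = ‖fderiv ℝ u x‖ₑ := by
  rw [← ofReal_norm, norm_gradient_eq, ofReal_norm]

theorem ContDiff.continuous_gradient {u : EuclideanSpace ℝ (Fin N) → ℝ} (hu : ContDiff ℝ 1 u) :
    Continuous (gradient u) :=
  (LinearIsometryEquiv.continuous _).comp (hu.continuous_fderiv one_ne_zero)

theorem enorm_sub_le_lintegral_gradient {u : EuclideanSpace ℝ (Fin N) → ℝ} (hu : ContDiff ℝ 1 u)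
    (x w : EuclideanSpace ℝ (Fin N)) :
    ‖u x - u w‖ₑ ≤ ‖w - x‖ₑ *
      ∫⁻ θ in Set.Ioo (0 : ℝ) 1, ‖gradient u (x + θ • (w - x))‖ₑ := by
  have hd : ∀ θ ∈ Set.uIcc (0 : ℝ) 1, HasDerivAt (fun θ : ℝ => u (x + θ • (w - x)))
      (fderiv ℝ u (x + θ • (w - x)) (w - x)) θ := by
    intro θ _
    have h1 : HasDerivAt (fun θ : ℝ => x + θ • (w - x)) (w - x) θ := by
      simpa using ((hasDerivAt_id θ).smul_const (w - x)).const_add x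
    exact ((hu.differentiable one_ne_zero).differentiableAt.hasFDerivAt).comp_hasDerivAt θ h1
  have hc : Continuous fun θ : ℝ => fderiv ℝ u (x + θ • (w - x)) (w - x) := by
    have := hu.continuous_fderiv one_ne_zero
    fun_prop
  have h2 := intervalIntegral.integral_eq_sub_of_hasDerivAt hd (hc.intervalIntegrable 0 1)
  simp only [one_smul, add_sub_cancel, zero_smul, add_zero] at h2
  have h3 : ‖u x - u w‖ₑ = ‖∫ θ in (0 : ℝ)..1, fderiv ℝ u (x + θ • (w - x)) (w - x)‖ₑ := by
    rw [h2, ← enorm_neg, neg_sub]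
  rw [h3, intervalIntegral.integral_of_le zero_le_one, restrict_Ioo_eq_restrict_Ioc,
    ← lintegral_const_mul' _ _ enorm_ne_top]
  refine (enorm_integral_le_lintegral_enorm _).trans (lintegral_mono fun θ => ?_)
  rw [enorm_gradient_eq, mul_comm]
  exact ContinuousLinearMap.le_opENorm _ _

theorem rpow_lintegral_unitInterval_le {q : ℝ} (hq : 1 ≤ q) {g : ℝ → ℝ≥0∞} (hg : Measurable g) :
    (∫⁻ θ in Set.Ioo (0 : ℝ) 1, g θ) ^ q ≤ ∫⁻ θ in Set.Ioo (0 : ℝ) 1, g θ ^ q := by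
  rcases hq.eq_or_lt with rfl | hq1
  · simp
  have hh := ENNReal.lintegral_mul_le_Lp_mul_Lq (volume.restrict (Set.Ioo (0 : ℝ) 1))
    (Real.HolderConjugate.conjExponent hq1) hg.aemeasurable (aemeasurable_const (b := (1 : ℝ≥0∞)))
  simp only [Pi.mul_apply, mul_one, ENNReal.one_rpow, lintegral_const, Measure.restrict_apply,
    MeasurableSet.univ, Set.univ_inter, Real.volume_Ioo, sub_zero, ENNReal.ofReal_one] at hh
  calc _ ≤ ((∫⁻ θ in Set.Ioo (0 : ℝ) 1, g θ ^ q) ^ (1 / q)) ^ q :=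
        ENNReal.rpow_le_rpow hh (by linarith)
    _ = _ := by rw [← ENNReal.rpow_mul, one_div_mul_cancel (by linarith), ENNReal.rpow_one]

theorem lintegral_unitInterval_rpow_lt_top {a : ℝ} (ha : -1 < a) :
    ∫⁻ θ in Set.Ioo (0 : ℝ) 1, ENNReal.ofReal (θ ^ a) < ⊤ := by
  have h1 : IntegrableOn (fun θ : ℝ => θ ^ a) (Set.Ioo 0 1) :=
    (intervalIntegral.integrableOn_Ioo_rpow_iff zero_lt_one).2 ha
  have h2 := h1.hasFiniteIntegral
  refine lt_of_le_of_lt (lintegral_mono fun θ => ?_) h2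
  exact Real.ofReal_le_enorm _

/-- Hölder for `g = (θ^b g) θ^(-b)` with `b = (q - 1) / (2 q)`: the dual factor is a power of `∫
θ^(-1/2)`, hence finite. The positive power of `θ` gained here makes the `θ`-integral of the
Gagliardo estimate converge; it is available only for `q > 1`. -/
theorem exists_rpow_lintegral_unitInterval_le_weighted {q : ℝ} (hq : 1 < q) :
    ∃ K : ℝ≥0, ∀ g : ℝ → ℝ≥0∞, Measurable g →
    (∫⁻ θ in Set.Ioo (0 : ℝ) 1, g θ) ^ q ≤
      K * ∫⁻ θ in Set.Ioo (0 : ℝ) 1, ENNReal.ofReal (θ ^ ((q - 1) / 2)) * g θ ^ q := by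
  let q' := Real.conjExponent q
  have hqq : q.HolderConjugate q' := Real.HolderConjugate.conjExponent hq
  set b : ℝ := (q - 1) / 2 / q with hb
  have hq0 : 0 < q := by linarith
  have hq'0 : 0 < q' := hqq.symm.pos
  have hbq : -b * q' = -(1 / 2) := by
    have : q' = q / (q - 1) := rfl
    rw [this, hb]
    have : q - 1 ≠ 0 := by linarith
    field_simp
  set A := ∫⁻ θ in Set.Ioo (0 : ℝ) 1, ENNReal.ofReal (θ ^ (-(1 / 2) : ℝ)) with hA
  have hAfin : A < ⊤ := lintegral_unitInterval_rpow_lt_top (by norm_num)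
  have hAr : (A ^ (1 / q')) ^ q ≠ ⊤ :=
    (ENNReal.rpow_lt_top_of_nonneg hq0.le
      (ENNReal.rpow_lt_top_of_nonneg (by positivity) hAfin.ne).ne).ne
  refine ⟨((A ^ (1 / q')) ^ q).toNNReal, fun g hg => ?_⟩
  rw [ENNReal.coe_toNNReal hAr]
  have hm : ∀ a : ℝ, Measurable fun θ : ℝ => ENNReal.ofReal (θ ^ a) := fun a => by fun_prop
  have hh := ENNReal.lintegral_mul_le_Lp_mul_Lq (volume.restrict (Set.Ioo (0 : ℝ) 1)) hqq
    ((hm b).mul hg).aemeasurable (hm (-b)).aemeasurable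
  have e1 : ∫⁻ θ in Set.Ioo (0 : ℝ) 1, g θ = ∫⁻ θ in Set.Ioo (0 : ℝ) 1,
      (((fun θ : ℝ => ENNReal.ofReal (θ ^ b)) * g) * fun θ : ℝ => ENNReal.ofReal (θ ^ (-b))) θ := by
    refine setLIntegral_congr_fun measurableSet_Ioo fun θ hθ => ?_
    simp only [Pi.mul_apply]
    rw [mul_right_comm, ← ENNReal.ofReal_mul (Real.rpow_nonneg hθ.1.le _), ← Real.rpow_add hθ.1]
    simp
  have e2 : ∫⁻ θ in Set.Ioo (0 : ℝ) 1, ((fun θ : ℝ => ENNReal.ofReal (θ ^ b)) * g) θ ^ q =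
      ∫⁻ θ in Set.Ioo (0 : ℝ) 1, ENNReal.ofReal (θ ^ ((q - 1) / 2)) * g θ ^ q := by
    refine setLIntegral_congr_fun measurableSet_Ioo fun θ hθ => ?_
    simp only [Pi.mul_apply]
    rw [ENNReal.mul_rpow_of_nonneg _ _ hq0.le, ENNReal.ofReal_rpow_of_pos (Real.rpow_pos_of_pos hθ.1 _),
      ← Real.rpow_mul hθ.1.le, hb, div_mul_cancel₀ _ hq0.ne']
  have e3 : ∫⁻ θ in Set.Ioo (0 : ℝ) 1, (fun θ : ℝ => ENNReal.ofReal (θ ^ (-b))) θ ^ q' = A := by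
    refine setLIntegral_congr_fun measurableSet_Ioo fun θ hθ => ?_
    simp only
    rw [ENNReal.ofReal_rpow_of_pos (Real.rpow_pos_of_pos hθ.1 _), ← Real.rpow_mul hθ.1.le, hbq]
  rw [← e1, e2, e3] at hh
  refine (ENNReal.rpow_le_rpow hh hq0.le).trans ?_
  rw [ENNReal.mul_rpow_of_nonneg _ _ hq0.le, ← ENNReal.rpow_mul (∫⁻ _ in _, _),
    one_div_mul_cancel hq0.ne', ENNReal.rpow_one, mul_comm]

theorem lintegral_rotate {X Y Z : Type*} [MeasurableSpace X] [MeasurableSpace Y] [MeasurableSpace Z]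
    {μ : Measure X} {ν : Measure Y} {τ : Measure Z} [SFinite μ] [SFinite ν] [SFinite τ]
    {g : X → Y → Z → ℝ≥0∞} (hg : Measurable fun a : X × Y × Z => g a.1 a.2.1 a.2.2) :
    ∫⁻ x, ∫⁻ y, ∫⁻ z, g x y z ∂τ ∂ν ∂μ = ∫⁻ y, ∫⁻ z, ∫⁻ x, g x y z ∂μ ∂τ ∂ν := by
  rw [lintegral_lintegral_swap]
  · refine lintegral_congr fun y => ?_
    rw [lintegral_lintegral_swap]
    exact (hg.comp (f := fun a : X × Z => (a.1, y, a.2)) (by fun_prop)).aemeasurable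
  · refine Measurable.aemeasurable ?_
    exact Measurable.lintegral_prod_right' (f := fun a : (X × Y) × Z => g a.1.1 a.1.2 a.2)
      (hg.comp (f := fun a : (X × Y) × Z => (a.1.1, a.1.2, a.2)) (by fun_prop))

end Calculus

/-! ### Energy estimates along interior cones -/

section ConeEnergy

variable {N : ℕ}

open Classical in
/-- Indicator of the configurations in which `z` has distance comparable to `θ s` both from the
boundary of `Ω` and from `x`. -/
noncomputable def coneWeight (Ω : Set (EuclideanSpace ℝ (Fin N))) (M s : ℝ)
    (x : EuclideanSpace ℝ (Fin N)) (θ : ℝ) (z : EuclideanSpace ℝ (Fin N)) : ℝ≥0∞ :=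
  if Metric.infDist z (frontier Ω) ≤ M * (θ * s) ∧ θ * s ≤ M * Metric.infDist z (frontier Ω) ∧
    dist x z < M * Metric.infDist z (frontier Ω) then 1 else 0

theorem measurable_coneWeight {α : Type*} [MeasurableSpace α]
    (Ω : Set (EuclideanSpace ℝ (Fin N))) (M : ℝ) {s θ : α → ℝ}
    {x z : α → EuclideanSpace ℝ (Fin N)} (hs : Measurable s) (hx : Measurable x)
    (hθ : Measurable θ) (hz : Measurable z) :
    Measurable fun a => coneWeight Ω M (s a) (x a) (θ a) (z a) := by
  have hδ : Measurable fun a => Metric.infDist (z a) (frontier Ω) :=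
    (Metric.continuous_infDist_pt _).measurable.comp hz
  unfold coneWeight
  refine Measurable.ite ?_ measurable_const measurable_const
  exact (measurableSet_le hδ ((hθ.mul hs).const_mul M)).inter
    ((measurableSet_le (hθ.mul hs) (hδ.const_mul M)).inter
      (measurableSet_lt (hx.dist hz) (hδ.const_mul M)))

/-- The fundamental theorem of calculus on the segment from `x` to `w`, `hK` to bring the power
inside, and the substitution `z = x + θ (w - x)` with Jacobian `θ^(-N)`. The image points lie well
inside the cone, where boundary distance and `θ s` are comparable and control `dist x z`;
`coneWeight` records this. The inequality `hK` is kept abstract since the trace estimate uses it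
with `β = 0` and the Gagliardo estimate with `β > 0`. -/
theorem IsInteriorCone.lintegral_sub_rpow_le {Ω : Set (EuclideanSpace ℝ (Fin N))}
    (hopen : IsOpen Ω) {ξ ν : EuclideanSpace ℝ (Fin N)} {r c h : ℝ}
    (hcone : IsInteriorCone Ω ξ ν r c h) {q β : ℝ} {K : ℝ≥0} (hq : 1 ≤ q)
    (hK : ∀ g : ℝ → ℝ≥0∞, Measurable g → (∫⁻ θ in Set.Ioo (0 : ℝ) 1, g θ) ^ q ≤
      K * ∫⁻ θ in Set.Ioo (0 : ℝ) 1, ENNReal.ofReal (θ ^ β) * g θ ^ q)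
    {x : EuclideanSpace ℝ (Fin N)} (hxf : x ∈ frontier Ω) (hxr : x ∈ Metric.ball ξ r)
    {s : ℝ} (hs : 0 < s) (hsh : s < h) {u : EuclideanSpace ℝ (Fin N) → ℝ} (hu : ContDiff ℝ 1 u) :
    ∫⁻ w in Metric.ball (x + s • ν) (c * s / 2), ‖u x - u w‖ₑ ^ q ≤
      ENNReal.ofReal (2 * s) ^ q * K * ∫⁻ θ in Set.Ioo (0 : ℝ) 1, ∫⁻ z in Ω,
        ENNReal.ofReal (θ ^ β * (θ ^ N)⁻¹) * ‖gradient u z‖ₑ ^ q *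
          coneWeight Ω (4 / c) s x θ z := by
  have hc := hcone.c_pos
  have hq0 : 0 ≤ q := by linarith
  have hgm : Measurable fun z => ‖gradient u z‖ₑ ^ q :=
    (hu.continuous_gradient.measurable.enorm).pow_const q
  have hνn : ∀ a : ℝ, 0 ≤ a → ‖a • ν‖ ≤ a := fun a ha => by
    rw [norm_smul, Real.norm_eq_abs, abs_of_nonneg ha]
    exact mul_le_of_le_one_right ha hcone.norm_le
  have step1 : ∀ w ∈ Metric.ball (x + s • ν) (c * s / 2), ‖u x - u w‖ₑ ^ q ≤
      ENNReal.ofReal (2 * s) ^ q * K * ∫⁻ θ in Set.Ioo (0 : ℝ) 1,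
        ENNReal.ofReal (θ ^ β) * ‖gradient u (x + θ • (w - x))‖ₑ ^ q := by
    intro w hw
    have hwx : ‖w - x‖ ≤ 2 * s := by
      rw [Metric.mem_ball, dist_eq_norm] at hw
      have e : w - x = (w - (x + s • ν)) + s • ν := by abel
      rw [e]
      have h1 := norm_add_le (w - (x + s • ν)) (s • ν)
      have h2 := hνn s hs.le
      nlinarith [hcone.c_le]
    have hm : Measurable fun θ : ℝ => ‖gradient u (x + θ • (w - x))‖ₑ :=
      (hu.continuous_gradient.comp (by fun_prop)).measurable.enorm
    calc ‖u x - u w‖ₑ ^ q ≤ (ENNReal.ofReal (2 * s) *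
          ∫⁻ θ in Set.Ioo (0 : ℝ) 1, ‖gradient u (x + θ • (w - x))‖ₑ) ^ q := by
          refine ENNReal.rpow_le_rpow ((enorm_sub_le_lintegral_gradient hu x w).trans ?_) hq0
          gcongr
          rw [← ofReal_norm]
          exact ENNReal.ofReal_le_ofReal hwx
      _ ≤ _ := by
          rw [ENNReal.mul_rpow_of_nonneg _ _ hq0, mul_assoc]
          gcongr
          exact hK _ hm
  have step2 : ∀ θ ∈ Set.Ioo (0 : ℝ) 1,
      ∫⁻ w in Metric.ball (x + s • ν) (c * s / 2), ‖gradient u (x + θ • (w - x))‖ₑ ^ q ≤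
      ∫⁻ z in Ω, ENNReal.ofReal ((θ ^ N)⁻¹) * ‖gradient u z‖ₑ ^ q *
        coneWeight Ω (4 / c) s x θ z := by
    rintro θ ⟨hθ0, hθ1⟩
    set D := Metric.ball (x + (θ * s) • ν) (c * (θ * s) / 2) with hD
    have hθs : 0 < θ * s := mul_pos hθ0 hs
    have hθsh : θ * s < h := by nlinarith
    have e1 : ∫⁻ w in Metric.ball (x + s • ν) (c * s / 2), ‖gradient u (x + θ • (w - x))‖ₑ ^ q =
        ∫⁻ w, D.indicator (fun z => ‖gradient u z‖ₑ ^ q) ((x - θ • x) + θ • w) := by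
      rw [← lintegral_indicator Metric.isOpen_ball.measurableSet]
      refine lintegral_congr fun w => ?_
      have e : (x - θ • x) + θ • w = x + θ • (w - x) := by rw [smul_sub]; abel
      rw [e]
      have hiff : w ∈ Metric.ball (x + s • ν) (c * s / 2) ↔ x + θ • (w - x) ∈ D := by
        rw [hD, Metric.mem_ball, Metric.mem_ball, dist_eq_norm, dist_eq_norm]
        have e' : x + θ • (w - x) - (x + (θ * s) • ν) = θ • (w - (x + s • ν)) := by module
        rw [e', norm_smul, Real.norm_eq_abs, abs_of_pos hθ0,
          show c * (θ * s) / 2 = θ * (c * s / 2) by ring]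
        exact (mul_lt_mul_iff_right₀ hθ0).symm
      by_cases hw : w ∈ Metric.ball (x + s • ν) (c * s / 2)
      · rw [Set.indicator_of_mem hw, Set.indicator_of_mem (hiff.1 hw)]
      · rw [Set.indicator_of_notMem hw, Set.indicator_of_notMem (mt hiff.2 hw)]
    rw [e1, lintegral_comp_add_smul _ _ hθ0.ne', abs_of_pos (by positivity),
      ← lintegral_const_mul' _ _ ENNReal.ofReal_ne_top, ← lintegral_indicator hopen.measurableSet]
    refine lintegral_mono fun z => ?_
    by_cases hz : z ∈ D
    swap
    · rw [Set.indicator_of_notMem hz, mul_zero]; exact zero_le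
    have hzD : dist z (x + (θ * s) • ν) < c * (θ * s) / 2 := hz
    -- The cone contains a ball of radius `c θ s` at height `θ s`, and `z` is within half that
    -- radius of its centre.
    have hbig : Metric.ball z (c * (θ * s) / 2) ⊆ Ω := by
      refine subset_trans ?_ (hcone.ball_subset x (frontier_subset_closure hxf) hxr _ hθs hθsh)
      refine Metric.ball_subset_ball' ?_
      linarith
    have hzΩ : z ∈ Ω := hbig (Metric.mem_ball_self (by positivity))
    have hδ1 := infDist_frontier_ge_of_ball_subset hopen ⟨x, hxf⟩ hbig
    have hδ2 : Metric.infDist z (frontier Ω) ≤ dist z x := Metric.infDist_le_dist_of_mem hxf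
    have hzx : dist z x < 2 * (θ * s) := by
      have h1 := dist_triangle z (x + (θ * s) • ν) x
      have h2 : dist (x + (θ * s) • ν) x ≤ θ * s := by
        rw [dist_eq_norm, add_sub_cancel_left]; exact hνn _ hθs.le
      have h3 : c * (θ * s) / 2 ≤ θ * s := by nlinarith [hcone.c_le]
      linarith
    -- With boundary distance at least `c θ s / 2`, the factor `4 / c` makes it exceed `dist x z`,
    -- which is below `2 θ s`.
    have hM : (4 / c) * (c * (θ * s) / 2) = 2 * (θ * s) := by field_simp; norm_num
    have hM4 : 4 ≤ 4 / c := by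
      rw [le_div_iff₀ hc]; linarith [hcone.c_le]
    have hM' : 2 * (θ * s) ≤ 4 / c * Metric.infDist z (frontier Ω) := by
      rw [← hM]; gcongr
    rw [Set.indicator_of_mem hz, Set.indicator_of_mem hzΩ, coneWeight, if_pos, mul_one]
    refine ⟨?_, ?_, ?_⟩
    · nlinarith
    · linarith
    · rw [dist_comm]; linarith
  have hjoint : Measurable (Function.uncurry fun (w : EuclideanSpace ℝ (Fin N)) (θ : ℝ) =>
      ENNReal.ofReal (θ ^ β) * ‖gradient u (x + θ • (w - x))‖ₑ ^ q) := by
    refine Measurable.mul (by fun_prop) ?_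
    exact hgm.comp (f := fun a : EuclideanSpace ℝ (Fin N) × ℝ => x + a.2 • (a.1 - x)) (by fun_prop)
  calc _ ≤ ∫⁻ w in Metric.ball (x + s • ν) (c * s / 2), ENNReal.ofReal (2 * s) ^ q * K *
        ∫⁻ θ in Set.Ioo (0 : ℝ) 1,
          ENNReal.ofReal (θ ^ β) * ‖gradient u (x + θ • (w - x))‖ₑ ^ q :=
        setLIntegral_mono' Metric.isOpen_ball.measurableSet step1
    _ = ENNReal.ofReal (2 * s) ^ q * K * ∫⁻ θ in Set.Ioo (0 : ℝ) 1,
        ∫⁻ w in Metric.ball (x + s • ν) (c * s / 2),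
          ENNReal.ofReal (θ ^ β) * ‖gradient u (x + θ • (w - x))‖ₑ ^ q := by
        rw [lintegral_const_mul' _ _ (ENNReal.mul_ne_top
          (ENNReal.rpow_ne_top_of_nonneg hq0 ENNReal.ofReal_ne_top) ENNReal.coe_ne_top),
          lintegral_lintegral_swap hjoint.aemeasurable]
    _ ≤ _ := by
        gcongr 1
        refine setLIntegral_mono' measurableSet_Ioo fun θ hθ => ?_
        rw [lintegral_const_mul' _ _ ENNReal.ofReal_ne_top]
        refine (mul_le_mul_right (step2 θ hθ) _).trans_eq ?_
        rw [← lintegral_const_mul' _ _ ENNReal.ofReal_ne_top]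
        refine lintegral_congr fun z => ?_
        rw [ENNReal.ofReal_mul (Real.rpow_nonneg hθ.1.le _)]
        ring

/-- Tonelli with `z` outermost. At boundary distance `δ` the weight confines `x` to a ball of radius
`M δ`, of measure at most a multiple of `δ^(N-1)`, bounds `θ^(-N)` by `(M s / δ)^N`, and confines
`θ` to an interval of length `M δ / s`. The powers of `δ` cancel. -/
theorem lintegral_coneWeight_le {Ω : Set (EuclideanSpace ℝ (Fin N))}
    (hN : 1 ≤ N) (hopen : IsOpen Ω) (hne : (frontier Ω).Nonempty)
    [IsFiniteMeasure (surfaceMeasure Ω)] {C : ℝ≥0}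
    (hC : ∀ x ρ, 0 < ρ →
      surfaceMeasure Ω (Metric.ball x ρ) ≤ C * ENNReal.ofReal ρ ^ (N - 1))
    {M s : ℝ} (hM : 0 < M) (hs : 0 < s) {F : EuclideanSpace ℝ (Fin N) → ℝ≥0∞} (hF : Measurable F) :
    ∫⁻ x, (∫⁻ θ in Set.Ioo (0 : ℝ) 1, ∫⁻ z in Ω, ENNReal.ofReal ((θ ^ N)⁻¹) * F z *
      coneWeight Ω M s x θ z) ∂(surfaceMeasure Ω) ≤
    C * ENNReal.ofReal (M ^ (2 * N) * s ^ (N - 1)) * ∫⁻ z in Ω, F z := by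
  have hδm : Measurable fun z => Metric.infDist z (frontier Ω) :=
    (Metric.continuous_infDist_pt _).measurable
  have hδpos : ∀ z ∈ Ω, 0 < Metric.infDist z (frontier Ω) := by
    intro z hz
    obtain ⟨ε, hε, hb⟩ := Metric.isOpen_iff.1 hopen z hz
    exact hε.trans_le (infDist_frontier_ge_of_ball_subset hopen hne hb)
  rw [lintegral_rotate]
  swap
  · exact Measurable.mul (Measurable.mul (by fun_prop) (hF.comp (by fun_prop)))
      (measurable_coneWeight Ω M (by fun_prop) (by fun_prop) (by fun_prop) (by fun_prop))
  have hinner : ∀ θ ∈ Set.Ioo (0 : ℝ) 1, ∀ z ∈ Ω,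
      ∫⁻ x, ENNReal.ofReal ((θ ^ N)⁻¹) * F z * coneWeight Ω M s x θ z ∂(surfaceMeasure Ω) ≤
      F z * (ENNReal.ofReal ((M * s / Metric.infDist z (frontier Ω)) ^ N) *
        (C * ENNReal.ofReal (M * Metric.infDist z (frontier Ω)) ^ (N - 1)) *
        (Set.Ioc 0 (M * Metric.infDist z (frontier Ω) / s)).indicator 1 θ) := by
    intro θ hθ z hz
    set δ := Metric.infDist z (frontier Ω) with hδ
    have hδ0 : 0 < δ := hδpos z hz
    have hb : ∀ x, ENNReal.ofReal ((θ ^ N)⁻¹) * F z * coneWeight Ω M s x θ z ≤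
        F z * (ENNReal.ofReal ((M * s / δ) ^ N) * (Set.Ioc 0 (M * δ / s)).indicator 1 θ) *
          (Metric.ball z (M * δ)).indicator 1 x := by
      intro x
      unfold coneWeight
      rw [← hδ]
      split_ifs with hcond
      swap
      · simp
      obtain ⟨h1, h2, h3⟩ := hcond
      rw [Set.indicator_of_mem (show x ∈ Metric.ball z (M * δ) from h3),
        Set.indicator_of_mem (show θ ∈ Set.Ioc 0 (M * δ / s) from
          ⟨hθ.1, by rw [le_div_iff₀ hs]; exact h2⟩)]
      simp only [Pi.one_apply, mul_one]
      rw [mul_comm]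
      gcongr
      rw [← inv_pow]
      refine pow_le_pow_left₀ (inv_nonneg.2 hθ.1.le) ?_ _
      rw [inv_le_iff_one_le_mul₀ hθ.1, div_mul_eq_mul_div, one_le_div hδ0]
      linarith
    refine (lintegral_mono hb).trans ?_
    rw [lintegral_const_mul _ (measurable_one.indicator Metric.isOpen_ball.measurableSet),
      lintegral_indicator_one Metric.isOpen_ball.measurableSet]
    refine (mul_le_mul_right (hC z (M * δ) (by positivity)) _).trans_eq ?_
    ring
  calc _ ≤ ∫⁻ θ in Set.Ioo (0 : ℝ) 1, ∫⁻ z in Ω,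
      F z * (ENNReal.ofReal ((M * s / Metric.infDist z (frontier Ω)) ^ N) *
        (C * ENNReal.ofReal (M * Metric.infDist z (frontier Ω)) ^ (N - 1)) *
        (Set.Ioc 0 (M * Metric.infDist z (frontier Ω) / s)).indicator 1 θ) :=
        setLIntegral_mono' measurableSet_Ioo fun θ hθ =>
          setLIntegral_mono' hopen.measurableSet fun z hz => hinner θ hθ z hz
    _ = ∫⁻ z in Ω, ∫⁻ θ in Set.Ioo (0 : ℝ) 1,
      F z * (ENNReal.ofReal ((M * s / Metric.infDist z (frontier Ω)) ^ N) *
        (C * ENNReal.ofReal (M * Metric.infDist z (frontier Ω)) ^ (N - 1)) *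
        (Set.Ioc 0 (M * Metric.infDist z (frontier Ω) / s)).indicator 1 θ) := by
        refine lintegral_lintegral_swap (Measurable.aemeasurable ?_)
        refine Measurable.mul (hF.comp measurable_snd) (Measurable.mul (by fun_prop) ?_)
        have : (Function.uncurry fun (θ : ℝ) (z : EuclideanSpace ℝ (Fin N)) =>
            (Set.Ioc 0 (M * Metric.infDist z (frontier Ω) / s)).indicator (1 : ℝ → ℝ≥0∞) θ) =
            Set.indicator {a : ℝ × EuclideanSpace ℝ (Fin N) | 0 < a.1 ∧
              a.1 ≤ M * Metric.infDist a.2 (frontier Ω) / s} 1 := rfl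
        change Measurable (Function.uncurry fun (θ : ℝ) (z : EuclideanSpace ℝ (Fin N)) =>
            (Set.Ioc 0 (M * Metric.infDist z (frontier Ω) / s)).indicator (1 : ℝ → ℝ≥0∞) θ)
        rw [this]
        refine measurable_one.indicator ?_
        exact (measurableSet_lt measurable_const measurable_fst).inter
          (measurableSet_le measurable_fst
            (((hδm.comp measurable_snd).const_mul M).div_const s))
    _ ≤ ∫⁻ z in Ω, C * ENNReal.ofReal (M ^ (2 * N) * s ^ (N - 1)) * F z := by
        refine setLIntegral_mono' hopen.measurableSet fun z hz => ?_
        set δ := Metric.infDist z (frontier Ω) with hδ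
        have hδ0 : 0 < δ := hδpos z hz
        have hind : ∫⁻ θ in Set.Ioo (0 : ℝ) 1,
            (Set.Ioc 0 (M * δ / s)).indicator (1 : ℝ → ℝ≥0∞) θ ≤ ENNReal.ofReal (M * δ / s) := by
          refine (setLIntegral_le_lintegral _ _).trans ?_
          rw [lintegral_indicator_one measurableSet_Ioc, Real.volume_Ioc, sub_zero]
        have hmi : Measurable fun θ : ℝ => (Set.Ioc 0 (M * δ / s)).indicator (1 : ℝ → ℝ≥0∞) θ :=
          measurable_one.indicator measurableSet_Ioc
        rw [lintegral_const_mul _ (hmi.const_mul _), lintegral_const_mul _ hmi]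
        refine (mul_le_mul_right (mul_le_mul_right hind _) _).trans_eq ?_
        rw [← ENNReal.ofReal_pow (by positivity)]
        have e : M ^ (2 * N) * s ^ (N - 1) =
            (M * s / δ) ^ N * (M * δ) ^ (N - 1) * (M * δ / s) := by
          obtain ⟨n, rfl⟩ : ∃ n, N = n + 1 := ⟨N - 1, by omega⟩
          simp only [Nat.add_sub_cancel, div_pow, mul_pow]
          field_simp
          ring
        rw [e, ENNReal.ofReal_mul (by positivity), ENNReal.ofReal_mul (by positivity)]
        ring
    _ = _ := by
        rw [lintegral_const_mul' _ _ (ENNReal.mul_ne_top ENNReal.coe_ne_top ENNReal.ofReal_ne_top)]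

/-- For fixed `θ` and `z` the weight at scale `M * dist x y` forces `dist x y` to be comparable to
`δ / θ`, where `δ` is the boundary distance of `z`. Then `y` runs over a ball of radius `2 δ / θ`
about `x` and `x` over a ball of radius `M δ` about `z`. All powers of `δ` cancel and `θ^(β - 1)`
remains, which is integrable for `β > 0`. -/
theorem lintegral_lintegral_coneWeight_le {Ω : Set (EuclideanSpace ℝ (Fin N))}
    (hN : 1 ≤ N) (hopen : IsOpen Ω) (hne : (frontier Ω).Nonempty)
    [IsFiniteMeasure (surfaceMeasure Ω)] {C : ℝ≥0}
    (hC : ∀ x ρ, 0 < ρ →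
      surfaceMeasure Ω (Metric.ball x ρ) ≤ C * ENNReal.ofReal ρ ^ (N - 1))
    {M β : ℝ} (hM : 0 < M) {F : EuclideanSpace ℝ (Fin N) → ℝ≥0∞} (hF : Measurable F) :
    ∫⁻ x, ∫⁻ y, (∫⁻ θ in Set.Ioo (0 : ℝ) 1, ∫⁻ z in Ω,
      ENNReal.ofReal ((dist x y ^ (2 * (N - 1)))⁻¹) *
        (ENNReal.ofReal (θ ^ β * (θ ^ N)⁻¹) * F z * coneWeight Ω M (M * dist x y) x θ z))
      ∂(surfaceMeasure Ω) ∂(surfaceMeasure Ω) ≤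
    C ^ 2 * ENNReal.ofReal (M ^ (5 * (N - 1)) * 2 ^ (N - 1)) *
      (∫⁻ θ in Set.Ioo (0 : ℝ) 1, ENNReal.ofReal (θ ^ (β - 1))) * ∫⁻ z in Ω, F z := by
  have hδm : Measurable fun z => Metric.infDist z (frontier Ω) :=
    (Metric.continuous_infDist_pt _).measurable
  have hδpos : ∀ z ∈ Ω, 0 < Metric.infDist z (frontier Ω) := by
    intro z hz
    obtain ⟨ε, hε, hb⟩ := Metric.isOpen_iff.1 hopen z hz
    exact hε.trans_le (infDist_frontier_ge_of_ball_subset hopen hne hb)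
  let A : ℝ → EuclideanSpace ℝ (Fin N) → ℝ≥0∞ := fun θ z =>
    ENNReal.ofReal (θ ^ β * (θ ^ N)⁻¹) * F z *
      (ENNReal.ofReal ((M ^ 2 * θ / Metric.infDist z (frontier Ω)) ^ (2 * (N - 1))) *
        (C * ENNReal.ofReal (2 * Metric.infDist z (frontier Ω) / θ) ^ (N - 1)))
  have hAm : Measurable (Function.uncurry A) := by
    refine Measurable.mul (Measurable.mul (by fun_prop) (hF.comp measurable_snd)) ?_
    fun_prop
  let J : EuclideanSpace ℝ (Fin N) → EuclideanSpace ℝ (Fin N) → ℝ≥0∞ := fun x z =>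
    Set.indicator {a : EuclideanSpace ℝ (Fin N) × EuclideanSpace ℝ (Fin N) |
      dist a.1 a.2 < M * Metric.infDist a.2 (frontier Ω)} 1 (x, z)
  have hJm : Measurable (Function.uncurry J) := by
    refine measurable_one.indicator ?_
    exact measurableSet_lt (by fun_prop) (by fun_prop)
  have hy : ∀ x, ∫⁻ y, (∫⁻ θ in Set.Ioo (0 : ℝ) 1, ∫⁻ z in Ω,
      ENNReal.ofReal ((dist x y ^ (2 * (N - 1)))⁻¹) *
        (ENNReal.ofReal (θ ^ β * (θ ^ N)⁻¹) * F z * coneWeight Ω M (M * dist x y) x θ z))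
      ∂(surfaceMeasure Ω) ≤ ∫⁻ θ in Set.Ioo (0 : ℝ) 1, ∫⁻ z in Ω, A θ z * J x z := by
    intro x
    rw [lintegral_rotate]
    swap
    · refine Measurable.mul (by fun_prop) ?_
      exact Measurable.mul (Measurable.mul (by fun_prop) (hF.comp (by fun_prop)))
        (measurable_coneWeight Ω M (by fun_prop) (by fun_prop) (by fun_prop) (by fun_prop))
    refine setLIntegral_mono' measurableSet_Ioo fun θ hθ =>
      setLIntegral_mono' hopen.measurableSet fun z hz => ?_
    set δ := Metric.infDist z (frontier Ω) with hδ
    have hδ0 : 0 < δ := hδpos z hz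
    have hθ0 := hθ.1
    have hb : ∀ y, ENNReal.ofReal ((dist x y ^ (2 * (N - 1)))⁻¹) *
        (ENNReal.ofReal (θ ^ β * (θ ^ N)⁻¹) * F z * coneWeight Ω M (M * dist x y) x θ z) ≤
        ENNReal.ofReal (θ ^ β * (θ ^ N)⁻¹) * F z *
          ENNReal.ofReal ((M ^ 2 * θ / δ) ^ (2 * (N - 1))) * J x z *
          (Metric.ball x (2 * δ / θ)).indicator 1 y := by
      intro y
      unfold coneWeight
      rw [← hδ]
      split_ifs with hcond
      swap
      · simp
      obtain ⟨h1, h2, h3⟩ := hcond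
      -- On the diagonal the weight vanishes because `δ > 0`, so the value of the inverse at zero is
      -- irrelevant.
      have hd : 0 < dist x y := by
        by_contra! hneg
        have : dist x y = 0 := le_antisymm hneg dist_nonneg
        rw [this] at h1
        simp only [mul_zero] at h1
        linarith
      have hd2 : θ * dist x y ≤ δ := by
        have : M * (θ * dist x y) ≤ M * δ := by linarith [h2]
        exact le_of_mul_le_mul_left this hM
      -- The factor `2` turns `dist x y ≤ δ / θ` into the strict inequality of an open ball.
      have hmem : y ∈ Metric.ball x (2 * δ / θ) := by
        rw [Metric.mem_ball, dist_comm, lt_div_iff₀ hθ0]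
        linarith
      have hJ : J x z = 1 := Set.indicator_of_mem (by exact h3) _
      rw [Set.indicator_of_mem hmem, hJ]
      simp only [Pi.one_apply, mul_one]
      rw [mul_comm]
      gcongr
      rw [← inv_pow]
      refine pow_le_pow_left₀ (inv_nonneg.2 hd.le) ?_ _
      rw [inv_le_iff_one_le_mul₀ hd, div_mul_eq_mul_div, one_le_div hδ0]
      nlinarith
    refine (lintegral_mono hb).trans ?_
    rw [lintegral_const_mul _ (measurable_one.indicator Metric.isOpen_ball.measurableSet),
      lintegral_indicator_one Metric.isOpen_ball.measurableSet]
    refine (mul_le_mul_right (hC x (2 * δ / θ) (by positivity)) _).trans_eq ?_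
    simp only [A]
    ring
  refine (lintegral_mono hy).trans ?_
  rw [lintegral_rotate]
  swap
  · exact Measurable.mul
      (hAm.comp (f := fun a : EuclideanSpace ℝ (Fin N) × ℝ × EuclideanSpace ℝ (Fin N) =>
        (a.2.1, a.2.2)) (by fun_prop))
      (hJm.comp (f := fun a : EuclideanSpace ℝ (Fin N) × ℝ × EuclideanSpace ℝ (Fin N) =>
        (a.1, a.2.2)) (by fun_prop))
  have hx : ∀ θ ∈ Set.Ioo (0 : ℝ) 1, ∀ z ∈ Ω, ∫⁻ x, A θ z * J x z ∂(surfaceMeasure Ω) ≤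
      C ^ 2 * ENNReal.ofReal (M ^ (5 * (N - 1)) * 2 ^ (N - 1)) * ENNReal.ofReal (θ ^ (β - 1)) *
        F z := by
    intro θ hθ z hz
    have hδ0 := hδpos z hz
    have hθ0 := hθ.1
    have hJ : ∫⁻ x, J x z ∂(surfaceMeasure Ω) ≤
        C * ENNReal.ofReal (M * Metric.infDist z (frontier Ω)) ^ (N - 1) := by
      have e : (fun x => J x z) =
          (Metric.ball z (M * Metric.infDist z (frontier Ω))).indicator 1 := rfl
      rw [e, lintegral_indicator_one Metric.isOpen_ball.measurableSet]
      exact hC _ _ (by positivity)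
    have hJz : Measurable fun x => J x z := hJm.comp (f := fun x => (x, z)) (by fun_prop)
    rw [lintegral_const_mul _ hJz]
    refine (mul_le_mul_right hJ _).trans_eq ?_
    simp only [A]
    set δ := Metric.infDist z (frontier Ω)
    have e : M ^ (5 * (N - 1)) * 2 ^ (N - 1) * θ ^ (β - 1) =
        θ ^ β * (θ ^ N)⁻¹ * (M ^ 2 * θ / δ) ^ (2 * (N - 1)) * (2 * δ / θ) ^ (N - 1) *
          (M * δ) ^ (N - 1) := by
      obtain ⟨n, rfl⟩ : ∃ n, N = n + 1 := ⟨N - 1, by omega⟩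
      simp only [Nat.add_sub_cancel, div_pow, mul_pow]
      rw [Real.rpow_sub_one hθ0.ne']
      field_simp
      ring
    rw [← ENNReal.ofReal_pow (by positivity), ← ENNReal.ofReal_pow (by positivity)]
    have h0 : 0 ≤ θ ^ β := Real.rpow_nonneg hθ0.le _
    have e2 : ENNReal.ofReal (M ^ (5 * (N - 1)) * 2 ^ (N - 1)) * ENNReal.ofReal (θ ^ (β - 1)) =
        ENNReal.ofReal (θ ^ β * (θ ^ N)⁻¹) * ENNReal.ofReal ((M ^ 2 * θ / δ) ^ (2 * (N - 1))) *
        ENNReal.ofReal ((2 * δ / θ) ^ (N - 1)) * ENNReal.ofReal ((M * δ) ^ (N - 1)) := by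
      rw [← ENNReal.ofReal_mul (by positivity), e, ENNReal.ofReal_mul (by positivity),
        ENNReal.ofReal_mul (by positivity), ENNReal.ofReal_mul (by positivity)]
    rw [mul_assoc ((C : ℝ≥0∞) ^ 2), e2]
    ring
  calc _ ≤ ∫⁻ θ in Set.Ioo (0 : ℝ) 1, ∫⁻ z in Ω,
      C ^ 2 * ENNReal.ofReal (M ^ (5 * (N - 1)) * 2 ^ (N - 1)) * ENNReal.ofReal (θ ^ (β - 1)) *
        F z :=
        setLIntegral_mono' measurableSet_Ioo fun θ hθ =>
          setLIntegral_mono' hopen.measurableSet fun z hz => hx θ hθ z hz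
    _ = _ := by
        simp_rw [lintegral_const_mul _ hF]
        rw [lintegral_mul_const _ (by fun_prop), lintegral_const_mul _ (by fun_prop)]

end ConeEnergy

/-! ### The trace inequality and the Gagliardo estimate for smooth functions -/

section TraceInequality

variable {N : ℕ}

/-- The triangle inequality through `u w`, averaged over `w ∈ D`. With `b = 0` it controls a single
value, with `b` another boundary value a difference. -/
theorem volume_mul_enorm_sub_rpow_le {u : EuclideanSpace ℝ (Fin N) → ℝ} (hu : Continuous u) {q : ℝ}
    (hq : 1 ≤ q) (a b : ℝ) (D : Set (EuclideanSpace ℝ (Fin N))) :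
    volume D * ‖a - b‖ₑ ^ q ≤
      2 ^ (q - 1) * ((∫⁻ w in D, ‖a - u w‖ₑ ^ q) + ∫⁻ w in D, ‖b - u w‖ₑ ^ q) := by
  have hm : ∀ a : ℝ, Measurable fun w => ‖a - u w‖ₑ ^ q := fun a =>
    ((measurable_const.sub hu.measurable).enorm).pow_const q
  have h1 : volume D * ‖a - b‖ₑ ^ q = ∫⁻ _ in D, ‖a - b‖ₑ ^ q := by
    rw [lintegral_const, Measure.restrict_apply_univ, mul_comm]
  rw [h1, ← lintegral_add_left ((hm a)), ← lintegral_const_mul' _ _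
    (ENNReal.rpow_ne_top_of_nonneg (by linarith) (by norm_num))]
  refine lintegral_mono fun w => ?_
  refine le_trans ?_ (ENNReal.rpow_add_le_mul_rpow_add_rpow _ _ hq)
  refine ENNReal.rpow_le_rpow ?_ (by linarith)
  have e : a - b = (a - u w) - (b - u w) := by ring
  rw [e]
  exact enorm_sub_le

/-- The boundary value is compared with the values in one cone ball at the fixed height `h / 2`: the
differences cost gradient energy, and the values themselves are bounded by the `L^q` norm in `Ω`. -/
theorem IsInteriorCone.exists_lintegral_boundary_le (hN : 1 ≤ N)
    {Ω : Set (EuclideanSpace ℝ (Fin N))} (hopen : IsOpen Ω) [IsFiniteMeasure (surfaceMeasure Ω)]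
    {C : ℝ≥0} (hC : ∀ x ρ, 0 < ρ →
      surfaceMeasure Ω (Metric.ball x ρ) ≤ C * ENNReal.ofReal ρ ^ (N - 1))
    {ξ ν : EuclideanSpace ℝ (Fin N)} {r c h : ℝ} (hξ : ξ ∈ frontier Ω)
    (hcone : IsInteriorCone Ω ξ ν r c h) {q : ℝ} (hq : 1 ≤ q) :
    ∃ C' : ℝ≥0, ∀ u : EuclideanSpace ℝ (Fin N) → ℝ, ContDiff ℝ 1 u →
      ∫⁻ x in frontier Ω ∩ Metric.ball ξ r, ‖u x‖ₑ ^ q ∂(surfaceMeasure Ω) ≤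
        C' * ((∫⁻ x in Ω, ‖u x‖ₑ ^ q) + ∫⁻ x in Ω, ‖gradient u x‖ₑ ^ q) := by
  have hq0 : 0 ≤ q := by linarith
  have hc := hcone.c_pos
  set s := h / 2 with hs
  have hs0 : 0 < s := by have := hcone.h_pos; positivity
  have hsh : s < h := by have := hcone.h_pos; rw [hs]; linarith
  set v := volume (Metric.ball (0 : EuclideanSpace ℝ (Fin N)) (c * s / 2)) with hv
  have hv0 : v ≠ 0 := (Metric.measure_ball_pos _ _ (by positivity)).ne'
  have hvt : v ≠ ⊤ := measure_ball_lt_top.ne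
  set a : ℝ≥0∞ := ENNReal.ofReal (2 * s) ^ q with ha
  have hat : a ≠ ⊤ := ENNReal.rpow_ne_top_of_nonneg hq0 ENNReal.ofReal_ne_top
  set b : ℝ≥0∞ := C * ENNReal.ofReal ((4 / c) ^ (2 * N) * s ^ (N - 1)) with hb
  have hbt : b ≠ ⊤ := ENNReal.mul_ne_top ENNReal.coe_ne_top ENNReal.ofReal_ne_top
  set m := surfaceMeasure Ω Set.univ with hm
  have hmt : m ≠ ⊤ := measure_ne_top _ _
  set k : ℝ≥0∞ := v⁻¹ * 2 ^ (q - 1) with hk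
  have hkt : k ≠ ⊤ := ENNReal.mul_ne_top (ENNReal.inv_ne_top.2 hv0)
    (ENNReal.rpow_ne_top_of_nonneg (by linarith) (by norm_num))
  have htop : k * (a * b + m) ≠ ⊤ :=
    ENNReal.mul_ne_top hkt (ENNReal.add_ne_top.2 ⟨ENNReal.mul_ne_top hat hbt, hmt⟩)
  refine ⟨(k * (a * b + m)).toNNReal, fun u hu => ?_⟩
  rw [ENNReal.coe_toNNReal htop]
  have hgm : Measurable fun z => ‖gradient u z‖ₑ ^ q :=
    (hu.continuous_gradient.measurable.enorm).pow_const q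
  set R : EuclideanSpace ℝ (Fin N) → ℝ≥0∞ := fun x =>
    ∫⁻ θ in Set.Ioo (0 : ℝ) 1, ∫⁻ z in Ω,
      ENNReal.ofReal ((θ ^ N)⁻¹) * ‖gradient u z‖ₑ ^ q * coneWeight Ω (4 / c) s x θ z with hR
  have hpt : ∀ x ∈ frontier Ω ∩ Metric.ball ξ r,
      ‖u x‖ₑ ^ q ≤ k * (a * R x + ∫⁻ x in Ω, ‖u x‖ₑ ^ q) := by
    rintro x ⟨hxf, hxr⟩
    have h1 := volume_mul_enorm_sub_rpow_le hu.continuous hq (u x) 0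
      (Metric.ball (x + s • ν) (c * s / 2))
    -- No gain in `θ` is needed at a fixed scale, so plain Jensen suffices, also for `q = 1`.
    have h2 := hcone.lintegral_sub_rpow_le (q := q) (β := 0) (K := 1) hopen hq
      (fun g hg => by simpa using rpow_lintegral_unitInterval_le hq hg) hxf hxr hs0 hsh hu
    simp only [Real.rpow_zero, one_mul, ENNReal.coe_one, mul_one] at h2
    have h3 : ∫⁻ w in Metric.ball (x + s • ν) (c * s / 2), ‖0 - u w‖ₑ ^ q ≤
        ∫⁻ x in Ω, ‖u x‖ₑ ^ q := by
      simp only [zero_sub, enorm_neg]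
      refine lintegral_mono_set ?_
      refine subset_trans (Metric.ball_subset_ball ?_)
        (hcone.ball_subset x (frontier_subset_closure hxf) hxr s hs0 hsh)
      linarith [mul_pos hc hs0]
    rw [Measure.addHaar_ball_center, sub_zero, ← hv] at h1
    have h4 : v * ‖u x‖ₑ ^ q ≤ 2 ^ (q - 1) * (a * R x + ∫⁻ x in Ω, ‖u x‖ₑ ^ q) :=
      h1.trans (by gcongr)
    calc ‖u x‖ₑ ^ q = v⁻¹ * (v * ‖u x‖ₑ ^ q) := by
          rw [← mul_assoc, ENNReal.inv_mul_cancel hv0 hvt, one_mul]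
      _ ≤ v⁻¹ * (2 ^ (q - 1) * (a * R x + ∫⁻ x in Ω, ‖u x‖ₑ ^ q)) := by gcongr
      _ = _ := by rw [hk, mul_assoc]
  have hRint : ∫⁻ x, R x ∂(surfaceMeasure Ω) ≤ b * ∫⁻ x in Ω, ‖gradient u x‖ₑ ^ q :=
    lintegral_coneWeight_le hN hopen ⟨ξ, hξ⟩ hC (by positivity) hs0 hgm
  have hmeas : MeasurableSet (frontier Ω ∩ Metric.ball ξ r) :=
    isClosed_frontier.measurableSet.inter Metric.isOpen_ball.measurableSet
  calc _ ≤ ∫⁻ x in frontier Ω ∩ Metric.ball ξ r, k * (a * R x + ∫⁻ x in Ω, ‖u x‖ₑ ^ q)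
          ∂(surfaceMeasure Ω) := setLIntegral_mono' hmeas hpt
    _ ≤ ∫⁻ x, k * (a * R x + ∫⁻ x in Ω, ‖u x‖ₑ ^ q) ∂(surfaceMeasure Ω) :=
        setLIntegral_le_lintegral _ _
    _ = k * ((a * ∫⁻ x, R x ∂(surfaceMeasure Ω)) + (∫⁻ x in Ω, ‖u x‖ₑ ^ q) * m) := by
        rw [lintegral_const_mul' _ _ hkt, lintegral_add_right _ measurable_const,
          lintegral_const_mul' _ _ hat, lintegral_const]
    _ ≤ k * ((a * (b * ∫⁻ x in Ω, ‖gradient u x‖ₑ ^ q)) + (∫⁻ x in Ω, ‖u x‖ₑ ^ q) * m) := by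
        gcongr
    _ ≤ _ := by
        rw [mul_assoc k]
        refine mul_le_mul_right ?_ k
        rw [add_mul, ← mul_assoc a, mul_comm m]
        exact add_le_add (mul_le_mul_right le_add_self _)
          (mul_le_mul_left le_self_add _)

theorem HasLipschitzBoundary.exists_lintegral_boundary_le (hN : 1 ≤ N)
    {Ω : Set (EuclideanSpace ℝ (Fin N))} (hopen : IsOpen Ω) (hbdd : Bornology.IsBounded Ω)
    (hlip : HasLipschitzBoundary Ω) {q : ℝ} (hq : 1 ≤ q) :
    ∃ C : ℝ≥0, ∀ u : EuclideanSpace ℝ (Fin N) → ℝ, ContDiff ℝ 1 u →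
      ∫⁻ x, ‖u x‖ₑ ^ q ∂(surfaceMeasure Ω) ≤
        C * ((∫⁻ x in Ω, ‖u x‖ₑ ^ q) + ∫⁻ x in Ω, ‖gradient u x‖ₑ ^ q) := by
  have := hlip.isFiniteMeasure_surfaceMeasure hN hopen hbdd
  obtain ⟨C₀, hC₀⟩ := hlip.exists_surfaceMeasure_ball_le hN hopen hbdd
  have key : ∃ C : ℝ≥0, ∀ u : EuclideanSpace ℝ (Fin N) → ℝ, ContDiff ℝ 1 u →
      ∫⁻ x in frontier Ω, ‖u x‖ₑ ^ q ∂(surfaceMeasure Ω) ≤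
        C * ((∫⁻ x in Ω, ‖u x‖ₑ ^ q) + ∫⁻ x in Ω, ‖gradient u x‖ₑ ^ q) := by
    refine (isCompact_frontier_of_isBounded hbdd).induction_on
      (p := fun s => ∃ C : ℝ≥0, ∀ u : EuclideanSpace ℝ (Fin N) → ℝ, ContDiff ℝ 1 u →
        ∫⁻ x in s, ‖u x‖ₑ ^ q ∂(surfaceMeasure Ω) ≤
        C * ((∫⁻ x in Ω, ‖u x‖ₑ ^ q) + ∫⁻ x in Ω, ‖gradient u x‖ₑ ^ q)) ?_ ?_ ?_ ?_
    · exact ⟨0, by simp⟩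
    · rintro s t hst ⟨C, hC⟩
      exact ⟨C, fun u hu => (lintegral_mono_set hst).trans (hC u hu)⟩
    · rintro s t ⟨C, hC⟩ ⟨D, hD⟩
      refine ⟨C + D, fun u hu => (lintegral_union_le _ _ _).trans ?_⟩
      rw [ENNReal.coe_add, add_mul]
      exact add_le_add (hC u hu) (hD u hu)
    · intro ξ hξ
      obtain ⟨ν, r, c, h, hcone⟩ := hlip.exists_isInteriorCone hopen (frontier_subset_closure hξ)
      exact ⟨frontier Ω ∩ Metric.ball ξ r,
        inter_mem_nhdsWithin _ (Metric.ball_mem_nhds ξ hcone.r_pos),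
        hcone.exists_lintegral_boundary_le hN hopen hC₀ hξ hq⟩
  obtain ⟨C, hC⟩ := key
  refine ⟨C, fun u hu => le_trans (le_of_eq ?_) (hC u hu)⟩
  rw [surfaceMeasure, Measure.restrict_restrict isClosed_frontier.measurableSet, Set.inter_self]

theorem ofReal_abs_sub_rpow_div {q : ℝ} (hq : 0 ≤ q) (a b t : ℝ) (ht : 0 ≤ t) :
    ENNReal.ofReal (|a - b| ^ q / t) = ENNReal.ofReal t⁻¹ * ‖a - b‖ₑ ^ q := by
  rw [div_eq_inv_mul, ENNReal.ofReal_mul (inv_nonneg.2 ht),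
    ← ENNReal.ofReal_rpow_of_nonneg (abs_nonneg _) hq, Real.enorm_eq_ofReal_abs]

/-- Two boundary points at distance `d` are compared through a common ball. At height `M d = 4 d /
c` the two cone balls have radius `2 d` and centres at distance `d`, so the ball of radius `d`
concentric with the first lies in both. Dividing by its volume `d^N` and by `d^e` and using the
factor `d^q` of the cone estimate leaves the kernel `d^(-2(N-1))`. -/
theorem IsInteriorCone.exists_gagliardo_near_le (hN : 1 ≤ N)
    {Ω : Set (EuclideanSpace ℝ (Fin N))} (hopen : IsOpen Ω) [IsFiniteMeasure (surfaceMeasure Ω)]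
    {C : ℝ≥0} (hC : ∀ x ρ, 0 < ρ →
      surfaceMeasure Ω (Metric.ball x ρ) ≤ C * ENNReal.ofReal ρ ^ (N - 1))
    {ξ ν : EuclideanSpace ℝ (Fin N)} {r c h : ℝ} (hξ : ξ ∈ frontier Ω)
    (hcone : IsInteriorCone Ω ξ ν r c h) {q e : ℝ} (hq : 1 < q) (he : e = N - 2 + q) :
    ∃ C' : ℝ≥0, ∃ δ > 0, ∀ u : EuclideanSpace ℝ (Fin N) → ℝ, ContDiff ℝ 1 u →
      ∫⁻ x in frontier Ω ∩ Metric.ball ξ (r / 2), (∫⁻ y in Metric.ball x δ,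
        ENNReal.ofReal (|u x - u y| ^ q / dist x y ^ e) ∂(surfaceMeasure Ω)) ∂(surfaceMeasure Ω) ≤
        C' * ∫⁻ x in Ω, ‖gradient u x‖ₑ ^ q := by
  have hq0 : 0 ≤ q := by linarith
  have hc := hcone.c_pos
  have hr := hcone.r_pos
  have hh := hcone.h_pos
  obtain ⟨K, hK⟩ := exists_rpow_lintegral_unitInterval_le_weighted hq
  set β := (q - 1) / 2 with hβ
  set M := 4 / c with hM
  have hM0 : 0 < M := by positivity
  set A : ℝ≥0∞ := ∫⁻ θ in Set.Ioo (0 : ℝ) 1, ENNReal.ofReal (θ ^ (β - 1)) with hA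
  have hAt : A ≠ ⊤ := (lintegral_unitInterval_rpow_lt_top (by rw [hβ]; linarith)).ne
  set V := volume (Metric.ball (0 : EuclideanSpace ℝ (Fin N)) 1) with hV
  have hV0 : V ≠ 0 := (Metric.measure_ball_pos _ _ zero_lt_one).ne'
  have hVt : V ≠ ⊤ := measure_ball_lt_top.ne
  set k : ℝ≥0∞ := V⁻¹ * 2 ^ (q - 1) * (ENNReal.ofReal ((2 * M) ^ q) * K) with hk
  have hkt : k ≠ ⊤ := ENNReal.mul_ne_top (ENNReal.mul_ne_top (ENNReal.inv_ne_top.2 hV0)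
    (ENNReal.rpow_ne_top_of_nonneg (by linarith) (by norm_num)))
    (ENNReal.mul_ne_top ENNReal.ofReal_ne_top ENNReal.coe_ne_top)
  set b : ℝ≥0∞ := C ^ 2 * ENNReal.ofReal (M ^ (5 * (N - 1)) * 2 ^ (N - 1)) * A with hb
  have hbt : b ≠ ⊤ := ENNReal.mul_ne_top (ENNReal.mul_ne_top
    (ENNReal.pow_ne_top ENNReal.coe_ne_top) ENNReal.ofReal_ne_top) hAt
  have htop : k * (b + b) ≠ ⊤ := ENNReal.mul_ne_top hkt (ENNReal.add_ne_top.2 ⟨hbt, hbt⟩)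
  -- The bound `r / 2` keeps `y` where the cone of `ξ` is valid, and `h / M` keeps the height `M *
  -- dist x y` below `h`.
  refine ⟨(k * (b + b)).toNNReal, min (r / 2) (h / M), by positivity, fun u hu => ?_⟩
  rw [ENNReal.coe_toNNReal htop]
  have hgm : Measurable fun z => ‖gradient u z‖ₑ ^ q :=
    (hu.continuous_gradient.measurable.enorm).pow_const q
  let B : EuclideanSpace ℝ (Fin N) → EuclideanSpace ℝ (Fin N) → ℝ≥0∞ := fun x y =>
    ∫⁻ θ in Set.Ioo (0 : ℝ) 1, ∫⁻ z in Ω, ENNReal.ofReal ((dist x y ^ (2 * (N - 1)))⁻¹) *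
        (ENNReal.ofReal (θ ^ β * (θ ^ N)⁻¹) * ‖gradient u z‖ₑ ^ q *
          coneWeight Ω M (M * dist x y) x θ z)
  have hBm : Measurable (Function.uncurry B) := by
    refine Measurable.lintegral_prod_right'
      (f := fun a : (EuclideanSpace ℝ (Fin N) × EuclideanSpace ℝ (Fin N)) × ℝ =>
        ∫⁻ z in Ω, ENNReal.ofReal ((dist a.1.1 a.1.2 ^ (2 * (N - 1)))⁻¹) *
        (ENNReal.ofReal (a.2 ^ β * (a.2 ^ N)⁻¹) * ‖gradient u z‖ₑ ^ q *
          coneWeight Ω M (M * dist a.1.1 a.1.2) a.1.1 a.2 z)) ?_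
    refine Measurable.lintegral_prod_right'
      (f := fun a : ((EuclideanSpace ℝ (Fin N) × EuclideanSpace ℝ (Fin N)) × ℝ) ×
          EuclideanSpace ℝ (Fin N) =>
        ENNReal.ofReal ((dist a.1.1.1 a.1.1.2 ^ (2 * (N - 1)))⁻¹) *
        (ENNReal.ofReal (a.1.2 ^ β * (a.1.2 ^ N)⁻¹) * ‖gradient u a.2‖ₑ ^ q *
          coneWeight Ω M (M * dist a.1.1.1 a.1.1.2) a.1.1.1 a.1.2 a.2)) ?_
    refine Measurable.mul (by fun_prop) ?_
    exact Measurable.mul (Measurable.mul (by fun_prop) (hgm.comp (by fun_prop)))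
      (measurable_coneWeight Ω M (by fun_prop) (by fun_prop) (by fun_prop) (by fun_prop))
  have hBint : ∫⁻ x, ∫⁻ y, B x y ∂(surfaceMeasure Ω) ∂(surfaceMeasure Ω) ≤
      b * ∫⁻ x in Ω, ‖gradient u x‖ₑ ^ q :=
    lintegral_lintegral_coneWeight_le hN hopen ⟨ξ, hξ⟩ hC hM0 hgm
  have hBE : ∀ x ∈ frontier Ω, x ∈ Metric.ball ξ r → ∀ y, 0 < dist x y → M * dist x y < h →
      ENNReal.ofReal ((dist x y ^ e)⁻¹) * ENNReal.ofReal ((dist x y ^ N)⁻¹) *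
        ∫⁻ w in Metric.ball (x + (M * dist x y) • ν) (c * (M * dist x y) / 2), ‖u x - u w‖ₑ ^ q ≤
      ENNReal.ofReal ((2 * M) ^ q) * K * B x y := by
    intro x hxf hxr y hd hdh
    set d := dist x y with hd'
    have h1 := hcone.lintegral_sub_rpow_le hopen hq.le hK hxf hxr (mul_pos hM0 hd) hdh hu
    rw [← hM] at h1
    refine (mul_le_mul_right h1 _).trans_eq ?_
    have h2 : B x y = ENNReal.ofReal ((d ^ (2 * (N - 1)))⁻¹) * ∫⁻ θ in Set.Ioo (0 : ℝ) 1,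
        ∫⁻ z in Ω, ENNReal.ofReal (θ ^ β * (θ ^ N)⁻¹) * ‖gradient u z‖ₑ ^ q *
          coneWeight Ω M (M * d) x θ z := by
      simp only [B, ← hd']
      simp_rw [lintegral_const_mul' _ _ ENNReal.ofReal_ne_top]
    have h3 : ENNReal.ofReal ((d ^ e)⁻¹) * ENNReal.ofReal ((d ^ N)⁻¹) *
        ENNReal.ofReal (2 * (M * d)) ^ q =
        ENNReal.ofReal ((2 * M) ^ q) * ENNReal.ofReal ((d ^ (2 * (N - 1)))⁻¹) := by
      have hd0 : 0 ≤ (d ^ e)⁻¹ := inv_nonneg.2 (Real.rpow_nonneg hd.le _)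
      rw [ENNReal.ofReal_rpow_of_nonneg (by positivity) hq0,
        ← ENNReal.ofReal_mul hd0, ← ENNReal.ofReal_mul (by positivity),
        ← ENNReal.ofReal_mul (by positivity), ← mul_assoc,
        Real.mul_rpow (by positivity) hd.le]
      congr 1
      -- The exponents add up by `e + N - q = 2 (N - 1)`.
      have h4 : (d ^ e)⁻¹ * (d ^ N)⁻¹ * d ^ q = (d ^ (2 * (N - 1)))⁻¹ := by
        rw [← Real.rpow_natCast d N, ← Real.rpow_natCast d (2 * (N - 1)), ← Real.rpow_neg hd.le,
          ← Real.rpow_neg hd.le, ← Real.rpow_neg hd.le, ← Real.rpow_add hd, ← Real.rpow_add hd, he]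
        congr 1
        push_cast [Nat.cast_sub hN]
        ring
      rw [← h4]; ring
    rw [h2, ← mul_assoc, ← mul_assoc, h3]
    ring
  have hpt : ∀ x ∈ frontier Ω ∩ Metric.ball ξ (r / 2), ∀ y ∈ frontier Ω,
      y ∈ Metric.ball x (min (r / 2) (h / M)) →
      ENNReal.ofReal (|u x - u y| ^ q / dist x y ^ e) ≤ k * (B x y + B y x) := by
    rintro x ⟨hxf, hxr⟩ y hyf hyx
    rcases (dist_nonneg (x := x) (y := y)).eq_or_lt with hd | hd
    · have : x = y := dist_eq_zero.1 hd.symm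
      subst this
      rw [sub_self, abs_zero, Real.zero_rpow (by linarith), zero_div, ENNReal.ofReal_zero]
      exact zero_le
    rw [Metric.mem_ball, dist_comm] at hyx
    have hd1 : dist x y < r / 2 := hyx.trans_le (min_le_left _ _)
    have hd2 : M * dist x y < h := by
      have := hyx.trans_le (min_le_right _ _)
      rw [lt_div_iff₀ hM0] at this
      linarith
    have hxr' : x ∈ Metric.ball ξ r := Metric.ball_subset_ball (by linarith) hxr
    have hyr' : y ∈ Metric.ball ξ r := by
      rw [Metric.mem_ball] at *
      linarith [dist_triangle y x ξ, dist_comm x y]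
    have hB1 := hBE x hxf hxr' y hd hd2
    have hB2 := hBE y hyf hyr' x (by rwa [dist_comm]) (by rwa [dist_comm])
    rw [dist_comm y x] at hB2
    set d := dist x y with hd'
    have hrad : c * (M * d) / 2 = 2 * d := by rw [hM]; field_simp; norm_num
    rw [hrad] at hB1 hB2
    set I := ∫⁻ w in Metric.ball (x + (M * d) • ν) (2 * d), ‖u x - u w‖ₑ ^ q with hI
    set J := ∫⁻ w in Metric.ball (y + (M * d) • ν) (2 * d), ‖u y - u w‖ₑ ^ q with hJ
    have h1 := volume_mul_enorm_sub_rpow_le hu.continuous hq.le (u x) (u y)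
      (Metric.ball (x + (M * d) • ν) d)
    have h2 : ∫⁻ w in Metric.ball (x + (M * d) • ν) d, ‖u x - u w‖ₑ ^ q ≤ I :=
      lintegral_mono_set (Metric.ball_subset_ball (by linarith))
    have h3 : ∫⁻ w in Metric.ball (x + (M * d) • ν) d, ‖u y - u w‖ₑ ^ q ≤ J := by
      refine lintegral_mono_set (Metric.ball_subset_ball' ?_)
      rw [dist_add_right]; linarith
    rw [Measure.addHaar_ball_of_pos _ _ hd, finrank_euclideanSpace_fin, ← hV] at h1
    have h4 : ENNReal.ofReal (d ^ N) * V * ‖u x - u y‖ₑ ^ q ≤ 2 ^ (q - 1) * (I + J) :=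
      h1.trans (by gcongr)
    have h5 : ENNReal.ofReal (d ^ N)⁻¹ * ENNReal.ofReal (d ^ N) = 1 := by
      rw [← ENNReal.ofReal_mul (by positivity), inv_mul_cancel₀ (by positivity), ENNReal.ofReal_one]
    have h6 : ‖u x - u y‖ₑ ^ q ≤
        V⁻¹ * ENNReal.ofReal (d ^ N)⁻¹ * (2 ^ (q - 1) * (I + J)) := by
      calc ‖u x - u y‖ₑ ^ q = (V⁻¹ * V) * (ENNReal.ofReal (d ^ N)⁻¹ * ENNReal.ofReal (d ^ N)) *
            ‖u x - u y‖ₑ ^ q := by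
            rw [h5, ENNReal.inv_mul_cancel hV0 hVt, one_mul, one_mul]
        _ = V⁻¹ * ENNReal.ofReal (d ^ N)⁻¹ *
            (ENNReal.ofReal (d ^ N) * V * ‖u x - u y‖ₑ ^ q) := by ring
        _ ≤ _ := by gcongr
    rw [ofReal_abs_sub_rpow_div hq0 _ _ _ (Real.rpow_nonneg hd.le _)]
    calc _ ≤ ENNReal.ofReal (d ^ e)⁻¹ *
          (V⁻¹ * ENNReal.ofReal (d ^ N)⁻¹ * (2 ^ (q - 1) * (I + J))) := by gcongr
      _ = V⁻¹ * 2 ^ (q - 1) * (ENNReal.ofReal (d ^ e)⁻¹ * ENNReal.ofReal (d ^ N)⁻¹ * I +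
          ENNReal.ofReal (d ^ e)⁻¹ * ENNReal.ofReal (d ^ N)⁻¹ * J) := by ring
      _ ≤ V⁻¹ * 2 ^ (q - 1) * (ENNReal.ofReal ((2 * M) ^ q) * K * B x y +
          ENNReal.ofReal ((2 * M) ^ q) * K * B y x) := by gcongr
      _ = _ := by rw [hk]; ring
  have hmeas : MeasurableSet (frontier Ω ∩ Metric.ball ξ (r / 2)) :=
    isClosed_frontier.measurableSet.inter Metric.isOpen_ball.measurableSet
  have hae : ∀ᵐ y ∂(surfaceMeasure Ω), y ∈ frontier Ω :=
    ae_restrict_mem isClosed_frontier.measurableSet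
  have hBx : ∀ x, Measurable fun y => B x y := fun x =>
    hBm.comp (f := fun y => (x, y)) (by fun_prop)
  have hBy : ∀ x, Measurable fun y => B y x := fun x =>
    hBm.comp (f := fun y => (y, x)) (by fun_prop)
  calc _ ≤ ∫⁻ x in frontier Ω ∩ Metric.ball ξ (r / 2), (∫⁻ y, k * (B x y + B y x)
        ∂(surfaceMeasure Ω)) ∂(surfaceMeasure Ω) := by
        refine setLIntegral_mono' hmeas fun x hx => ?_
        refine le_trans ?_ (setLIntegral_le_lintegral
          (Metric.ball x (min (r / 2) (h / M))) _)
        refine setLIntegral_mono_ae' Metric.isOpen_ball.measurableSet ?_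
        filter_upwards [hae] with y hy hyb using hpt x hx y hy hyb
    _ ≤ ∫⁻ x, (∫⁻ y, k * (B x y + B y x) ∂(surfaceMeasure Ω)) ∂(surfaceMeasure Ω) :=
        setLIntegral_le_lintegral _ _
    _ = k * ((∫⁻ x, ∫⁻ y, B x y ∂(surfaceMeasure Ω) ∂(surfaceMeasure Ω)) +
          ∫⁻ x, ∫⁻ y, B y x ∂(surfaceMeasure Ω) ∂(surfaceMeasure Ω)) := by
        simp_rw [lintegral_const_mul' _ _ hkt, lintegral_add_left (hBx _)]
        rw [lintegral_add_left]
        exact Measurable.lintegral_prod_right' hBm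
    _ ≤ k * ((b * ∫⁻ x in Ω, ‖gradient u x‖ₑ ^ q) + b * ∫⁻ x in Ω, ‖gradient u x‖ₑ ^ q) := by
        gcongr
        rw [lintegral_lintegral_swap]
        · exact hBint
        · exact (hBm.comp measurable_swap).aemeasurable
    _ = _ := by ring

/-- Compactness of the boundary gives one radius `δ` for which the cone estimate covers all pairs
closer than `δ`. For the remaining pairs the kernel is bounded and the `L^q` trace inequality
suffices. -/
theorem HasLipschitzBoundary.exists_gagliardo_le (hN : 1 ≤ N)
    {Ω : Set (EuclideanSpace ℝ (Fin N))} (hopen : IsOpen Ω) (hbdd : Bornology.IsBounded Ω)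
    (hlip : HasLipschitzBoundary Ω) {q e : ℝ} (hq : 1 < q) (he : e = N - 2 + q) :
    ∃ C : ℝ≥0, ∀ u : EuclideanSpace ℝ (Fin N) → ℝ, ContDiff ℝ 1 u →
      ∫⁻ x, ∫⁻ y, ENNReal.ofReal (|u x - u y| ^ q / dist x y ^ e)
        ∂(surfaceMeasure Ω) ∂(surfaceMeasure Ω) ≤
        C * ((∫⁻ x in Ω, ‖u x‖ₑ ^ q) + ∫⁻ x in Ω, ‖gradient u x‖ₑ ^ q) := by
  have := hlip.isFiniteMeasure_surfaceMeasure hN hopen hbdd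
  obtain ⟨C₀, hC₀⟩ := hlip.exists_surfaceMeasure_ball_le hN hopen hbdd
  obtain ⟨C₁, hC₁⟩ := hlip.exists_lintegral_boundary_le hN hopen hbdd hq.le
  have hq0 : 0 ≤ q := by linarith
  have he0 : 0 ≤ e := by
    have : (1 : ℝ) ≤ N := by exact_mod_cast hN
    linarith
  have key : ∃ C : ℝ≥0, ∃ δ > 0, ∀ u : EuclideanSpace ℝ (Fin N) → ℝ, ContDiff ℝ 1 u →
      ∫⁻ x in frontier Ω, (∫⁻ y in Metric.ball x δ,
        ENNReal.ofReal (|u x - u y| ^ q / dist x y ^ e) ∂(surfaceMeasure Ω)) ∂(surfaceMeasure Ω) ≤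
        C * ∫⁻ x in Ω, ‖gradient u x‖ₑ ^ q := by
    refine (isCompact_frontier_of_isBounded hbdd).induction_on
      (p := fun s => ∃ C : ℝ≥0, ∃ δ > 0, ∀ u : EuclideanSpace ℝ (Fin N) → ℝ, ContDiff ℝ 1 u →
        ∫⁻ x in s, (∫⁻ y in Metric.ball x δ,
          ENNReal.ofReal (|u x - u y| ^ q / dist x y ^ e) ∂(surfaceMeasure Ω)) ∂(surfaceMeasure Ω) ≤
          C * ∫⁻ x in Ω, ‖gradient u x‖ₑ ^ q) ?_ ?_ ?_ ?_
    · exact ⟨0, 1, one_pos, by simp⟩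
    · rintro s t hst ⟨C, δ, hδ, hC⟩
      exact ⟨C, δ, hδ, fun u hu => (lintegral_mono_set hst).trans (hC u hu)⟩
    · rintro s t ⟨C, δ, hδ, hC⟩ ⟨D, δ', hδ', hD⟩
      refine ⟨C + D, min δ δ', lt_min hδ hδ', fun u hu => (lintegral_union_le _ _ _).trans ?_⟩
      rw [ENNReal.coe_add, add_mul]
      refine add_le_add (le_trans ?_ (hC u hu)) (le_trans ?_ (hD u hu))
      · exact lintegral_mono fun x => lintegral_mono_set (Metric.ball_subset_ball (min_le_left _ _))
      · exact lintegral_mono fun x => lintegral_mono_set (Metric.ball_subset_ball (min_le_right _ _))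
    · intro ξ hξ
      obtain ⟨ν, r, c, h, hcone⟩ := hlip.exists_isInteriorCone hopen (frontier_subset_closure hξ)
      exact ⟨frontier Ω ∩ Metric.ball ξ (r / 2),
        inter_mem_nhdsWithin _ (Metric.ball_mem_nhds ξ (half_pos hcone.r_pos)),
        hcone.exists_gagliardo_near_le hN hopen hC₀ hξ hq he⟩
  obtain ⟨C, δ, hδ, hC⟩ := key
  set m := surfaceMeasure Ω Set.univ with hm
  have hmt : m ≠ ⊤ := measure_ne_top _ _
  set k : ℝ≥0∞ := ENNReal.ofReal (δ ^ e)⁻¹ * 2 ^ (q - 1) with hk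
  have hkt : k ≠ ⊤ := ENNReal.mul_ne_top ENNReal.ofReal_ne_top
    (ENNReal.rpow_ne_top_of_nonneg (by linarith) (by norm_num))
  have htop : k * (m + m) * C₁ ≠ ⊤ := ENNReal.mul_ne_top
    (ENNReal.mul_ne_top hkt (ENNReal.add_ne_top.2 ⟨hmt, hmt⟩)) ENNReal.coe_ne_top
  refine ⟨C + (k * (m + m) * C₁).toNNReal, fun u hu => ?_⟩
  rw [ENNReal.coe_add, ENNReal.coe_toNNReal htop]
  have hum : Measurable fun x => ‖u x‖ₑ ^ q := (hu.continuous.measurable.enorm).pow_const q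
  have hnear : ∫⁻ x, (∫⁻ y in Metric.ball x δ,
      ENNReal.ofReal (|u x - u y| ^ q / dist x y ^ e) ∂(surfaceMeasure Ω)) ∂(surfaceMeasure Ω) ≤
      C * ∫⁻ x in Ω, ‖gradient u x‖ₑ ^ q := by
    refine le_trans (le_of_eq ?_) (hC u hu)
    conv_rhs => rw [surfaceMeasure, Measure.restrict_restrict isClosed_frontier.measurableSet,
      Set.inter_self]
    rfl
  have hfar : ∀ x, ∫⁻ y in (Metric.ball x δ)ᶜ,
      ENNReal.ofReal (|u x - u y| ^ q / dist x y ^ e) ∂(surfaceMeasure Ω) ≤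
      k * (‖u x‖ₑ ^ q * m + ∫⁻ y, ‖u y‖ₑ ^ q ∂(surfaceMeasure Ω)) := by
    intro x
    calc _ ≤ ∫⁻ y in (Metric.ball x δ)ᶜ, k * (‖u x‖ₑ ^ q + ‖u y‖ₑ ^ q) ∂(surfaceMeasure Ω) := by
          refine setLIntegral_mono' Metric.isOpen_ball.measurableSet.compl fun y hy => ?_
          have hd : δ ≤ dist x y := by
            rw [Set.mem_compl_iff, Metric.mem_ball, not_lt, dist_comm] at hy; exact hy
          rw [ofReal_abs_sub_rpow_div hq0 _ _ _ (Real.rpow_nonneg dist_nonneg _), hk, mul_assoc]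
          refine mul_le_mul' (ENNReal.ofReal_le_ofReal ?_) ?_
          · exact inv_anti₀ (Real.rpow_pos_of_pos hδ _) (Real.rpow_le_rpow hδ.le hd he0)
          · refine le_trans ?_ (ENNReal.rpow_add_le_mul_rpow_add_rpow _ _ hq.le)
            exact ENNReal.rpow_le_rpow enorm_sub_le hq0
      _ ≤ ∫⁻ y, k * (‖u x‖ₑ ^ q + ‖u y‖ₑ ^ q) ∂(surfaceMeasure Ω) :=
          setLIntegral_le_lintegral _ _
      _ = _ := by
          rw [lintegral_const_mul' _ _ hkt, lintegral_add_left measurable_const, lintegral_const]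
  calc _ = ∫⁻ x, ((∫⁻ y in Metric.ball x δ,
        ENNReal.ofReal (|u x - u y| ^ q / dist x y ^ e) ∂(surfaceMeasure Ω)) +
        ∫⁻ y in (Metric.ball x δ)ᶜ,
        ENNReal.ofReal (|u x - u y| ^ q / dist x y ^ e) ∂(surfaceMeasure Ω))
          ∂(surfaceMeasure Ω) := by
        refine lintegral_congr fun x => ?_
        rw [lintegral_add_compl _ Metric.isOpen_ball.measurableSet]
    _ ≤ ∫⁻ x, ((∫⁻ y in Metric.ball x δ,
        ENNReal.ofReal (|u x - u y| ^ q / dist x y ^ e) ∂(surfaceMeasure Ω)) +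
        k * (‖u x‖ₑ ^ q * m + ∫⁻ y, ‖u y‖ₑ ^ q ∂(surfaceMeasure Ω))) ∂(surfaceMeasure Ω) :=
        lintegral_mono fun x => by gcongr; exact hfar x
    _ = (∫⁻ x, (∫⁻ y in Metric.ball x δ,
        ENNReal.ofReal (|u x - u y| ^ q / dist x y ^ e) ∂(surfaceMeasure Ω)) ∂(surfaceMeasure Ω)) +
        k * (m + m) * ∫⁻ y, ‖u y‖ₑ ^ q ∂(surfaceMeasure Ω) := by
        rw [lintegral_add_right _ (((hum.mul_const m).add_const _).const_mul k),
          lintegral_const_mul' _ _ hkt, lintegral_add_right _ measurable_const,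
          lintegral_mul_const _ hum, lintegral_const]
        ring
    _ ≤ (C * ∫⁻ x in Ω, ‖gradient u x‖ₑ ^ q) +
        k * (m + m) * (C₁ * ((∫⁻ x in Ω, ‖u x‖ₑ ^ q) + ∫⁻ x in Ω, ‖gradient u x‖ₑ ^ q)) :=
        add_le_add hnear (mul_le_mul_right (hC₁ u hu) _)
    _ ≤ _ := by
        rw [add_mul, ← mul_assoc]
        exact add_le_add (mul_le_mul_right le_add_self _) le_rfl

end TraceInequality

/-! ### Mollification with a displaced centre -/

section ApproximateIdentity

variable {N : ℕ}

theorem rpow_lintegral_le {α : Type*} [MeasurableSpace α] {μ : Measure α} {q : ℝ} (hq : 1 ≤ q)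
    {g : α → ℝ≥0∞} (hg : AEMeasurable g μ) :
    (∫⁻ x, g x ∂μ) ^ q ≤ μ Set.univ ^ (q - 1) * ∫⁻ x, g x ^ q ∂μ := by
  rcases hq.eq_or_lt with rfl | hq1
  · simp
  have hq0 : 0 < q := by linarith
  have hh := ENNReal.lintegral_mul_le_Lp_mul_Lq μ
    (Real.HolderConjugate.conjExponent hq1) hg (aemeasurable_const (b := (1 : ℝ≥0∞)))
  simp only [Pi.mul_apply, mul_one, ENNReal.one_rpow, lintegral_const, one_mul] at hh
  refine (ENNReal.rpow_le_rpow hh hq0.le).trans_eq ?_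
  rw [ENNReal.mul_rpow_of_nonneg _ _ hq0.le, ← ENNReal.rpow_mul, ← ENNReal.rpow_mul,
    one_div_mul_cancel hq0.ne', ENNReal.rpow_one, mul_comm]
  congr 2
  rw [Real.conjExponent]
  field_simp

theorem eLpNorm_rpow_toReal {α F : Type*} [MeasurableSpace α] {μ : Measure α}
    [NormedAddCommGroup F] {p : ℝ≥0∞} (hp : 1 ≤ p) (hpt : p ≠ ⊤) (f : α → F) :
    eLpNorm f p μ ^ p.toReal = ∫⁻ x, ‖f x‖ₑ ^ p.toReal ∂μ := by
  have h0 : p ≠ 0 := (zero_lt_one.trans_le hp).ne'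
  rw [eLpNorm_eq_lintegral_rpow_enorm_toReal h0 hpt, ← ENNReal.rpow_mul,
    one_div_mul_cancel (ENNReal.toReal_ne_zero.2 ⟨h0, hpt⟩), ENNReal.rpow_one]

theorem one_le_toReal {p : ℝ≥0∞} (hp : 1 ≤ p) (hpt : p ≠ ⊤) : 1 ≤ p.toReal := by
  rw [← ENNReal.toReal_one]
  exact ENNReal.toReal_mono hpt hp

theorem eLpNorm_le_of_lintegral_le {α F : Type*} [MeasurableSpace α] {μ : Measure α}
    [NormedAddCommGroup F] {p : ℝ≥0∞} (hp : 1 ≤ p) (hpt : p ≠ ⊤) {f : α → F} {a : ℝ≥0∞}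
    (h : ∫⁻ x, ‖f x‖ₑ ^ p.toReal ∂μ ≤ a ^ p.toReal) : eLpNorm f p μ ≤ a := by
  rw [← eLpNorm_rpow_toReal hp hpt] at h
  exact (ENNReal.rpow_le_rpow_iff (by linarith [one_le_toReal hp hpt])).1 h

theorem tendsto_eLpNorm_comp_add_sub {F : Type*} [NormedAddCommGroup F] {p : ℝ≥0∞} (hp : 1 ≤ p)
    (hpt : p ≠ ⊤) {f : EuclideanSpace ℝ (Fin N) → F} (hf : MemLp f p volume) :
    Tendsto (fun v => eLpNorm (fun x => f (x + v) - f x) p volume) (𝓝 0) (𝓝 0) := by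
  have : Fact (1 ≤ p) := ⟨hp⟩
  let g : EuclideanSpace ℝ (Fin N) → C(EuclideanSpace ℝ (Fin N), EuclideanSpace ℝ (Fin N)) :=
    fun v => ⟨fun x => x + v, by fun_prop⟩
  have hg : Continuous g := by
    let G : C(EuclideanSpace ℝ (Fin N) × EuclideanSpace ℝ (Fin N), EuclideanSpace ℝ (Fin N)) :=
      ⟨fun a => a.2 + a.1, by fun_prop⟩
    exact G.curry.continuous
  have hgm : ∀ v, MeasurePreserving (g v) volume volume := fun v =>
    measurePreserving_add_right volume v
  have h1 := (continuous_const (y := hf.toLp f)).compMeasurePreservingLp hg hgm hpt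
  have h2 := h1.tendsto 0
  have h3 : ∀ v, edist (Lp.compMeasurePreserving (g v) (hgm v) (hf.toLp f))
      (Lp.compMeasurePreserving (g 0) (hgm 0) (hf.toLp f)) =
      eLpNorm (fun x => f (x + v) - f x) p volume := by
    intro v
    rw [Lp.edist_def]
    refine eLpNorm_congr_ae ?_
    have a1 : ∀ v, Lp.compMeasurePreserving (g v) (hgm v) (hf.toLp f) =ᵐ[volume]
        fun x => f (x + v) := fun v =>
      (Lp.coeFn_compMeasurePreserving _ (hgm v)).trans
        ((hgm v).quasiMeasurePreserving.ae_eq_comp hf.coeFn_toLp)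
    filter_upwards [a1 v, a1 0] with x hx1 hx2
    simp only [Pi.sub_apply, hx1, hx2, add_zero]
  have h4 := (tendsto_iff_edist_tendsto_0).1 h2
  simpa only [h3] using h4

theorem lintegral_ofReal_normed (φ : ContDiffBump (0 : EuclideanSpace ℝ (Fin N))) :
    ∫⁻ v, ENNReal.ofReal (φ.normed volume v) = 1 := by
  rw [← ofReal_integral_eq_lintegral_ofReal φ.integrable_normed
    (ae_of_all _ fun v => φ.nonneg_normed v), φ.integral_normed, ENNReal.ofReal_one]

theorem rpow_lintegral_normed_mul_le (φ : ContDiffBump (0 : EuclideanSpace ℝ (Fin N))) {q : ℝ}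
    (hq : 1 ≤ q) {g : EuclideanSpace ℝ (Fin N) → ℝ≥0∞} (hg : Measurable g) :
    (∫⁻ v, ENNReal.ofReal (φ.normed volume v) * g v) ^ q ≤
      ∫⁻ v, ENNReal.ofReal (φ.normed volume v) * g v ^ q := by
  have hkm : Measurable fun v => ENNReal.ofReal (φ.normed volume v) :=
    φ.continuous_normed.measurable.ennreal_ofReal
  have h := rpow_lintegral_le (μ := volume.withDensity fun v => ENNReal.ofReal (φ.normed volume v))
    hq hg.aemeasurable
  rw [lintegral_withDensity_eq_lintegral_mul _ hkm hg,
    lintegral_withDensity_eq_lintegral_mul _ hkm (hg.pow_const q),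
    withDensity_apply _ MeasurableSet.univ, Measure.restrict_univ, lintegral_ofReal_normed,
    ENNReal.one_rpow, one_mul] at h
  exact h

theorem integrable_normed_smul_comp_add {F : Type*} [NormedAddCommGroup F] [NormedSpace ℝ F]
    (φ : ContDiffBump (0 : EuclideanSpace ℝ (Fin N))) {f : EuclideanSpace ℝ (Fin N) → F}
    (hf : Integrable f) (b : EuclideanSpace ℝ (Fin N)) :
    Integrable fun v => φ.normed volume v • f (b + v) := by
  obtain ⟨C, hC⟩ := φ.hasCompactSupport_normed.exists_bound_of_continuous
    (φ.continuous_normed (μ := volume))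
  exact (hf.comp_add_left b).bdd_smul C φ.continuous_normed.aestronglyMeasurable
    (ae_of_all _ hC)

/-- The mollification averages the translates by `a + v` with `‖a + v‖ < δ`, so Jensen and Tonelli
reduce the claim to continuity of translations in `L^p`. Uniformity in `a` and `φ` is needed because
displacement and radius shrink together. -/
theorem exists_forall_eLpNorm_mollify_sub_le {F : Type*} [NormedAddCommGroup F] [NormedSpace ℝ F]
    [CompleteSpace F] {p : ℝ≥0∞} (hp : 1 ≤ p) (hpt : p ≠ ⊤) {f : EuclideanSpace ℝ (Fin N) → F}
    (hfm : StronglyMeasurable f) (hf : MemLp f p volume) (hfi : Integrable f) {ε : ℝ≥0∞}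
    (hε : ε ≠ 0) : ∃ δ > 0, ∀ (a : EuclideanSpace ℝ (Fin N))
      (φ : ContDiffBump (0 : EuclideanSpace ℝ (Fin N))), ‖a‖ + φ.rOut < δ →
      eLpNorm (fun x => (∫ v, φ.normed volume v • f (x + a + v)) - f x) p volume ≤ ε := by
  have h1 := (ENNReal.tendsto_nhds_zero.1 (tendsto_eLpNorm_comp_add_sub hp hpt hf)) ε
    (pos_iff_ne_zero.2 hε)
  obtain ⟨δ, hδ, hb⟩ := Metric.eventually_nhds_iff.1 h1
  refine ⟨δ, hδ, fun a φ ha => eLpNorm_le_of_lintegral_le hp hpt ?_⟩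
  have hq := one_le_toReal hp hpt
  set q := p.toReal
  have hq0 : 0 ≤ q := by linarith
  have hjm : StronglyMeasurable fun b : EuclideanSpace ℝ (Fin N) × EuclideanSpace ℝ (Fin N) =>
      f (b.1 + a + b.2) - f b.1 :=
    (hfm.comp_measurable (by fun_prop)).sub (hfm.comp_measurable (by fun_prop))
  have hpt : ∀ x, ‖(∫ v, φ.normed volume v • f (x + a + v)) - f x‖ₑ ^ q ≤
      ∫⁻ v, ENNReal.ofReal (φ.normed volume v) * ‖f (x + a + v) - f x‖ₑ ^ q := by
    intro x
    have e1 : (∫ v, φ.normed volume v • f (x + a + v)) - f x =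
        ∫ v, φ.normed volume v • (f (x + a + v) - f x) := by
      simp_rw [smul_sub]
      rw [integral_sub (integrable_normed_smul_comp_add φ hfi _)
        (φ.integrable_normed.smul_const _), integral_smul_const, φ.integral_normed, one_smul]
    rw [e1]
    refine (ENNReal.rpow_le_rpow (enorm_integral_le_lintegral_enorm _) hq0).trans ?_
    have e2 : ∀ v, ‖φ.normed volume v • (f (x + a + v) - f x)‖ₑ =
        ENNReal.ofReal (φ.normed volume v) * ‖f (x + a + v) - f x‖ₑ := by
      intro v
      rw [enorm_smul, Real.enorm_of_nonneg (φ.nonneg_normed v)]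
    simp_rw [e2]
    exact rpow_lintegral_normed_mul_le φ hq
      (hjm.comp_measurable (g := fun v => (x, v)) (by fun_prop)).enorm
  refine (lintegral_mono hpt).trans ?_
  rw [lintegral_lintegral_swap]
  swap
  · refine (Measurable.mul ?_ (hjm.enorm.pow_const q)).aemeasurable
    exact (φ.continuous_normed.measurable.comp measurable_snd).ennreal_ofReal
  calc _ ≤ ∫⁻ v, ENNReal.ofReal (φ.normed volume v) * ε ^ q := by
        refine lintegral_mono fun v => ?_
        rw [lintegral_const_mul' _ _ ENNReal.ofReal_ne_top]
        by_cases hv : v ∈ Metric.ball (0 : EuclideanSpace ℝ (Fin N)) φ.rOut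
        · refine mul_le_mul_right ?_ _
          have hd : dist (a + v) 0 < δ := by
            rw [dist_zero_right]
            rw [mem_ball_zero_iff] at hv
            linarith [norm_add_le a v]
          have h3 := hb hd
          simp_rw [← add_assoc] at h3
          rw [← eLpNorm_rpow_toReal hp ‹_›]
          exact ENNReal.rpow_le_rpow h3 hq0
        -- Translations that are not small carry no mass.
        · rw [← φ.support_normed_eq (μ := volume), Function.notMem_support] at hv
          rw [hv, ENNReal.ofReal_zero, zero_mul, zero_mul]
    _ = ε ^ q := by
        rw [lintegral_mul_const _ (φ.continuous_normed.measurable.ennreal_ofReal),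
          lintegral_ofReal_normed, one_mul]

theorem inner_gradient_eq_fderiv (u : EuclideanSpace ℝ (Fin N) → ℝ)
    (x w : EuclideanSpace ℝ (Fin N)) : inner ℝ (gradient u x) w = fderiv ℝ u x w := by
  rw [gradient, InnerProductSpace.toDual_symm_apply]

theorem mollify_eq_convolution (φ : ContDiffBump (0 : EuclideanSpace ℝ (Fin N)))
    (f : EuclideanSpace ℝ (Fin N) → ℝ) (a x : EuclideanSpace ℝ (Fin N)) :
    ∫ v, φ.normed volume v • f (x + a + v) =
      MeasureTheory.convolution f (fun w => φ.normed volume (w + a))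
        (ContinuousLinearMap.mul ℝ ℝ) volume x := by
  rw [MeasureTheory.convolution, ← integral_add_left_eq_self
    (fun t => ContinuousLinearMap.mul ℝ ℝ (f t) (φ.normed volume (x - t + a))) (x + a)]
  refine integral_congr_ae (ae_of_all _ fun v => ?_)
  have e : x - (x + a + v) + a = -v := by abel
  simp only [smul_eq_mul, ContinuousLinearMap.mul_apply', e, φ.normed_neg]
  ring

theorem hasCompactSupport_normed_comp_add (φ : ContDiffBump (0 : EuclideanSpace ℝ (Fin N)))
    (a : EuclideanSpace ℝ (Fin N)) :
    HasCompactSupport fun w => φ.normed volume (w + a) :=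
  φ.hasCompactSupport_normed.comp_homeomorph (Homeomorph.addRight a)

theorem contDiff_mollify (φ : ContDiffBump (0 : EuclideanSpace ℝ (Fin N)))
    {f : EuclideanSpace ℝ (Fin N) → ℝ} (hf : Integrable f) (a : EuclideanSpace ℝ (Fin N)) :
    ContDiff ℝ ∞ fun x => ∫ v, φ.normed volume v • f (x + a + v) := by
  simp_rw [mollify_eq_convolution]
  exact (hasCompactSupport_normed_comp_add φ a).contDiff_convolution_right _ hf.locallyIntegrable
    (φ.contDiff_normed.comp (by fun_prop))

/-- The derivative is put on the kernel as a function of the integration variable `y`, the form in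
which the kernel can serve as a test function. -/
theorem fderiv_mollify (φ : ContDiffBump (0 : EuclideanSpace ℝ (Fin N)))
    {f : EuclideanSpace ℝ (Fin N) → ℝ} (hf : Integrable f) (a x w : EuclideanSpace ℝ (Fin N)) :
    fderiv ℝ (fun x => ∫ v, φ.normed volume v • f (x + a + v)) x w =
      -∫ y, f y * fderiv ℝ (fun y => φ.normed volume (x - y + a)) y w := by
  have hg : ContDiff ℝ 1 fun w => φ.normed volume (w + a) :=
    (φ.contDiff_normed (n := 1)).comp (by fun_prop)
  have hgc := hasCompactSupport_normed_comp_add φ a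
  simp_rw [mollify_eq_convolution]
  rw [(hgc.hasFDerivAt_convolution_right (ContinuousLinearMap.mul ℝ ℝ) hf.locallyIntegrable hg
    x).fderiv, convolution_precompR_apply _ hf.locallyIntegrable (hgc.fderiv ℝ)
    (hg.continuous_fderiv one_ne_zero), MeasureTheory.convolution, ← integral_neg]
  refine integral_congr_ae (ae_of_all _ fun y => ?_)
  simp only [ContinuousLinearMap.mul_apply']
  have h1 : HasFDerivAt (fun y => φ.normed volume (x - y + a))
      ((fderiv ℝ (fun w => φ.normed volume (w + a)) (x - y)).comp
        (-ContinuousLinearMap.id ℝ (EuclideanSpace ℝ (Fin N)))) y := by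
    refine HasFDerivAt.comp (g := fun w => φ.normed volume (w + a)) y
      ((hg.differentiable one_ne_zero).differentiableAt.hasFDerivAt) ?_
    simpa using (hasFDerivAt_id y).const_sub x
  rw [h1.fderiv]
  simp

end ApproximateIdentity

/-! ### Weak gradients and density of smooth functions -/

section WeakGradient

variable {N : ℕ} {Ω : Set (EuclideanSpace ℝ (Fin N))}

theorem ContDiff.exists_bound_gradient {φ : EuclideanSpace ℝ (Fin N) → ℝ} (hφ : ContDiff ℝ 1 φ)
    (hc : HasCompactSupport φ) : ∃ C, ∀ x, ‖gradient φ x‖ ≤ C := by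
  obtain ⟨C, hC⟩ := (hc.fderiv ℝ).exists_bound_of_continuous (hφ.continuous_fderiv one_ne_zero)
  exact ⟨C, fun x => by rw [norm_gradient_eq]; exact hC x⟩

theorem HasWeakGradient.integral_fderiv {f : EuclideanSpace ℝ (Fin N) → ℝ}
    {G : EuclideanSpace ℝ (Fin N) → EuclideanSpace ℝ (Fin N)} (h : HasWeakGradient Ω f G)
    (hf : IntegrableOn f Ω) (hG : IntegrableOn G Ω) {φ : EuclideanSpace ℝ (Fin N) → ℝ}
    (hφ : ContDiff ℝ ∞ φ) (hc : HasCompactSupport φ) (hs : tsupport φ ⊆ Ω)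
    (w : EuclideanSpace ℝ (Fin N)) :
    ∫ x in Ω, f x * fderiv ℝ φ x w = -∫ x in Ω, φ x * inner ℝ (G x) w := by
  have hφ1 : ContDiff ℝ 1 φ := hφ.of_le (by exact_mod_cast le_top)
  obtain ⟨C, hC⟩ := hc.exists_bound_of_continuous hφ.continuous
  obtain ⟨D, hD⟩ := hφ1.exists_bound_gradient hc
  have i1 : IntegrableOn (fun x => f x • gradient φ x) Ω :=
    hf.smul_bdd D hφ1.continuous_gradient.aestronglyMeasurable (ae_of_all _ hD)
  have i2 : IntegrableOn (fun x => φ x • G x) Ω :=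
    hG.bdd_smul C hφ.continuous.aestronglyMeasurable (ae_of_all _ hC)
  have h1 := congrArg (fun v => inner ℝ w v) (h.2.2 φ hφ hc hs)
  simp only [inner_neg_right] at h1
  rw [← integral_inner i1, ← integral_inner i2] at h1
  have e1 : ∀ x, f x * fderiv ℝ φ x w = inner ℝ w (f x • gradient φ x) := fun x => by
    rw [inner_smul_right, real_inner_comm, inner_gradient_eq_fderiv]
  have e2 : ∀ x, φ x * inner ℝ (G x) w = inner ℝ w (φ x • G x) := fun x => by
    rw [inner_smul_right, real_inner_comm]
  simp_rw [e1, e2]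
  exact h1

/-- The weak product rule. Only the product `ψ φ` is used as a test function, so neither support has
to lie in `Ω` by itself. -/
theorem HasWeakGradient.integral_mul_fderiv {f : EuclideanSpace ℝ (Fin N) → ℝ}
    {G : EuclideanSpace ℝ (Fin N) → EuclideanSpace ℝ (Fin N)} (h : HasWeakGradient Ω f G)
    (hf : IntegrableOn f Ω) (hG : IntegrableOn G Ω) {φ ψ : EuclideanSpace ℝ (Fin N) → ℝ}
    (hψ : ContDiff ℝ ∞ ψ) (hψc : HasCompactSupport ψ) (hφ : ContDiff ℝ ∞ φ)
    (hφc : HasCompactSupport φ) (hs : tsupport ψ ∩ tsupport φ ⊆ Ω)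
    (w : EuclideanSpace ℝ (Fin N)) :
    ∫ x in Ω, ψ x * f x * fderiv ℝ φ x w =
      -∫ x in Ω, φ x * inner ℝ (ψ x • G x + f x • gradient ψ x) w := by
  have hψ1 : ContDiff ℝ 1 ψ := hψ.of_le (by exact_mod_cast le_top)
  have hφ1 : ContDiff ℝ 1 φ := hφ.of_le (by exact_mod_cast le_top)
  have hts : tsupport (fun x => ψ x * φ x) ⊆ Ω :=
    (Set.subset_inter (tsupport_mul_subset_left (f := ψ) (g := φ))
      (tsupport_mul_subset_right (f := ψ) (g := φ))).trans hs
  have h1 := h.integral_fderiv hf hG (hψ.mul hφ) (hψc.mul_right (f' := φ)) hts w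
  have e1 : ∀ x, fderiv ℝ (fun x => ψ x * φ x) x w =
      ψ x * fderiv ℝ φ x w + φ x * fderiv ℝ ψ x w := by
    intro x
    rw [fderiv_fun_mul (hψ1.differentiable one_ne_zero).differentiableAt
      (hφ1.differentiable one_ne_zero).differentiableAt]
    simp
  obtain ⟨C, hC⟩ := hψc.exists_bound_of_continuous hψ.continuous
  obtain ⟨C', hC'⟩ := hφc.exists_bound_of_continuous hφ.continuous
  obtain ⟨D, hD⟩ := (hψc.fderiv_apply ℝ w).exists_bound_of_continuous
    ((hψ1.continuous_fderiv one_ne_zero).clm_apply continuous_const)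
  obtain ⟨D', hD'⟩ := (hφc.fderiv_apply ℝ w).exists_bound_of_continuous
    ((hφ1.continuous_fderiv one_ne_zero).clm_apply continuous_const)
  have cψ' : Continuous fun x => fderiv ℝ ψ x w :=
    (hψ1.continuous_fderiv one_ne_zero).clm_apply continuous_const
  have cφ' : Continuous fun x => fderiv ℝ φ x w :=
    (hφ1.continuous_fderiv one_ne_zero).clm_apply continuous_const
  have iψf : IntegrableOn (fun x => ψ x * f x) Ω :=
    hf.bdd_mul hψ.continuous.aestronglyMeasurable (ae_of_all _ hC)
  have i1 : IntegrableOn (fun x => ψ x * f x * fderiv ℝ φ x w) Ω :=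
    Integrable.mul_bdd (c := D') iψf cφ'.aestronglyMeasurable (ae_of_all _ hD')
  have iφf : IntegrableOn (fun x => φ x * f x) Ω :=
    hf.bdd_mul hφ.continuous.aestronglyMeasurable (ae_of_all _ hC')
  have i2 : IntegrableOn (fun x => φ x * f x * fderiv ℝ ψ x w) Ω :=
    Integrable.mul_bdd (c := D) iφf cψ'.aestronglyMeasurable (ae_of_all _ hD)
  have iG : IntegrableOn (fun x => inner ℝ (G x) w) Ω := hG.inner_const w
  have i3 : IntegrableOn (fun x => ψ x * φ x * inner ℝ (G x) w) Ω := by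
    have : IntegrableOn (fun x => φ x * inner ℝ (G x) w) Ω :=
      iG.bdd_mul hφ.continuous.aestronglyMeasurable (ae_of_all _ hC')
    have := Integrable.bdd_mul this hψ.continuous.aestronglyMeasurable (ae_of_all _ hC)
    simp only [mul_assoc]
    exact this
  have e2 : ∫ x in Ω, f x * fderiv ℝ (fun x => ψ x * φ x) x w =
      (∫ x in Ω, ψ x * f x * fderiv ℝ φ x w) + ∫ x in Ω, φ x * f x * fderiv ℝ ψ x w := by
    rw [← integral_add i1 i2]
    refine integral_congr_ae (ae_of_all _ fun x => ?_)
    simp only [e1]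
    ring
  have e3 : ∫ x in Ω, φ x * inner ℝ (ψ x • G x + f x • gradient ψ x) w =
      (∫ x in Ω, ψ x * φ x * inner ℝ (G x) w) + ∫ x in Ω, φ x * f x * fderiv ℝ ψ x w := by
    rw [← integral_add i3 i2]
    refine integral_congr_ae (ae_of_all _ fun x => ?_)
    simp only [inner_add_left, real_inner_smul_left, inner_gradient_eq_fderiv]
    ring
  rw [e2] at h1
  rw [e3]
  linarith

theorem HasWeakGradient.congr_ae {f f' : EuclideanSpace ℝ (Fin N) → ℝ}
    {G G' : EuclideanSpace ℝ (Fin N) → EuclideanSpace ℝ (Fin N)} (h : HasWeakGradient Ω f G)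
    (hf' : IntegrableOn f' Ω) (hG' : IntegrableOn G' Ω)
    (hf : f =ᵐ[volume.restrict Ω] f') (hG : G =ᵐ[volume.restrict Ω] G') :
    HasWeakGradient Ω f' G' := by
  refine ⟨hf'.locallyIntegrableOn, hG'.locallyIntegrableOn, fun φ h1 h2 h3 => ?_⟩
  have e1 : ∫ x in Ω, f' x • gradient φ x = ∫ x in Ω, f x • gradient φ x :=
    integral_congr_ae (by filter_upwards [hf] with x hx; rw [hx])
  have e2 : ∫ x in Ω, φ x • G' x = ∫ x in Ω, φ x • G x :=
    integral_congr_ae (by filter_upwards [hG] with x hx; rw [hx])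
  rw [e1, e2, h.2.2 φ h1 h2 h3]

/-- The weak derivative is tested against the kernel centred at `x + a`. The extension by zero need
not have a weak gradient across `∂Ω`, so the formula is claimed only at points `x` where the
kernel's ball leaves `Ω` at most outside `tsupport ψ`. -/
theorem HasWeakGradient.gradient_mollify (hopen : IsOpen Ω) {f : EuclideanSpace ℝ (Fin N) → ℝ}
    {G : EuclideanSpace ℝ (Fin N) → EuclideanSpace ℝ (Fin N)} (h : HasWeakGradient Ω f G)
    (hf : IntegrableOn f Ω) (hG : IntegrableOn G Ω) {ψ : EuclideanSpace ℝ (Fin N) → ℝ}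
    (hψ : ContDiff ℝ ∞ ψ) (hψc : HasCompactSupport ψ)
    (φ : ContDiffBump (0 : EuclideanSpace ℝ (Fin N))) (a x : EuclideanSpace ℝ (Fin N))
    (hx : tsupport ψ ∩ Metric.closedBall (x + a) φ.rOut ⊆ Ω)
    (hfi : Integrable (Ω.indicator fun x => ψ x * f x))
    (hGi : Integrable (Ω.indicator fun x => ψ x • G x + f x • gradient ψ x)) :
    gradient (fun x => ∫ v, φ.normed volume v • Ω.indicator (fun x => ψ x * f x) (x + a + v)) x =
      ∫ v, φ.normed volume v •
        Ω.indicator (fun x => ψ x • G x + f x • gradient ψ x) (x + a + v) := by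
  refine ext_inner_right ℝ fun w => ?_
  set k : EuclideanSpace ℝ (Fin N) → ℝ := fun y => φ.normed volume (x - y + a) with hk
  have hk' : k = fun y => φ.normed volume (y - (x + a)) := by
    funext y
    rw [hk]
    simp only
    rw [← φ.normed_neg]
    congr 1
    abel
  have hkd : ContDiff ℝ ∞ k := φ.contDiff_normed.comp (by fun_prop)
  have hkt : tsupport k ⊆ Metric.closedBall (x + a) φ.rOut := by
    refine closure_minimal ?_ Metric.isClosed_closedBall
    intro y hy
    rw [hk', Function.mem_support] at hy
    have : y - (x + a) ∈ Function.support (φ.normed volume) := hy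
    rw [φ.support_normed_eq, mem_ball_zero_iff] at this
    rw [Metric.mem_closedBall, dist_eq_norm]
    exact this.le
  have hkc : HasCompactSupport k :=
    HasCompactSupport.of_support_subset_isCompact (isCompact_closedBall (x + a) φ.rOut)
      (subset_closure.trans hkt)
  have h1 := h.integral_mul_fderiv hf hG hψ hψc hkd hkc
    ((Set.inter_subset_inter_right _ hkt).trans hx) w
  rw [inner_gradient_eq_fderiv, fderiv_mollify φ hfi a x w, real_inner_comm,
    ← integral_inner (integrable_normed_smul_comp_add φ hGi _)]
  have e1 : ∫ y, Ω.indicator (fun x => ψ x * f x) y * fderiv ℝ k y w =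
      ∫ x in Ω, ψ x * f x * fderiv ℝ k x w := by
    rw [← integral_indicator hopen.measurableSet]
    refine integral_congr_ae (ae_of_all _ fun y => ?_)
    by_cases hy : y ∈ Ω <;> simp [hy]
  have e2 : ∫ x in Ω, k x * inner ℝ (ψ x • G x + f x • gradient ψ x) w =
      ∫ y, k y * inner ℝ (Ω.indicator (fun x => ψ x • G x + f x • gradient ψ x) y) w := by
    rw [← integral_indicator hopen.measurableSet]
    refine integral_congr_ae (ae_of_all _ fun y => ?_)
    by_cases hy : y ∈ Ω <;> simp [hy]
  rw [e1, h1, neg_neg, e2, ← integral_add_left_eq_self _ (x + a)]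
  refine integral_congr_ae (ae_of_all _ fun v => ?_)
  have e3 : k (x + a + v) = φ.normed volume v := by rw [hk']; simp
  simp only [e3]
  rw [inner_smul_right, real_inner_comm]

/-- Displacing the centre by `t • ν` moves points of `Ω` into their cone, and the radius `c t / 2`
keeps the mollifier inside `Ω`. Thus the gradient formula holds at every point of `Ω`, and both
errors are those of an approximate identity. -/
theorem HasWeakGradient.exists_smooth_approx_of_cone (hopen : IsOpen Ω)
    {ξ ν : EuclideanSpace ℝ (Fin N)} {r c h : ℝ} (hcone : IsInteriorCone Ω ξ ν r c h)
    {p : ℝ≥0∞} (hp : 1 ≤ p) (hpt : p ≠ ⊤) {f : EuclideanSpace ℝ (Fin N) → ℝ}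
    {G : EuclideanSpace ℝ (Fin N) → EuclideanSpace ℝ (Fin N)} (hw : HasWeakGradient Ω f G)
    (hfm : StronglyMeasurable f) (hGm : StronglyMeasurable G)
    (hfp : MemLp f p (volume.restrict Ω)) (hGp : MemLp G p (volume.restrict Ω))
    (hf : IntegrableOn f Ω) (hG : IntegrableOn G Ω) {ψ : EuclideanSpace ℝ (Fin N) → ℝ}
    (hψ : ContDiff ℝ ∞ ψ) (hψc : HasCompactSupport ψ) (hψs : tsupport ψ ⊆ Metric.ball ξ r)
    {ε : ℝ≥0∞} (hε : ε ≠ 0) :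
    ∃ u : EuclideanSpace ℝ (Fin N) → ℝ, ContDiff ℝ ∞ u ∧
      eLpNorm (fun x => u x - ψ x * f x) p (volume.restrict Ω) ≤ ε ∧
      eLpNorm (fun x => gradient u x - (ψ x • G x + f x • gradient ψ x)) p
        (volume.restrict Ω) ≤ ε := by
  have hψ1 : ContDiff ℝ 1 ψ := hψ.of_le (by exact_mod_cast le_top)
  obtain ⟨C, hC⟩ := hψc.exists_bound_of_continuous hψ.continuous
  obtain ⟨D, hD⟩ := hψ1.exists_bound_gradient hψc
  have hm1 : StronglyMeasurable fun x => ψ x * f x := hψ.continuous.stronglyMeasurable.mul hfm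
  have hm2 : StronglyMeasurable fun x => ψ x • G x + f x • gradient ψ x :=
    (hψ.continuous.stronglyMeasurable.smul hGm).add
      (hfm.smul hψ1.continuous_gradient.stronglyMeasurable)
  have mem : ∀ q : ℝ≥0∞, MemLp f q (volume.restrict Ω) → MemLp G q (volume.restrict Ω) →
      MemLp (Ω.indicator fun x => ψ x * f x) q volume ∧
      MemLp (Ω.indicator fun x => ψ x • G x + f x • gradient ψ x) q volume := by
    intro q h1 h2
    rw [memLp_indicator_iff_restrict hopen.measurableSet,
      memLp_indicator_iff_restrict hopen.measurableSet]
    refine ⟨h1.of_le_mul (c := C) hm1.aestronglyMeasurable (ae_of_all _ fun x => ?_), MemLp.add ?_ ?_⟩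
    · rw [norm_mul]
      exact mul_le_mul_of_nonneg_right (hC x) (norm_nonneg _)
    · refine h2.of_le_mul (c := C)
        (hψ.continuous.stronglyMeasurable.smul hGm).aestronglyMeasurable (ae_of_all _ fun x => ?_)
      rw [norm_smul]
      exact mul_le_mul_of_nonneg_right (hC x) (norm_nonneg _)
    · refine h1.of_le_mul (c := D)
        (hfm.smul hψ1.continuous_gradient.stronglyMeasurable).aestronglyMeasurable
        (ae_of_all _ fun x => ?_)
      rw [norm_smul, mul_comm]
      exact mul_le_mul_of_nonneg_right (hD x) (norm_nonneg _)
  obtain ⟨hfp', hGp'⟩ := mem p hfp hGp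
  obtain ⟨hf1, hG1⟩ := mem 1 (memLp_one_iff_integrable.2 hf) (memLp_one_iff_integrable.2 hG)
  rw [memLp_one_iff_integrable] at hf1 hG1
  obtain ⟨δ₁, hδ₁, hb₁⟩ := exists_forall_eLpNorm_mollify_sub_le hp hpt
    (hm1.indicator hopen.measurableSet) hfp' hf1 hε
  obtain ⟨δ₂, hδ₂, hb₂⟩ := exists_forall_eLpNorm_mollify_sub_le hp hpt
    (hm2.indicator hopen.measurableSet) hGp' hG1 hε
  -- The support of `ψ` keeps a distance `r - r'` from the complement of the ball; `t` is chosen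
  -- below half of this gap.
  obtain ⟨r', hr', hsr'⟩ := exists_lt_subset_ball (isClosed_tsupport ψ) hψs
  have hc := hcone.c_pos
  have hh := hcone.h_pos
  obtain ⟨t, ht0, ht⟩ : ∃ t > 0, t < min (min (δ₁ / 2) (δ₂ / 2)) (min h ((r - r') / 2)) :=
    exists_between (by
      refine lt_min (lt_min (by linarith) (by linarith)) (lt_min hh (by linarith)))
  simp only [lt_min_iff] at ht
  obtain ⟨⟨ht1, ht2⟩, ht3, ht4⟩ := ht
  have hct : 0 < c * t := mul_pos hc ht0
  have hct1 : c * t ≤ t := mul_le_of_le_one_left ht0.le hcone.c_le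
  let φ : ContDiffBump (0 : EuclideanSpace ℝ (Fin N)) := ⟨c * t / 4, c * t / 2, by linarith, by linarith⟩
  have hφ : φ.rOut = c * t / 2 := rfl
  have hta : ‖t • ν‖ ≤ t := by
    rw [norm_smul, Real.norm_eq_abs, abs_of_pos ht0]
    exact mul_le_of_le_one_right ht0.le hcone.norm_le
  refine ⟨fun x => ∫ v, φ.normed volume v • Ω.indicator (fun x => ψ x * f x) (x + t • ν + v),
    contDiff_mollify φ hf1 _, ?_, ?_⟩
  · refine le_trans ?_ (hb₁ (t • ν) φ (by rw [hφ]; linarith))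
    refine le_trans (le_of_eq ?_) (eLpNorm_mono_measure _ (Measure.restrict_le_self (s := Ω)))
    refine eLpNorm_congr_ae ?_
    filter_upwards [ae_restrict_mem hopen.measurableSet] with x hx
    simp [hx]
  · refine le_trans ?_ (hb₂ (t • ν) φ (by rw [hφ]; linarith))
    refine le_trans (le_of_eq ?_) (eLpNorm_mono_measure _ (Measure.restrict_le_self (s := Ω)))
    refine eLpNorm_congr_ae ?_
    filter_upwards [ae_restrict_mem hopen.measurableSet] with x hx
    rw [hw.gradient_mollify hopen hf hG hψ hψc φ (t • ν) x ?_ hf1 hG1, Set.indicator_of_mem hx]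
    rintro y ⟨hy1, hy2⟩
    rw [hφ, Metric.mem_closedBall] at hy2
    by_cases hxr : x ∈ Metric.ball ξ r
    · refine hcone.ball_subset x (subset_closure hx) hxr t ht0 ht3 ?_
      rw [Metric.mem_ball]
      linarith
    -- A point outside `ball ξ r` is farther than `r - r'` from `tsupport ψ`, whereas `y` is within
    -- `t + c t / 2` of it.
    · exfalso
      have h1 := hsr' hy1
      rw [Metric.mem_ball] at h1
      rw [Metric.mem_ball, not_lt] at hxr
      have h2 : dist (x + t • ν) x ≤ t := by rwa [dist_eq_norm, add_sub_cancel_left]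
      have h3 := dist_triangle4 x (x + t • ν) y ξ
      linarith [dist_comm x (x + t • ν), dist_comm y (x + t • ν)]

/-- A partition of unity subordinate to cone neighbourhoods of the compact closure glues the local
approximations. The terms `f ∇ψ` cancel in the sum. Strong measurability provides the joint
measurability for Tonelli in the mollification estimate. -/
theorem HasWeakGradient.exists_smooth_approx_of_stronglyMeasurable (hopen : IsOpen Ω)
    (hbdd : Bornology.IsBounded Ω) (hlip : HasLipschitzBoundary Ω)
    {p : ℝ≥0∞} (hp : 1 ≤ p) (hpt : p ≠ ⊤) {f : EuclideanSpace ℝ (Fin N) → ℝ}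
    {G : EuclideanSpace ℝ (Fin N) → EuclideanSpace ℝ (Fin N)} (hw : HasWeakGradient Ω f G)
    (hfm : StronglyMeasurable f) (hGm : StronglyMeasurable G)
    (hfp : MemLp f p (volume.restrict Ω)) (hGp : MemLp G p (volume.restrict Ω))
    (hf : IntegrableOn f Ω) (hG : IntegrableOn G Ω) {ε : ℝ≥0∞} (hε : ε ≠ 0) :
    ∃ u : EuclideanSpace ℝ (Fin N) → ℝ, ContDiff ℝ ∞ u ∧
      eLpNorm (fun x => u x - f x) p (volume.restrict Ω) ≤ ε ∧
      eLpNorm (fun x => gradient u x - G x) p (volume.restrict Ω) ≤ ε := by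
  choose! ν r c h hcone using fun ξ (hξ : ξ ∈ closure Ω) => hlip.exists_isInteriorCone hopen hξ
  have hK : IsCompact (closure Ω) := Metric.isCompact_of_isClosed_isBounded isClosed_closure hbdd.closure
  obtain ⟨t, htK, htc⟩ := hK.elim_nhds_subcover (fun ξ => Metric.ball ξ (r ξ))
    fun ξ hξ => Metric.ball_mem_nhds ξ (hcone ξ hξ).r_pos
  obtain ⟨ρ, hρ⟩ := SmoothPartitionOfUnity.exists_isSubordinate
    (modelWithCornersSelf ℝ (EuclideanSpace ℝ (Fin N))) isClosed_closure
    (fun i : t => Metric.ball i.1 (r i.1)) (fun i => Metric.isOpen_ball)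
    (htc.trans (by intro x hx; simpa using hx))
  let ψ : t → EuclideanSpace ℝ (Fin N) → ℝ := fun i => ρ i
  have hψ : ∀ i, ContDiff ℝ ∞ (ψ i) := fun i => (ρ i).contMDiff.contDiff
  have hψ1 : ∀ i, ContDiff ℝ 1 (ψ i) := fun i => (hψ i).of_le (by exact_mod_cast le_top)
  have hψs : ∀ i, tsupport (ψ i) ⊆ Metric.ball i.1 (r i.1) := fun i => hρ i
  have hψc : ∀ i, HasCompactSupport (ψ i) := fun i =>
    HasCompactSupport.of_support_subset_isCompact (isCompact_closedBall i.1 (r i.1))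
      (subset_closure.trans ((hψs i).trans Metric.ball_subset_closedBall))
  have hsum : ∀ x ∈ Ω, ∑ i, ψ i x = 1 := fun x hx => by
    have := ρ.sum_eq_one (subset_closure hx)
    rwa [finsum_eq_sum_of_fintype] at this
  -- The partition functions sum to `1` on the open set `Ω`, so the sum has zero derivative there.
  have hgrad : ∀ x ∈ Ω, ∑ i, gradient (ψ i) x = 0 := by
    intro x hx
    have e1 : HasFDerivAt (fun x => ∑ i, ψ i x) (∑ i, fderiv ℝ (ψ i) x) x :=
      HasFDerivAt.fun_sum fun i _ =>
        ((hψ1 i).differentiable one_ne_zero).differentiableAt.hasFDerivAt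
    have e2 : HasFDerivAt (fun x => ∑ i, ψ i x)
        (0 : EuclideanSpace ℝ (Fin N) →L[ℝ] ℝ) x :=
      (hasFDerivAt_const (1 : ℝ) x).congr_of_eventuallyEq
        (by filter_upwards [hopen.mem_nhds hx] with y hy using hsum y hy)
    simp only [gradient]
    rw [← map_sum, e1.unique e2, map_zero]
  have hε' : ε / (t.card + 1) ≠ 0 := by
    simp [ENNReal.div_eq_zero_iff, hε]
  choose u hu hu1 hu2 using fun i : t => hw.exists_smooth_approx_of_cone hopen (hcone i.1 (htK i.1 i.2))
    hp hpt hfm hGm hfp hGp hf hG (hψ i) (hψc i) (hψs i) hε'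
  have hu' : ∀ i, ContDiff ℝ 1 (u i) := fun i => (hu i).of_le (by exact_mod_cast le_top)
  have hcard : ∑ _i : t, ε / ((t.card : ℝ≥0∞) + 1) ≤ ε := by
    rw [Finset.sum_const, nsmul_eq_mul, Finset.card_univ, Fintype.card_coe, ← mul_div_assoc]
    refine ENNReal.div_le_of_le_mul ?_
    rw [mul_comm]
    gcongr
    exact le_self_add
  refine ⟨fun x => ∑ i, u i x, ContDiff.sum fun i _ => hu i, ?_, ?_⟩
  · calc eLpNorm (fun x => ∑ i, u i x - f x) p (volume.restrict Ω)
        = eLpNorm (∑ i, fun x => u i x - ψ i x * f x) p (volume.restrict Ω) := by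
          refine eLpNorm_congr_ae ?_
          filter_upwards [ae_restrict_mem hopen.measurableSet] with x hx
          rw [Finset.sum_apply, Finset.sum_sub_distrib, ← Finset.sum_mul, hsum x hx, one_mul]
      _ ≤ ∑ i, eLpNorm (fun x => u i x - ψ i x * f x) p (volume.restrict Ω) := by
          refine eLpNorm_sum_le (fun i _ => ?_) hp
          exact ((hu i).continuous.stronglyMeasurable.sub
            ((hψ i).continuous.stronglyMeasurable.mul hfm)).aestronglyMeasurable
      _ ≤ _ := (Finset.sum_le_sum fun i _ => hu1 i).trans hcard
  · calc eLpNorm (fun x => gradient (fun x => ∑ i, u i x) x - G x) p (volume.restrict Ω)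
        = eLpNorm (∑ i, fun x => gradient (u i) x - (ψ i x • G x + f x • gradient (ψ i) x)) p
            (volume.restrict Ω) := by
          refine eLpNorm_congr_ae ?_
          filter_upwards [ae_restrict_mem hopen.measurableSet] with x hx
          have e1 : gradient (fun x => ∑ i, u i x) x = ∑ i, gradient (u i) x := by
            simp only [gradient]
            rw [← map_sum]
            congr 1
            exact fderiv_fun_sum fun i _ => ((hu' i).differentiable one_ne_zero).differentiableAt
          rw [Finset.sum_apply, Finset.sum_sub_distrib, Finset.sum_add_distrib, ← Finset.sum_smul,
            hsum x hx, one_smul, ← Finset.smul_sum, hgrad x hx, smul_zero, add_zero, e1]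
      _ ≤ ∑ i, eLpNorm (fun x => gradient (u i) x - (ψ i x • G x + f x • gradient (ψ i) x)) p
            (volume.restrict Ω) := by
          refine eLpNorm_sum_le (fun i _ => ?_) hp
          exact ((hu' i).continuous_gradient.stronglyMeasurable.sub
            (((hψ i).continuous.stronglyMeasurable.smul hGm).add
              (hfm.smul (hψ1 i).continuous_gradient.stronglyMeasurable))).aestronglyMeasurable
      _ ≤ _ := (Finset.sum_le_sum fun i _ => hu2 i).trans hcard

theorem MemLp.integrableOn_of_isBounded {F : Type*} [NormedAddCommGroup F]
    (hbdd : Bornology.IsBounded Ω) {p : ℝ≥0∞} (hp : 1 ≤ p) {f : EuclideanSpace ℝ (Fin N) → F}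
    (hf : MemLp f p (volume.restrict Ω)) : IntegrableOn f Ω := by
  have : IsFiniteMeasure (volume.restrict Ω) := ⟨by
    rw [Measure.restrict_apply_univ]; exact hbdd.measure_lt_top⟩
  exact hf.integrable hp

theorem HasWeakGradient.exists_smooth_approx (hopen : IsOpen Ω)
    (hbdd : Bornology.IsBounded Ω) (hlip : HasLipschitzBoundary Ω)
    {p : ℝ≥0∞} (hp : 1 ≤ p) (hpt : p ≠ ⊤) {f : EuclideanSpace ℝ (Fin N) → ℝ}
    {G : EuclideanSpace ℝ (Fin N) → EuclideanSpace ℝ (Fin N)} (hw : HasWeakGradient Ω f G)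
    (hfp : MemLp f p (volume.restrict Ω)) (hGp : MemLp G p (volume.restrict Ω)) :
    ∃ u : ℕ → EuclideanSpace ℝ (Fin N) → ℝ, (∀ n, ContDiff ℝ ∞ (u n)) ∧
      Tendsto (fun n => eLpNorm (fun x => u n x - f x) p (volume.restrict Ω)) atTop (𝓝 0) ∧
      Tendsto (fun n => eLpNorm (fun x => gradient (u n) x - G x) p (volume.restrict Ω))
        atTop (𝓝 0) := by
  have e1 := hfp.1.ae_eq_mk
  have e2 := hGp.1.ae_eq_mk
  have hfp' := hfp.ae_eq e1
  have hGp' := hGp.ae_eq e2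
  have hfi := MemLp.integrableOn_of_isBounded hbdd hp hfp'
  have hGi := MemLp.integrableOn_of_isBounded hbdd hp hGp'
  have hw' := hw.congr_ae hfi hGi e1 e2
  choose u hu hu1 hu2 using fun n : ℕ =>
    hw'.exists_smooth_approx_of_stronglyMeasurable hopen hbdd hlip hp hpt
      hfp.1.stronglyMeasurable_mk hGp.1.stronglyMeasurable_mk hfp' hGp' hfi hGi
      (ε := ((n : ℝ≥0∞) + 1)⁻¹) (by simp)
  have hlim : Tendsto (fun n : ℕ => ((n : ℝ≥0∞) + 1)⁻¹) atTop (𝓝 0) := by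
    have := (tendsto_add_atTop_iff_nat 1).2 ENNReal.tendsto_inv_nat_nhds_zero
    simpa using this
  refine ⟨u, hu, tendsto_of_tendsto_of_tendsto_of_le_of_le tendsto_const_nhds hlim
    (fun _ => zero_le) fun n => ?_, tendsto_of_tendsto_of_tendsto_of_le_of_le tendsto_const_nhds
    hlim (fun _ => zero_le) fun n => ?_⟩
  · refine le_trans (le_of_eq (eLpNorm_congr_ae ?_)) (hu1 n)
    filter_upwards [e1] with x hx
    rw [hx]
  · refine le_trans (le_of_eq (eLpNorm_congr_ae ?_)) (hu2 n)
    filter_upwards [e2] with x hx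
    rw [hx]

end WeakGradient

/-! ### Admissible steps and averages over balls of variable radius -/

section Averaging

variable {N : ℕ}

/-- The properties of a step function on `Ω` used to control the variable step mollifier. -/
structure IsAdmissibleStep (Ω : Set (EuclideanSpace ℝ (Fin N)))
    (η : EuclideanSpace ℝ (Fin N) → ℝ) : Prop where
  measurable : Measurable η
  pos : ∀ x ∈ Ω, 0 < η x
  eq_zero : ∀ x ∈ frontier Ω, η x = 0
  le_infDist : ∀ x ∈ Ω, η x ≤ Metric.infDist x (frontier Ω)
  comparable : ∃ A > 0, ∃ m > 0, ∀ x ∈ Ω, m ≤ η x ∨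
    ∀ y ∈ Metric.ball x (η x), η y ≤ A * η x ∧ η x ≤ A * η y
  bounded_gradient : ∃ L, ∀ x ∈ Ω, ‖gradient η x‖ ≤ L
  approx : ∃ ζ : ℕ → EuclideanSpace ℝ (Fin N) → ℝ, (∀ k, ContDiff ℝ ∞ (ζ k)) ∧
    (∀ x ∈ closure Ω, Tendsto (fun k => ζ k x) atTop (𝓝 (η x))) ∧
    (∀ x ∈ Ω, Tendsto (fun k => gradient (ζ k) x) atTop (𝓝 (gradient η x))) ∧
    ∃ B, ∀ k, (∀ x ∈ closure Ω, |ζ k x| ≤ B) ∧ ∀ x ∈ Ω, ‖gradient (ζ k) x‖ ≤ B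

variable {Ω : Set (EuclideanSpace ℝ (Fin N))} {η : EuclideanSpace ℝ (Fin N) → ℝ}

theorem IsAdmissibleStep.ball_subset (hη : IsAdmissibleStep Ω η) {x : EuclideanSpace ℝ (Fin N)}
    (hx : x ∈ Ω) : Metric.ball x (η x) ⊆ Ω :=
  ball_infDist_frontier_subset hx (hη.le_infDist x hx)

theorem setLIntegral_ball_comp_sub_smul (H : EuclideanSpace ℝ (Fin N) → ℝ≥0∞)
    (x : EuclideanSpace ℝ (Fin N)) {s : ℝ} (hs : 0 < s) :
    ∫⁻ z in Metric.ball (0 : EuclideanSpace ℝ (Fin N)) 1, H (x - s • z) =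
      ENNReal.ofReal (s ^ N)⁻¹ * ∫⁻ y in Metric.ball x s, H y := by
  have h1 := lintegral_comp_add_smul ((Metric.ball x s).indicator H) x (neg_ne_zero.2 hs.ne')
  rw [lintegral_indicator Metric.isOpen_ball.measurableSet] at h1
  have e : |((-s) ^ N)⁻¹| = (s ^ N)⁻¹ := by
    rw [abs_inv, abs_pow, abs_neg, abs_of_pos hs]
  rw [e] at h1
  rw [← h1, ← lintegral_indicator Metric.isOpen_ball.measurableSet]
  refine lintegral_congr fun z => ?_
  have e2 : x + -s • z = x - s • z := by rw [neg_smul, sub_eq_add_neg]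
  rw [e2]
  have hiff : z ∈ Metric.ball (0 : EuclideanSpace ℝ (Fin N)) 1 ↔ x - s • z ∈ Metric.ball x s := by
    rw [mem_ball_zero_iff, Metric.mem_ball, dist_eq_norm, sub_sub_cancel_left, norm_neg, norm_smul,
      Real.norm_eq_abs, abs_of_pos hs]
    exact (mul_lt_iff_lt_one_right hs).symm
  by_cases hz : z ∈ Metric.ball (0 : EuclideanSpace ℝ (Fin N)) 1
  · rw [Set.indicator_of_mem hz, Set.indicator_of_mem (hiff.1 hz)]
  · rw [Set.indicator_of_notMem hz, Set.indicator_of_notMem (mt hiff.2 hz)]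

/-- Tonelli reduces this to bounding, for fixed `y`, the integral of `(η x)^(-N)` over those `x`
with `dist y x < η x`. Where `η x ≥ m` the integrand is at most `m^(-N)` and `Ω` has finite volume.
Otherwise `η x` and `η y` are comparable, so `x` lies in a ball of radius `A η y` and the integrand
is at most `(A / η y)^N`; the powers of `η y` cancel. -/
theorem IsAdmissibleStep.exists_lintegral_average_le (hη : IsAdmissibleStep Ω η) (hopen : IsOpen Ω)
    (hbdd : Bornology.IsBounded Ω) : ∃ C : ℝ≥0, ∀ H : EuclideanSpace ℝ (Fin N) → ℝ≥0∞,
      Measurable H →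
      ∫⁻ x in Ω, ∫⁻ z in Metric.ball (0 : EuclideanSpace ℝ (Fin N)) 1, H (x - η x • z) ≤
        C * ∫⁻ y in Ω, H y := by
  obtain ⟨A, hA, m, hm, hcomp⟩ := hη.comparable
  set V := volume (Metric.ball (0 : EuclideanSpace ℝ (Fin N)) 1) with hV
  set C : ℝ≥0∞ := ENNReal.ofReal (m ^ N)⁻¹ * volume Ω + ENNReal.ofReal (A ^ (2 * N)) * V with hC
  have hCt : C ≠ ⊤ := ENNReal.add_ne_top.2
    ⟨ENNReal.mul_ne_top ENNReal.ofReal_ne_top hbdd.measure_lt_top.ne,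
      ENNReal.mul_ne_top ENNReal.ofReal_ne_top measure_ball_lt_top.ne⟩
  refine ⟨C.toNNReal, fun H hH => ?_⟩
  rw [ENNReal.coe_toNNReal hCt]
  let W : Set (EuclideanSpace ℝ (Fin N) × EuclideanSpace ℝ (Fin N)) :=
    {a | dist a.2 a.1 < η a.1}
  have hηm := hη.measurable
  have hW : MeasurableSet W := measurableSet_lt (by fun_prop) (by fun_prop)
  have hWm : Measurable (W.indicator (1 : EuclideanSpace ℝ (Fin N) × EuclideanSpace ℝ (Fin N) → ℝ≥0∞)) := measurable_one.indicator hW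
  have h1 : ∀ x ∈ Ω, ∫⁻ z in Metric.ball (0 : EuclideanSpace ℝ (Fin N)) 1, H (x - η x • z) ≤
      ∫⁻ y in Ω, ENNReal.ofReal (η x ^ N)⁻¹ * W.indicator 1 (x, y) * H y := by
    intro x hx
    rw [setLIntegral_ball_comp_sub_smul H x (hη.pos x hx),
      ← lintegral_const_mul' _ _ ENNReal.ofReal_ne_top]
    refine le_trans (le_of_eq ?_) (lintegral_mono_set (hη.ball_subset hx))
    refine setLIntegral_congr_fun Metric.isOpen_ball.measurableSet fun y hy => ?_
    have : (x, y) ∈ W := hy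
    simp [this]
  refine (setLIntegral_mono' hopen.measurableSet h1).trans ?_
  rw [lintegral_lintegral_swap]
  swap
  · exact ((Measurable.mul (by fun_prop) hWm).mul (by fun_prop)).aemeasurable
  rw [← lintegral_const_mul _ hH]
  refine setLIntegral_mono' hopen.measurableSet fun y hy => ?_
  have hWy : Measurable fun x => ENNReal.ofReal (η x ^ N)⁻¹ *
      W.indicator (1 : EuclideanSpace ℝ (Fin N) × EuclideanSpace ℝ (Fin N) → ℝ≥0∞) (x, y) :=
    Measurable.mul (by fun_prop) (hWm.comp (f := fun x => (x, y)) (by fun_prop))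
  rw [lintegral_mul_const _ hWy]
  refine mul_le_mul_left ?_ _
  have hy0 := hη.pos y hy
  have h2 : ∀ x ∈ Ω, ENNReal.ofReal (η x ^ N)⁻¹ *
      W.indicator (1 : EuclideanSpace ℝ (Fin N) × EuclideanSpace ℝ (Fin N) → ℝ≥0∞) (x, y) ≤
      ENNReal.ofReal (m ^ N)⁻¹ + ENNReal.ofReal ((A / η y) ^ N) *
        (Metric.ball y (A * η y)).indicator 1 x := by
    intro x hx
    by_cases hxy : (x, y) ∈ W
    swap
    · simp [hxy]
    rw [Set.indicator_of_mem hxy, Pi.one_apply, mul_one]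
    have hx0 := hη.pos x hx
    rcases hcomp x hx with h | h
    · refine le_trans ?_ le_self_add
      gcongr
    · have hc := h y hxy
      have hmem : x ∈ Metric.ball y (A * η y) := by
        rw [Metric.mem_ball, dist_comm]
        exact lt_of_lt_of_le hxy hc.2
      rw [Set.indicator_of_mem hmem, Pi.one_apply, mul_one]
      refine le_trans ?_ le_add_self
      rw [← inv_pow]
      gcongr
      rw [inv_le_iff_one_le_mul₀ hx0, div_mul_eq_mul_div, one_le_div hy0]
      exact hc.1
  refine (setLIntegral_mono' hopen.measurableSet h2).trans ?_
  have hind : Measurable ((Metric.ball y (A * η y)).indicator (1 : EuclideanSpace ℝ (Fin N) → ℝ≥0∞)) :=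
    measurable_one.indicator Metric.isOpen_ball.measurableSet
  rw [lintegral_add_left measurable_const, setLIntegral_const, hC,
    lintegral_const_mul _ hind]
  refine add_le_add le_rfl ?_
  refine (mul_le_mul_right (setLIntegral_le_lintegral _ _) _).trans ?_
  rw [lintegral_indicator_one Metric.isOpen_ball.measurableSet,
    Measure.addHaar_ball_of_pos _ _ (by positivity), finrank_euclideanSpace_fin, ← hV, ← mul_assoc,
    ← ENNReal.ofReal_mul (by positivity)]
  refine le_of_eq ?_
  congr 2
  rw [← mul_pow]
  have : A / η y * (A * η y) = A ^ 2 := by field_simp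
  rw [this, ← pow_mul]

/-- For fixed `x ∈ Ω` the map `z ↦ x - η x • z` is an invertible affine map into `Ω`, since `η x >
0`, so null sets pull back to null sets. Hence the mollification does not depend on the
representative of `f`. -/
theorem IsAdmissibleStep.ae_comp_eq (hη : IsAdmissibleStep Ω η) {F : Type*}
    {f f' : EuclideanSpace ℝ (Fin N) → F} (h : f =ᵐ[volume.restrict Ω] f')
    {x : EuclideanSpace ℝ (Fin N)} (hx : x ∈ Ω) :
    ∀ᵐ z ∂(volume.restrict (Metric.ball (0 : EuclideanSpace ℝ (Fin N)) 1)),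
      f (x - η x • z) = f' (x - η x • z) := by
  set S := toMeasurable (volume.restrict Ω) {y | ¬ f y = f' y} with hS
  have hS0 : volume.restrict Ω S = 0 := by rw [hS, measure_toMeasurable]; exact h
  have hSm : MeasurableSet S := measurableSet_toMeasurable _ _
  have h1 := setLIntegral_ball_comp_sub_smul (S.indicator 1) x (hη.pos x hx)
  have h2 : ∫⁻ y in Metric.ball x (η x), S.indicator 1 y = 0 := by
    rw [lintegral_indicator_one hSm]
    exact Measure.absolutelyContinuous_of_le (Measure.restrict_mono (hη.ball_subset hx) le_rfl) hS0
  rw [h2, mul_zero] at h1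
  have hm : Measurable fun z => S.indicator (1 : EuclideanSpace ℝ (Fin N) → ℝ≥0∞) (x - η x • z) :=
    (measurable_one.indicator hSm).comp (f := fun z => x - η x • z) (by fun_prop)
  rw [lintegral_eq_zero_iff hm] at h1
  filter_upwards [h1] with z hz
  by_contra hne
  have : x - η x • z ∈ S := subset_toMeasurable _ _ hne
  simp [this] at hz

theorem IsAdmissibleStep.integrableOn_comp (hη : IsAdmissibleStep Ω η) {F : Type*}
    [NormedAddCommGroup F] {f : EuclideanSpace ℝ (Fin N) → F} (hf : IntegrableOn f Ω)
    {x : EuclideanSpace ℝ (Fin N)} (hx : x ∈ Ω) :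
    IntegrableOn (fun z => f (x - η x • z)) (Metric.ball 0 1) := by
  have h1 := hη.ae_comp_eq hf.1.ae_eq_mk hx
  have hm : StronglyMeasurable (fun z => hf.1.mk f (x - η x • z)) :=
    hf.1.stronglyMeasurable_mk.comp_measurable (by fun_prop)
  refine ⟨⟨_, hm, h1⟩, ?_⟩
  rw [hasFiniteIntegral_iff_enorm, setLIntegral_ball_comp_sub_smul (fun y => ‖f y‖ₑ) x (hη.pos x hx)]
  refine ENNReal.mul_lt_top ENNReal.ofReal_lt_top ?_
  exact (lintegral_mono_set (hη.ball_subset hx)).trans_lt (hasFiniteIntegral_iff_enorm.1 hf.2)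

/-- Jensen on the unit ball followed by the averaging bound. Any `v` dominated by averages is
allowed, so that the mollifier and its gradient are both covered. -/
theorem IsAdmissibleStep.exists_eLpNorm_le (hη : IsAdmissibleStep Ω η) (hopen : IsOpen Ω)
    (hbdd : Bornology.IsBounded Ω) {p : ℝ≥0∞} (hp : 1 ≤ p) (hpt : p ≠ ⊤) {C₀ : ℝ≥0∞} (hC₀ : C₀ ≠ ⊤)
    (F V : Type*) [NormedAddCommGroup F] [NormedAddCommGroup V] :
    ∃ C : ℝ≥0∞, C ≠ ⊤ ∧ ∀ (f : EuclideanSpace ℝ (Fin N) → F) (v : EuclideanSpace ℝ (Fin N) → V),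
      AEStronglyMeasurable f (volume.restrict Ω) →
      (∀ x ∈ Ω, ‖v x‖ₑ ≤ C₀ * ∫⁻ z in Metric.ball 0 1, ‖f (x - η x • z)‖ₑ) →
      eLpNorm v p (volume.restrict Ω) ≤ C * eLpNorm f p (volume.restrict Ω) := by
  obtain ⟨C, hC⟩ := hη.exists_lintegral_average_le hopen hbdd
  have hq := one_le_toReal hp hpt
  set q := p.toReal with hq'
  have hq0 : 0 < q := by linarith
  set b := volume (Metric.ball (0 : EuclideanSpace ℝ (Fin N)) 1) ^ (q - 1) with hb
  have hbt : b ≠ ⊤ := ENNReal.rpow_ne_top_of_nonneg (by linarith) measure_ball_lt_top.ne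
  refine ⟨C₀ * (b * C) ^ q⁻¹, ENNReal.mul_ne_top hC₀ (ENNReal.rpow_ne_top_of_nonneg (by positivity)
    (ENNReal.mul_ne_top hbt ENNReal.coe_ne_top)), fun f v hf hv => ?_⟩
  refine eLpNorm_le_of_lintegral_le hp hpt ?_
  rw [ENNReal.mul_rpow_of_nonneg _ _ hq0.le, ENNReal.mul_rpow_of_nonneg _ _ hq0.le,
    eLpNorm_rpow_toReal hp hpt, ← hq', ENNReal.rpow_inv_rpow hq0.ne']
  have hgm : StronglyMeasurable (hf.mk f) := hf.stronglyMeasurable_mk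
  have hcg : ∫⁻ x in Ω, ‖f x‖ₑ ^ q = ∫⁻ x in Ω, ‖hf.mk f x‖ₑ ^ q := by
    refine lintegral_congr_ae ?_
    filter_upwards [hf.ae_eq_mk] with x hx
    rw [← hx]
  have hpt : ∀ x ∈ Ω, ‖v x‖ₑ ^ q ≤ C₀ ^ q * b *
      ∫⁻ z in Metric.ball 0 1, ‖hf.mk f (x - η x • z)‖ₑ ^ q := by
    intro x hx
    have e1 : ∫⁻ z in Metric.ball 0 1, ‖f (x - η x • z)‖ₑ =
        ∫⁻ z in Metric.ball 0 1, ‖hf.mk f (x - η x • z)‖ₑ := by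
      refine lintegral_congr_ae ?_
      filter_upwards [hη.ae_comp_eq hf.ae_eq_mk hx] with z hz
      rw [hz]
    have h1 := hv x hx
    rw [e1] at h1
    refine (ENNReal.rpow_le_rpow h1 hq0.le).trans ?_
    rw [ENNReal.mul_rpow_of_nonneg _ _ hq0.le, mul_assoc]
    refine mul_le_mul_right ?_ _
    have h2 := rpow_lintegral_le (μ := volume.restrict (Metric.ball (0 : EuclideanSpace ℝ (Fin N)) 1))
      hq (g := fun z => ‖hf.mk f (x - η x • z)‖ₑ)
      ((hgm.comp_measurable (g := fun z => x - η x • z) (by fun_prop)).enorm.aemeasurable)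
    rwa [Measure.restrict_apply_univ] at h2
  refine (setLIntegral_mono' hopen.measurableSet hpt).trans ?_
  rw [lintegral_const_mul' _ _ (ENNReal.mul_ne_top (ENNReal.rpow_ne_top_of_nonneg hq0.le hC₀) hbt),
    hcg, mul_assoc, mul_assoc, mul_assoc]
  exact mul_le_mul_right (mul_le_mul_right (hC _ (hgm.enorm.pow_const q)) _) _

end Averaging

/-! ### Smoothness and gradient of the mollification of smooth functions -/

section SmoothMollifier

variable {N : ℕ} {ρ : EuclideanSpace ℝ (Fin N) → ℝ}

/-- The expression obtained by differentiating `x ↦ (∫ ρ)⁻¹ ∫ ρ z * u (x - s z)` along a step `s`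
with gradient `g`, in terms of the gradient `G` of `u`. -/
noncomputable def stepGradient (ρ : EuclideanSpace ℝ (Fin N) → ℝ) (s : ℝ)
    (g : EuclideanSpace ℝ (Fin N)) (G : EuclideanSpace ℝ (Fin N) → EuclideanSpace ℝ (Fin N))
    (x : EuclideanSpace ℝ (Fin N)) : EuclideanSpace ℝ (Fin N) :=
  (∫ z in Metric.ball (0 : EuclideanSpace ℝ (Fin N)) 1, ρ z)⁻¹ •
    ∫ z in Metric.ball (0 : EuclideanSpace ℝ (Fin N)) 1,
      ρ z • (G (x - s • z) - inner ℝ (G (x - s • z)) z • g)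

theorem Continuous.integrableOn_ball {F : Type*} [NormedAddCommGroup F]
    {g : EuclideanSpace ℝ (Fin N) → F} (hg : Continuous g) (x : EuclideanSpace ℝ (Fin N)) (r : ℝ) :
    IntegrableOn g (Metric.ball x r) :=
  (hg.continuousOn.integrableOn_compact (isCompact_closedBall x r)).mono_set
    Metric.ball_subset_closedBall

/-- The kernel vanishes on the unit sphere. Passing to the compact ball gives access to continuity
of parametric integrals. -/
theorem IsMollifierKernel.setIntegral_ball_eq (hρ : IsMollifierKernel ρ) {F : Type*}
    [NormedAddCommGroup F] [NormedSpace ℝ F] (g : EuclideanSpace ℝ (Fin N) → F) :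
    ∫ z in Metric.ball (0 : EuclideanSpace ℝ (Fin N)) 1, ρ z • g z =
      ∫ z in Metric.closedBall (0 : EuclideanSpace ℝ (Fin N)) 1, ρ z • g z := by
  refine (setIntegral_eq_of_subset_of_forall_sdiff_eq_zero measurableSet_closedBall
    Metric.ball_subset_closedBall fun z hz => ?_).symm
  have : ρ z = 0 := (hρ.eq_zero_iff z).2 (by simpa using hz.2)
  rw [this, zero_smul]

theorem IsMollifierKernel.setIntegral_ball_eq_integral (hρ : IsMollifierKernel ρ) {F : Type*}
    [NormedAddCommGroup F] [NormedSpace ℝ F] (g : EuclideanSpace ℝ (Fin N) → F) :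
    ∫ z in Metric.ball (0 : EuclideanSpace ℝ (Fin N)) 1, ρ z • g z = ∫ z, ρ z • g z := by
  refine setIntegral_eq_integral_of_forall_compl_eq_zero fun z hz => ?_
  have : ρ z = 0 := (hρ.eq_zero_iff z).2 (by simpa using hz)
  rw [this, zero_smul]

theorem IsMollifierKernel.integral_pos (hρ : IsMollifierKernel ρ) :
    0 < ∫ z in Metric.ball (0 : EuclideanSpace ℝ (Fin N)) 1, ρ z := by
  have hi : IntegrableOn ρ (Metric.ball (0 : EuclideanSpace ℝ (Fin N)) 1) :=
    hρ.smooth.continuous.integrableOn_ball 0 1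
  rw [setIntegral_pos_iff_support_of_nonneg_ae (ae_of_all _ hρ.nonneg) hi]
  have : Function.support ρ ∩ Metric.ball (0 : EuclideanSpace ℝ (Fin N)) 1 = Metric.ball 0 1 := by
    refine Set.inter_eq_right.2 fun z hz => ?_
    rw [Function.mem_support, Ne, hρ.eq_zero_iff, not_le]
    simpa using hz
  rw [this]
  exact Metric.measure_ball_pos _ _ one_pos

/-- The integral is the value at `0` of the convolution of the constant `1` with the kernel `w ↦ ρ
(-w) u (q.1 + q.2 w)`, which depends smoothly on `q` and is supported in the unit ball for every
`q`. -/
theorem IsMollifierKernel.contDiff_integral (hρ : IsMollifierKernel ρ)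
    {u : EuclideanSpace ℝ (Fin N) → ℝ} (hu : ContDiff ℝ ∞ u) :
    ContDiff ℝ ∞ fun q : EuclideanSpace ℝ (Fin N) × ℝ =>
      ∫ z in Metric.ball (0 : EuclideanSpace ℝ (Fin N)) 1, ρ z * u (q.1 - q.2 • z) := by
  let g : EuclideanSpace ℝ (Fin N) × ℝ → EuclideanSpace ℝ (Fin N) → ℝ :=
    fun q w => ρ (-w) * u (q.1 + q.2 • w)
  have hg : ContDiff ℝ ∞ (Function.uncurry g) := by
    have h1 : ContDiff ℝ ∞ fun a : (EuclideanSpace ℝ (Fin N) × ℝ) × EuclideanSpace ℝ (Fin N) =>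
        ρ (-a.2) := hρ.smooth.comp contDiff_snd.neg
    have h2 : ContDiff ℝ ∞ fun a : (EuclideanSpace ℝ (Fin N) × ℝ) × EuclideanSpace ℝ (Fin N) =>
        u (a.1.1 + a.1.2 • a.2) :=
      hu.comp (contDiff_fst.fst.add (contDiff_fst.snd.smul contDiff_snd))
    exact h1.mul h2
  have h := contDiffOn_convolution_right_with_param (n := ⊤) (ContinuousLinearMap.mul ℝ ℝ)
    (f := fun _ : EuclideanSpace ℝ (Fin N) => (1 : ℝ)) (g := g) (s := Set.univ)
    (μ := (volume : Measure (EuclideanSpace ℝ (Fin N)))) isOpen_univ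
    (isCompact_closedBall (0 : EuclideanSpace ℝ (Fin N)) 1) (fun q w _ hw => by
      have : ρ (-w) = 0 := (hρ.eq_zero_iff _).2 (by
        rw [norm_neg]
        simp only [Metric.mem_closedBall, dist_zero_right, not_le] at hw
        exact hw.le)
      simp [g, this]) (locallyIntegrable_const _) (hg.contDiffOn)
  rw [Set.univ_prod_univ, contDiffOn_univ] at h
  have h3 := h.comp (contDiff_id.prodMk (contDiff_const (c := (0 : EuclideanSpace ℝ (Fin N)))))
  refine (contDiffOn_univ.2 h3).congr (fun q _ => ?_) |> contDiffOn_univ.1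
  have e := hρ.setIntegral_ball_eq_integral (fun z => u (q.1 - q.2 • z))
  simp only [smul_eq_mul] at e
  rw [e]
  simp only [Function.comp, id, MeasureTheory.convolution]
  refine integral_congr_ae (ae_of_all _ fun z => ?_)
  simp [g, sub_eq_add_neg]

theorem IsMollifierKernel.contDiff_variableStepMollifier (hρ : IsMollifierKernel ρ)
    {u ζ : EuclideanSpace ℝ (Fin N) → ℝ} (hu : ContDiff ℝ ∞ u) (hζ : ContDiff ℝ ∞ ζ) :
    ContDiff ℝ ∞ (variableStepMollifier ρ ζ u) :=
  contDiff_const.mul ((hρ.contDiff_integral hu).comp (contDiff_id.prodMk hζ))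

theorem IsMollifierKernel.hasFDerivAt_integral (hρ : IsMollifierKernel ρ)
    {u : EuclideanSpace ℝ (Fin N) → ℝ} (hu : ContDiff ℝ 1 u) (q₀ : EuclideanSpace ℝ (Fin N) × ℝ) :
    HasFDerivAt (fun q : EuclideanSpace ℝ (Fin N) × ℝ =>
      ∫ z in Metric.ball (0 : EuclideanSpace ℝ (Fin N)) 1, ρ z * u (q.1 - q.2 • z))
      (∫ z in Metric.ball (0 : EuclideanSpace ℝ (Fin N)) 1,
        ρ z • (fderiv ℝ u (q₀.1 - q₀.2 • z)).comp
          (ContinuousLinearMap.fst ℝ (EuclideanSpace ℝ (Fin N)) ℝ -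
            (ContinuousLinearMap.snd ℝ (EuclideanSpace ℝ (Fin N)) ℝ).smulRight z)) q₀ ∧
    IntegrableOn (fun z => ρ z • (fderiv ℝ u (q₀.1 - q₀.2 • z)).comp
          (ContinuousLinearMap.fst ℝ (EuclideanSpace ℝ (Fin N)) ℝ -
            (ContinuousLinearMap.snd ℝ (EuclideanSpace ℝ (Fin N)) ℝ).smulRight z))
      (Metric.ball (0 : EuclideanSpace ℝ (Fin N)) 1) := by
  have hρc := hρ.smooth.continuous
  have huc := hu.continuous
  have hfc := hu.continuous_fderiv one_ne_zero
  let F' : EuclideanSpace ℝ (Fin N) × ℝ → EuclideanSpace ℝ (Fin N) →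
      (EuclideanSpace ℝ (Fin N) × ℝ) →L[ℝ] ℝ := fun q z =>
    ρ z • (fderiv ℝ u (q.1 - q.2 • z)).comp
          (ContinuousLinearMap.fst ℝ (EuclideanSpace ℝ (Fin N)) ℝ -
            (ContinuousLinearMap.snd ℝ (EuclideanSpace ℝ (Fin N)) ℝ).smulRight z)
  have hF' : Continuous (Function.uncurry F') := by
    have h1 : Continuous fun a : (EuclideanSpace ℝ (Fin N) × ℝ) × EuclideanSpace ℝ (Fin N) =>
        (ContinuousLinearMap.snd ℝ (EuclideanSpace ℝ (Fin N)) ℝ).smulRight a.2 :=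
      ((ContinuousLinearMap.smulRightL ℝ (EuclideanSpace ℝ (Fin N) × ℝ) (EuclideanSpace ℝ (Fin N))
        (ContinuousLinearMap.snd ℝ (EuclideanSpace ℝ (Fin N)) ℝ)).continuous).comp continuous_snd
    refine (hρc.comp continuous_snd).smul (Continuous.clm_comp ?_ (continuous_const.sub h1))
    exact hfc.comp (by fun_prop)
  obtain ⟨C, hC⟩ := ((isCompact_closedBall q₀ 1).prod
    (isCompact_closedBall (0 : EuclideanSpace ℝ (Fin N)) 1)).exists_bound_of_continuousOn
    hF'.continuousOn
  have hfin : IsFiniteMeasure (volume.restrict (Metric.ball (0 : EuclideanSpace ℝ (Fin N)) 1)) :=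
    ⟨by rw [Measure.restrict_apply_univ]; exact measure_ball_lt_top⟩
  have hF'i : IntegrableOn (F' q₀) (Metric.ball (0 : EuclideanSpace ℝ (Fin N)) 1) :=
    (hF'.comp (g := Function.uncurry F') (f := fun z => (q₀, z))
      (by fun_prop)).integrableOn_ball 0 1
  refine ⟨?_, hF'i⟩
  refine hasFDerivAt_integral_of_dominated_of_fderiv_le (F' := F') (bound := fun _ => C)
    (s := Metric.ball q₀ 1)
    (Metric.ball_mem_nhds q₀ one_pos) (Eventually.of_forall fun q => ?_) ?_ ?_ ?_
    (integrable_const C) ?_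
  · exact (hρc.mul (huc.comp (by fun_prop))).aestronglyMeasurable
  · exact (hρc.mul (huc.comp (f := fun z => q₀.1 - q₀.2 • z) (by fun_prop))).integrableOn_ball 0 1
  · exact hF'i.aestronglyMeasurable
  · filter_upwards [ae_restrict_mem Metric.isOpen_ball.measurableSet] with z hz q hq
    exact hC (q, z) ⟨Metric.ball_subset_closedBall hq, Metric.ball_subset_closedBall hz⟩
  · refine ae_of_all _ fun z q _ => ?_
    refine HasFDerivAt.const_mul ?_ (ρ z)
    refine HasFDerivAt.comp q (hu.differentiable one_ne_zero).differentiableAt.hasFDerivAt ?_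
    exact hasFDerivAt_fst.sub (hasFDerivAt_snd.smul_const z)

/-- The chain rule for `x ↦ x - ζ x • z`: the first term of `stepGradient` comes from moving `x`,
the second from the variation of the step. -/
theorem IsMollifierKernel.gradient_variableStepMollifier (hρ : IsMollifierKernel ρ)
    {u ζ : EuclideanSpace ℝ (Fin N) → ℝ} (hu : ContDiff ℝ 1 u) {x : EuclideanSpace ℝ (Fin N)}
    (hζ : DifferentiableAt ℝ ζ x) :
    gradient (variableStepMollifier ρ ζ u) x =
      stepGradient ρ (ζ x) (gradient ζ x) (gradient u) x := by
  refine ext_inner_right ℝ fun w => ?_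
  obtain ⟨h1, h2⟩ := hρ.hasFDerivAt_integral hu (x, ζ x)
  have h3 := (h1.comp x ((hasFDerivAt_id x).prodMk hζ.hasFDerivAt)).const_mul
    ((∫ z in Metric.ball (0 : EuclideanSpace ℝ (Fin N)) 1, ρ z)⁻¹)
  have h4 : fderiv ℝ (variableStepMollifier ρ ζ u) x = _ := h3.fderiv
  have hgc := hu.continuous_gradient
  have hi : IntegrableOn (fun z => ρ z • (gradient u (x - ζ x • z) -
      inner ℝ (gradient u (x - ζ x • z)) z • gradient ζ x))
      (Metric.ball (0 : EuclideanSpace ℝ (Fin N)) 1) := by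
    have hc : Continuous fun z => gradient u (x - ζ x • z) := hgc.comp (by fun_prop)
    have hc2 : Continuous fun z => (inner ℝ (gradient u (x - ζ x • z)) z : ℝ) :=
      hc.inner continuous_id
    have hc3 : Continuous fun z => (inner ℝ (gradient u (x - ζ x • z)) z : ℝ) • gradient ζ x :=
      hc2.smul continuous_const
    exact (hρ.smooth.continuous.smul (hc.sub hc3)).integrableOn_ball 0 1
  rw [inner_gradient_eq_fderiv, h4, stepGradient, real_inner_smul_left, real_inner_comm,
    ← integral_inner hi]
  simp only [smul_apply, ContinuousLinearMap.comp_apply, smul_eq_mul]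
  rw [ContinuousLinearMap.integral_apply h2]
  congr 1
  refine integral_congr_ae (ae_of_all _ fun z => ?_)
  simp only [smul_apply, ContinuousLinearMap.comp_apply, smul_eq_mul,
    sub_apply, ContinuousLinearMap.prod_apply, ContinuousLinearMap.id_apply,
    ContinuousLinearMap.coe_fst', ContinuousLinearMap.smulRight_apply,
    ContinuousLinearMap.coe_snd', map_sub, map_smul, real_inner_smul_right, inner_sub_right]
  rw [real_inner_comm, inner_gradient_eq_fderiv, inner_gradient_eq_fderiv, real_inner_comm,
    inner_gradient_eq_fderiv]
  ring

theorem IsMollifierKernel.continuous_integral (hρ : IsMollifierKernel ρ)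
    {u : EuclideanSpace ℝ (Fin N) → ℝ} (hu : Continuous u) :
    Continuous fun q : EuclideanSpace ℝ (Fin N) × ℝ =>
      (∫ z in Metric.ball (0 : EuclideanSpace ℝ (Fin N)) 1, ρ z)⁻¹ *
      ∫ z in Metric.ball (0 : EuclideanSpace ℝ (Fin N)) 1, ρ z * u (q.1 - q.2 • z) := by
  refine continuous_const.mul ?_
  have e : ∀ q : EuclideanSpace ℝ (Fin N) × ℝ,
      ∫ z in Metric.ball (0 : EuclideanSpace ℝ (Fin N)) 1, ρ z * u (q.1 - q.2 • z) =
      ∫ z in Metric.closedBall (0 : EuclideanSpace ℝ (Fin N)) 1, ρ z * u (q.1 - q.2 • z) :=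
    fun q => hρ.setIntegral_ball_eq fun z => u (q.1 - q.2 • z)
  simp_rw [e]
  refine continuous_parametric_integral_of_continuous ?_ (isCompact_closedBall 0 1)
  exact (hρ.smooth.continuous.comp continuous_snd).mul (hu.comp (by fun_prop))

theorem IsMollifierKernel.continuous_stepGradient (hρ : IsMollifierKernel ρ)
    {G : EuclideanSpace ℝ (Fin N) → EuclideanSpace ℝ (Fin N)} (hG : Continuous G) :
    Continuous fun q : EuclideanSpace ℝ (Fin N) × ℝ × EuclideanSpace ℝ (Fin N) =>
      stepGradient ρ q.2.1 q.2.2 G q.1 := by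
  have h1 : Continuous fun a : (EuclideanSpace ℝ (Fin N) × ℝ × EuclideanSpace ℝ (Fin N)) ×
      EuclideanSpace ℝ (Fin N) => G (a.1.1 - a.1.2.1 • a.2) := hG.comp (by fun_prop)
  have h0 : Continuous fun a : (EuclideanSpace ℝ (Fin N) × ℝ × EuclideanSpace ℝ (Fin N)) ×
      EuclideanSpace ℝ (Fin N) => (inner ℝ (G (a.1.1 - a.1.2.1 • a.2)) a.2 : ℝ) • a.1.2.2 :=
    (h1.inner (𝕜 := ℝ) continuous_snd).smul continuous_fst.snd.snd
  have h2 : Continuous (Function.uncurry fun (q : EuclideanSpace ℝ (Fin N) × ℝ ×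
      EuclideanSpace ℝ (Fin N)) (z : EuclideanSpace ℝ (Fin N)) => ρ z • (G (q.1 - q.2.1 • z) -
        (inner ℝ (G (q.1 - q.2.1 • z)) z : ℝ) • q.2.2)) :=
    (hρ.smooth.continuous.comp continuous_snd).smul
      (h1.sub h0)
  simp only [stepGradient, hρ.setIntegral_ball_eq]
  exact (continuous_parametric_integral_of_continuous (μ := volume) h2
    (isCompact_closedBall 0 1)).const_smul
      (∫ z in Metric.ball (0 : EuclideanSpace ℝ (Fin N)) 1, ρ z)⁻¹

/-- At boundary points the step is zero, which is the reason why the mollification keeps boundary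
values. -/
theorem IsMollifierKernel.variableStepMollifier_eq_self (hρ : IsMollifierKernel ρ)
    {u η : EuclideanSpace ℝ (Fin N) → ℝ} {x : EuclideanSpace ℝ (Fin N)} (hx : η x = 0) :
    variableStepMollifier ρ η u x = u x := by
  simp only [variableStepMollifier, hx, zero_smul, sub_zero]
  rw [integral_mul_const, ← mul_assoc, inv_mul_cancel₀ hρ.integral_pos.ne', one_mul]

end SmoothMollifier

/-! ### Boundedness of the mollifier on `W^{1,p}` and approximation by globally smooth functions -/

section StepApproximation

variable {N : ℕ} {ρ : EuclideanSpace ℝ (Fin N) → ℝ}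

theorem tendsto_eLpNorm_zero_of_bounded {α F : Type*} [MeasurableSpace α] {μ : Measure α}
    [IsFiniteMeasure μ] [NormedAddCommGroup F] {p : ℝ≥0∞} (hp : 1 ≤ p) (hpt : p ≠ ⊤)
    {v : ℕ → α → F} (hv : ∀ k, AEStronglyMeasurable (v k) μ) {B : ℝ}
    (hB : ∀ k, ∀ᵐ x ∂μ, ‖v k x‖ ≤ B) (hlim : ∀ᵐ x ∂μ, Tendsto (fun k => v k x) atTop (𝓝 0)) :
    Tendsto (fun k => eLpNorm (v k) p μ) atTop (𝓝 0) := by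
  have hq := one_le_toReal hp hpt
  set q := p.toReal with hq'
  have hq0 : 0 < q := by linarith
  have h1 : Tendsto (fun k => ∫⁻ x, ‖v k x‖ₑ ^ q ∂μ) atTop (𝓝 (∫⁻ _, 0 ∂μ)) := by
    refine tendsto_lintegral_of_dominated_convergence' (fun _ => ENNReal.ofReal B ^ q)
      (fun k => (hv k).enorm.pow_const q) (fun k => ?_) ?_ ?_
    · filter_upwards [hB k] with x hx
      refine ENNReal.rpow_le_rpow ?_ hq0.le
      rw [← ofReal_norm]
      exact ENNReal.ofReal_le_ofReal hx
    · rw [lintegral_const]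
      exact ENNReal.mul_ne_top (ENNReal.rpow_ne_top_of_nonneg hq0.le ENNReal.ofReal_ne_top)
        (measure_ne_top _ _)
    · filter_upwards [hlim] with x hx
      have := (hx.enorm).ennrpow_const q
      simpa [hq0] using this
  have h2 := h1.ennrpow_const q⁻¹
  rw [lintegral_zero, ENNReal.zero_rpow_of_pos (by positivity)] at h2
  refine h2.congr fun k => ?_
  rw [← eLpNorm_rpow_toReal hp hpt, ← hq', ENNReal.rpow_rpow_inv hq0.ne']

/-- Since `Ψ` is bounded on a compact set containing all arguments, dominated convergence applies.
It serves for the mollification and its gradient in `Ω` and for the boundary values. -/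
theorem tendsto_eLpNorm_comp_sub {Y F : Type*} [NormedAddCommGroup Y] [ProperSpace Y]
    [NormedAddCommGroup F] [SecondCountableTopologyEither (EuclideanSpace ℝ (Fin N)) Y]
    {μ : Measure (EuclideanSpace ℝ (Fin N))} {S : Set (EuclideanSpace ℝ (Fin N))}
    (hS : MeasurableSet S) (hSb : Bornology.IsBounded S) [IsFiniteMeasure (μ.restrict S)]
    {p : ℝ≥0∞} (hp : 1 ≤ p) (hpt : p ≠ ⊤)
    {Ψ : EuclideanSpace ℝ (Fin N) × Y → F} (hΨ : Continuous Ψ)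
    {a : ℕ → EuclideanSpace ℝ (Fin N) → Y} (ha : ∀ k, Continuous (a k))
    {b : EuclideanSpace ℝ (Fin N) → Y} (hlim : ∀ x ∈ S, Tendsto (fun k => a k x) atTop (𝓝 (b x)))
    {B : ℝ} (hB : ∀ k, ∀ x ∈ S, ‖a k x‖ ≤ B) :
    Tendsto (fun k => eLpNorm (fun x => Ψ (x, a k x) - Ψ (x, b x)) p (μ.restrict S)) atTop
      (𝓝 0) := by
  obtain ⟨C, hC⟩ := (hSb.isCompact_closure.prod
    (isCompact_closedBall (0 : Y) B)).exists_bound_of_continuousOn hΨ.continuousOn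
  have h1 : ∀ k, ∀ x ∈ S, ‖Ψ (x, a k x)‖ ≤ C := fun k x hx =>
    hC _ ⟨subset_closure hx, mem_closedBall_zero_iff.2 (hB k x hx)⟩
  have hl : ∀ x ∈ S, Tendsto (fun k => Ψ (x, a k x)) atTop (𝓝 (Ψ (x, b x))) := fun x hx =>
    (hΨ.tendsto _).comp (tendsto_const_nhds.prodMk_nhds (hlim x hx))
  have h2 : ∀ x ∈ S, ‖Ψ (x, b x)‖ ≤ C := fun x hx =>
    le_of_tendsto' (hl x hx).norm fun k => h1 k x hx
  have hm : ∀ k, AEStronglyMeasurable (fun x => Ψ (x, a k x)) (μ.restrict S) := fun k =>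
    (hΨ.comp (continuous_id.prodMk (ha k))).aestronglyMeasurable
  have hmb : AEStronglyMeasurable (fun x => Ψ (x, b x)) (μ.restrict S) :=
    aestronglyMeasurable_of_tendsto_ae atTop hm ((ae_restrict_iff' hS).2 (ae_of_all _ hl))
  refine tendsto_eLpNorm_zero_of_bounded hp hpt (fun k => (hm k).sub hmb) (B := C + C)
    (fun k => (ae_restrict_iff' hS).2 (ae_of_all _ fun x hx =>
      (norm_sub_le _ _).trans (add_le_add (h1 k x hx) (h2 x hx))))
    ((ae_restrict_iff' hS).2 (ae_of_all _ fun x hx => ?_))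
  simpa using (hl x hx).sub_const (Ψ (x, b x))

theorem IsMollifierKernel.enorm_variableStepMollifier_le (hρ : IsMollifierKernel ρ)
    (η f : EuclideanSpace ℝ (Fin N) → ℝ) (x : EuclideanSpace ℝ (Fin N)) :
    ‖variableStepMollifier ρ η f x‖ₑ ≤
      ‖(∫ z in Metric.ball (0 : EuclideanSpace ℝ (Fin N)) 1, ρ z)⁻¹‖ₑ *
        ∫⁻ z in Metric.ball 0 1, ‖f (x - η x • z)‖ₑ := by
  rw [variableStepMollifier, enorm_mul]
  refine mul_le_mul_right ((enorm_integral_le_lintegral_enorm _).trans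
    (lintegral_mono fun z => ?_)) _
  rw [enorm_mul]
  refine mul_le_of_le_one_left' ?_
  rw [← ofReal_norm, Real.norm_of_nonneg (hρ.nonneg z), ← ENNReal.ofReal_one]
  exact ENNReal.ofReal_le_ofReal (hρ.le_one z)

theorem IsMollifierKernel.enorm_stepGradient_le (hρ : IsMollifierKernel ρ) (s : ℝ)
    (g : EuclideanSpace ℝ (Fin N)) (G : EuclideanSpace ℝ (Fin N) → EuclideanSpace ℝ (Fin N))
    (x : EuclideanSpace ℝ (Fin N)) :
    ‖stepGradient ρ s g G x‖ₑ ≤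
      ‖(∫ z in Metric.ball (0 : EuclideanSpace ℝ (Fin N)) 1, ρ z)⁻¹‖ₑ * ((1 + ‖g‖ₑ) *
        ∫⁻ z in Metric.ball 0 1, ‖G (x - s • z)‖ₑ) := by
  rw [stepGradient, enorm_smul]
  refine mul_le_mul_right ((enorm_integral_le_lintegral_enorm _).trans ?_) _
  rw [← lintegral_const_mul' _ _ (by simp)]
  refine setLIntegral_mono' Metric.isOpen_ball.measurableSet fun z hz => ?_
  rw [enorm_smul]
  have h1 : ‖ρ z‖ₑ ≤ 1 := by
    rw [← ofReal_norm, Real.norm_of_nonneg (hρ.nonneg z), ← ENNReal.ofReal_one]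
    exact ENNReal.ofReal_le_ofReal (hρ.le_one z)
  refine (mul_le_of_le_one_left' h1).trans (enorm_sub_le.trans ?_)
  rw [add_mul, one_mul, enorm_smul, mul_comm ‖g‖ₑ]
  gcongr
  rw [← ofReal_norm, ← ofReal_norm]
  refine ENNReal.ofReal_le_ofReal ((norm_inner_le_norm _ _).trans ?_)
  exact mul_le_of_le_one_right (norm_nonneg _) (mem_ball_zero_iff.1 hz).le

theorem IsMollifierKernel.integrableOn_mul (hρ : IsMollifierKernel ρ) {F : Type*}
    [NormedAddCommGroup F] [NormedSpace ℝ F] {f : EuclideanSpace ℝ (Fin N) → F}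
    {S : Set (EuclideanSpace ℝ (Fin N))} (hf : IntegrableOn f S) :
    IntegrableOn (fun z => ρ z • f z) S := by
  refine Integrable.bdd_smul (C := 1) hf hρ.smooth.continuous.aestronglyMeasurable
    (ae_of_all _ fun z => ?_)
  rw [Real.norm_of_nonneg (hρ.nonneg z)]
  exact hρ.le_one z

variable {Ω : Set (EuclideanSpace ℝ (Fin N))} {η : EuclideanSpace ℝ (Fin N) → ℝ}

theorem IsAdmissibleStep.variableStepMollifier_sub (hη : IsAdmissibleStep Ω η)
    (hρ : IsMollifierKernel ρ) {f u : EuclideanSpace ℝ (Fin N) → ℝ} (hf : IntegrableOn f Ω)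
    (hu : IntegrableOn u Ω) {x : EuclideanSpace ℝ (Fin N)} (hx : x ∈ Ω) :
    variableStepMollifier ρ η u x - variableStepMollifier ρ η f x =
      variableStepMollifier ρ η (fun y => u y - f y) x := by
  have h1 := hρ.integrableOn_mul (hη.integrableOn_comp hf hx)
  have h2 := hρ.integrableOn_mul (hη.integrableOn_comp hu hx)
  simp only [smul_eq_mul] at h1 h2
  simp only [variableStepMollifier, mul_sub]
  rw [integral_sub h2 h1]
  ring

theorem IsMollifierKernel.integrableOn_stepGradient (hρ : IsMollifierKernel ρ)
    {H : EuclideanSpace ℝ (Fin N) → EuclideanSpace ℝ (Fin N)}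
    (hH : IntegrableOn H (Metric.ball 0 1)) (g : EuclideanSpace ℝ (Fin N)) :
    IntegrableOn (fun z => ρ z • (H z - (inner ℝ (H z) z : ℝ) • g)) (Metric.ball 0 1) := by
  refine hρ.integrableOn_mul (hH.sub (Integrable.smul_const ?_ g))
  refine Integrable.mono' hH.norm (hH.1.inner continuous_id.aestronglyMeasurable) ?_
  filter_upwards [ae_restrict_mem Metric.isOpen_ball.measurableSet] with z hz
  refine (norm_inner_le_norm _ _).trans ?_
  exact mul_le_of_le_one_right (norm_nonneg _) (mem_ball_zero_iff.1 hz).le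

theorem IsAdmissibleStep.stepGradient_sub (hη : IsAdmissibleStep Ω η)
    (hρ : IsMollifierKernel ρ) {G H : EuclideanSpace ℝ (Fin N) → EuclideanSpace ℝ (Fin N)}
    (hG : IntegrableOn G Ω) (hH : IntegrableOn H Ω) {x : EuclideanSpace ℝ (Fin N)} (hx : x ∈ Ω)
    (g : EuclideanSpace ℝ (Fin N)) :
    stepGradient ρ (η x) g H x - stepGradient ρ (η x) g G x =
      stepGradient ρ (η x) g (fun y => H y - G y) x := by
  have h1 := hρ.integrableOn_stepGradient (hη.integrableOn_comp hG hx) g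
  have h2 := hρ.integrableOn_stepGradient (hη.integrableOn_comp hH hx) g
  rw [stepGradient, stepGradient, stepGradient, ← smul_sub, ← integral_sub h2 h1]
  congr 1
  refine integral_congr_ae (ae_of_all _ fun z => ?_)
  simp only [inner_sub_left, sub_smul, ← smul_sub]
  congr 1
  abel

theorem IsAdmissibleStep.aestronglyMeasurable_variableStepMollifier (hη : IsAdmissibleStep Ω η)
    (hρ : IsMollifierKernel ρ) (hopen : IsOpen Ω) {f : EuclideanSpace ℝ (Fin N) → ℝ}
    (hf : AEStronglyMeasurable f (volume.restrict Ω)) :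
    AEStronglyMeasurable (variableStepMollifier ρ η f) (volume.restrict Ω) := by
  have hηm := hη.measurable
  have hρm := hρ.smooth.continuous.measurable
  have hm : StronglyMeasurable (Function.uncurry fun x z : EuclideanSpace ℝ (Fin N) =>
      ρ z * hf.mk f (x - η x • z)) :=
    (hρm.comp measurable_snd).stronglyMeasurable.mul
      (hf.stronglyMeasurable_mk.comp_measurable (by fun_prop))
  refine ⟨variableStepMollifier ρ η (hf.mk f), (hm.integral_prod_right (ν :=
    volume.restrict (Metric.ball (0 : EuclideanSpace ℝ (Fin N)) 1))).const_mul _, ?_⟩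
  filter_upwards [ae_restrict_mem hopen.measurableSet] with x hx
  simp only [variableStepMollifier]
  congr 1
  refine integral_congr_ae ?_
  filter_upwards [hη.ae_comp_eq hf.ae_eq_mk hx] with z hz
  rw [hz]

theorem measurable_gradient (u : EuclideanSpace ℝ (Fin N) → ℝ) : Measurable (gradient u) :=
  (InnerProductSpace.toDual ℝ (EuclideanSpace ℝ (Fin N))).symm.continuous.measurable.comp
    (measurable_fderiv ℝ u)

theorem IsAdmissibleStep.aestronglyMeasurable_stepGradient (hη : IsAdmissibleStep Ω η)
    (hρ : IsMollifierKernel ρ) (hopen : IsOpen Ω)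
    {G : EuclideanSpace ℝ (Fin N) → EuclideanSpace ℝ (Fin N)}
    (hG : AEStronglyMeasurable G (volume.restrict Ω)) :
    AEStronglyMeasurable (fun x => stepGradient ρ (η x) (gradient η x) G x)
      (volume.restrict Ω) := by
  have hηm := hη.measurable
  have hgm := measurable_gradient η
  have hρm := hρ.smooth.continuous.measurable
  have h1 : StronglyMeasurable fun a : EuclideanSpace ℝ (Fin N) × EuclideanSpace ℝ (Fin N) =>
      hG.mk G (a.1 - η a.1 • a.2) :=
    hG.stronglyMeasurable_mk.comp_measurable (by fun_prop)
  have h2 : StronglyMeasurable fun a : EuclideanSpace ℝ (Fin N) × EuclideanSpace ℝ (Fin N) =>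
      (inner ℝ (hG.mk G (a.1 - η a.1 • a.2)) a.2 : ℝ) :=
    h1.inner measurable_snd.stronglyMeasurable
  have hm : StronglyMeasurable (Function.uncurry fun x z : EuclideanSpace ℝ (Fin N) =>
      ρ z • (hG.mk G (x - η x • z) - (inner ℝ (hG.mk G (x - η x • z)) z : ℝ) • gradient η x)) :=
    (hρm.comp measurable_snd).stronglyMeasurable.smul
      (h1.sub (h2.smul (hgm.comp measurable_fst).stronglyMeasurable))
  refine ⟨fun x => stepGradient ρ (η x) (gradient η x) (hG.mk G) x, (hm.integral_prod_right (ν :=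
    volume.restrict (Metric.ball (0 : EuclideanSpace ℝ (Fin N)) 1))).const_smul
      (∫ z in Metric.ball (0 : EuclideanSpace ℝ (Fin N)) 1, ρ z)⁻¹, ?_⟩
  filter_upwards [ae_restrict_mem hopen.measurableSet] with x hx
  simp only [stepGradient]
  congr 1
  refine integral_congr_ae ?_
  filter_upwards [hη.ae_comp_eq hG.ae_eq_mk hx] with z hz
  rw [hz]

/-- For smooth `u` and an admissible step, the mollification is approximated by functions smooth on
the whole space whose boundary values are close to those of `u`. -/
theorem IsAdmissibleStep.exists_smooth_close (hη : IsAdmissibleStep Ω η) (hρ : IsMollifierKernel ρ)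
    (hopen : IsOpen Ω) (hbdd : Bornology.IsBounded Ω) [IsFiniteMeasure (surfaceMeasure Ω)]
    {p : ℝ≥0∞} (hp : 1 ≤ p) (hpt : p ≠ ⊤) {u : EuclideanSpace ℝ (Fin N) → ℝ}
    (hu : ContDiff ℝ ∞ u) {ε : ℝ≥0∞} (hε : 0 < ε) :
    ∃ w : EuclideanSpace ℝ (Fin N) → ℝ, ContDiff ℝ ∞ w ∧
      eLpNorm (fun x => w x - variableStepMollifier ρ η u x) p (volume.restrict Ω) < ε ∧
      eLpNorm (fun x => gradient w x - stepGradient ρ (η x) (gradient η x) (gradient u) x) p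
        (volume.restrict Ω) < ε ∧
      eLpNorm (fun x => w x - u x) p (surfaceMeasure Ω) < ε := by
  obtain ⟨ζ, hζ, h1, h2, B, hB⟩ := hη.approx
  have hu1 : ContDiff ℝ 1 u := hu.of_le (by simp)
  have hζ1 : ∀ k, ContDiff ℝ 1 (ζ k) := fun k => (hζ k).of_le (by simp)
  have hfin : IsFiniteMeasure (volume.restrict Ω) :=
    ⟨by rw [Measure.restrict_apply_univ]; exact hbdd.measure_lt_top⟩
  have hfin' : IsFiniteMeasure ((Measure.hausdorffMeasure ((N : ℝ) - 1)).restrict (frontier Ω)) :=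
    ‹IsFiniteMeasure (surfaceMeasure Ω)›
  have hc := hρ.continuous_integral hu.continuous
  have a1 := tendsto_eLpNorm_comp_sub (μ := volume) hopen.measurableSet hbdd hp hpt hc
    (a := ζ) (b := η) (fun k => (hζ k).continuous) (fun x hx => h1 x (subset_closure hx))
    (fun k x hx => (hB k).1 x (subset_closure hx))
  -- The gradient depends on the step and on the gradient of the step, so the parameter is the pair
  -- of both.
  have a2 := tendsto_eLpNorm_comp_sub (μ := volume) hopen.measurableSet hbdd hp hpt
    (hρ.continuous_stepGradient hu1.continuous_gradient)
    (a := fun k x => (ζ k x, gradient (ζ k) x)) (b := fun x => (η x, gradient η x))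
    (fun k => (hζ k).continuous.prodMk (hζ1 k).continuous_gradient)
    (fun x hx => (h1 x (subset_closure hx)).prodMk_nhds (h2 x hx))
    (B := B) (fun k x hx => max_le ((hB k).1 x (subset_closure hx)) ((hB k).2 x hx))
  have a3 := tendsto_eLpNorm_comp_sub (μ := Measure.hausdorffMeasure ((N : ℝ) - 1))
    (S := frontier Ω) isClosed_frontier.measurableSet (hbdd.closure.subset frontier_subset_closure)
    hp hpt hc (a := ζ) (b := η) (fun k => (hζ k).continuous)
    (fun x hx => h1 x (frontier_subset_closure hx))
    (fun k x hx => (hB k).1 x (frontier_subset_closure hx))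
  obtain ⟨k, hk1, hk2, hk3⟩ := ((a1.eventually (gt_mem_nhds hε)).and
    ((a2.eventually (gt_mem_nhds hε)).and (a3.eventually (gt_mem_nhds hε)))).exists
  refine ⟨variableStepMollifier ρ (ζ k) u, hρ.contDiff_variableStepMollifier hu (hζ k), hk1, ?_, ?_⟩
  · simp only [hρ.gradient_variableStepMollifier hu1
      ((hζ1 k).differentiable one_ne_zero).differentiableAt]
    exact hk2
  -- On the boundary `η = 0`, so `u` is its own mollification with step `η` and the third limit
  -- applies.
  · refine lt_of_eq_of_lt (eLpNorm_congr_ae ?_) hk3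
    filter_upwards [ae_restrict_mem isClosed_frontier.measurableSet] with x hx
    rw [← hρ.variableStepMollifier_eq_self (u := u) (hη.eq_zero x hx)]
    rfl

/-- Smooth approximations of `f` in `W^{1,p}(Ω)` give rise to smooth approximations of its
mollification with asymptotically the same boundary values. -/
theorem IsAdmissibleStep.exists_smooth_approx (hη : IsAdmissibleStep Ω η)
    (hρ : IsMollifierKernel ρ) (hopen : IsOpen Ω) (hbdd : Bornology.IsBounded Ω)
    [IsFiniteMeasure (surfaceMeasure Ω)] {p : ℝ≥0∞} (hp : 1 ≤ p) (hpt : p ≠ ⊤)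
    {f : EuclideanSpace ℝ (Fin N) → ℝ} {G : EuclideanSpace ℝ (Fin N) → EuclideanSpace ℝ (Fin N)}
    (hf : MemLp f p (volume.restrict Ω)) (hG : MemLp G p (volume.restrict Ω))
    {u : ℕ → EuclideanSpace ℝ (Fin N) → ℝ} (hu : ∀ n, ContDiff ℝ ∞ (u n))
    (huf : Tendsto (fun n => eLpNorm (fun x => u n x - f x) p (volume.restrict Ω)) atTop (𝓝 0))
    (huG : Tendsto (fun n => eLpNorm (fun x => gradient (u n) x - G x) p (volume.restrict Ω))
      atTop (𝓝 0)) :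
    MemLp (variableStepMollifier ρ η f) p (volume.restrict Ω) ∧
    MemLp (fun x => stepGradient ρ (η x) (gradient η x) G x) p (volume.restrict Ω) ∧
    ∃ w : ℕ → EuclideanSpace ℝ (Fin N) → ℝ, (∀ n, ContDiff ℝ ∞ (w n)) ∧
      Tendsto (fun n => eLpNorm (fun x => w n x - variableStepMollifier ρ η f x) p
        (volume.restrict Ω)) atTop (𝓝 0) ∧
      Tendsto (fun n => eLpNorm (fun x => gradient (w n) x -
        stepGradient ρ (η x) (gradient η x) G x) p (volume.restrict Ω)) atTop (𝓝 0) ∧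
      Tendsto (fun n => eLpNorm (fun x => w n x - u n x) p (surfaceMeasure Ω)) atTop (𝓝 0) := by
  obtain ⟨L, hL⟩ := hη.bounded_gradient
  set c := ‖(∫ z in Metric.ball (0 : EuclideanSpace ℝ (Fin N)) 1, ρ z)⁻¹‖ₑ with hc
  have hct : c ≠ ⊤ := enorm_ne_top
  have hct' : c * (1 + ENNReal.ofReal L) ≠ ⊤ := ENNReal.mul_ne_top hct (by simp)
  obtain ⟨C, hCt, hC⟩ := hη.exists_eLpNorm_le hopen hbdd hp hpt hct ℝ ℝ
  obtain ⟨D, hDt, hD⟩ := hη.exists_eLpNorm_le hopen hbdd hp hpt hct'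
    (EuclideanSpace ℝ (Fin N)) (EuclideanSpace ℝ (Fin N))
  have hT : ∀ v : EuclideanSpace ℝ (Fin N) → ℝ, ∀ x ∈ Ω, ‖variableStepMollifier ρ η v x‖ₑ ≤
      c * ∫⁻ z in Metric.ball 0 1, ‖v (x - η x • z)‖ₑ := fun v x _ =>
    hρ.enorm_variableStepMollifier_le η v x
  have hS : ∀ H : EuclideanSpace ℝ (Fin N) → EuclideanSpace ℝ (Fin N), ∀ x ∈ Ω,
      ‖stepGradient ρ (η x) (gradient η x) H x‖ₑ ≤
      c * (1 + ENNReal.ofReal L) * ∫⁻ z in Metric.ball 0 1, ‖H (x - η x • z)‖ₑ := by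
    intro H x hx
    refine (hρ.enorm_stepGradient_le _ _ _ _).trans ?_
    rw [← mul_assoc]
    gcongr
    rw [← ofReal_norm]
    exact ENNReal.ofReal_le_ofReal (hL x hx)
  have hfi := MemLp.integrableOn_of_isBounded hbdd hp hf
  have hGi := MemLp.integrableOn_of_isBounded hbdd hp hG
  have hTm := hη.aestronglyMeasurable_variableStepMollifier hρ hopen hf.1
  have hSm := hη.aestronglyMeasurable_stepGradient hρ hopen hG.1
  refine ⟨⟨hTm, (hC f _ hf.1 (hT f)).trans_lt (ENNReal.mul_lt_top hCt.lt_top hf.2)⟩,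
    ⟨hSm, (hD G _ hG.1 (hS G)).trans_lt (ENNReal.mul_lt_top hDt.lt_top hG.2)⟩, ?_⟩
  have hε : ∀ n : ℕ, (0 : ℝ≥0∞) < ((n : ℝ≥0∞) + 1)⁻¹ := fun n =>
    ENNReal.inv_pos.2 (by simp)
  have hε0 : Tendsto (fun n : ℕ => ((n : ℝ≥0∞) + 1)⁻¹) atTop (𝓝 0) := by
    have := (tendsto_add_atTop_iff_nat 1).2 ENNReal.tendsto_inv_nat_nhds_zero
    simpa using this
  -- In general the mollification of `u n` is smooth only in `Ω`; `w n` is a globally smooth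
  -- substitute within `1 / (n + 1)`.
  choose w hw hw1 hw2 hw3 using fun n => hη.exists_smooth_close hρ hopen hbdd hp hpt (hu n) (hε n)
  have hui : ∀ n, IntegrableOn (u n) Ω := fun n =>
    ((hu n).continuous.continuousOn.integrableOn_compact hbdd.isCompact_closure).mono_set
      subset_closure
  have hgc : ∀ n, Continuous (gradient (u n)) := fun n =>
    (ContDiff.of_le (n := ((⊤ : ℕ∞) : WithTop ℕ∞)) (m := 1) (hu n) (by simp)).continuous_gradient
  have hgi : ∀ n, IntegrableOn (gradient (u n)) Ω := fun n =>
    ((hgc n).continuousOn.integrableOn_compact hbdd.isCompact_closure).mono_set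
      subset_closure
  have hb1 : Tendsto (fun n : ℕ => ((n : ℝ≥0∞) + 1)⁻¹ +
      C * eLpNorm (fun x => u n x - f x) p (volume.restrict Ω)) atTop (𝓝 0) := by
    simpa using hε0.add (ENNReal.Tendsto.const_mul huf (Or.inr hCt))
  have hb2 : Tendsto (fun n : ℕ => ((n : ℝ≥0∞) + 1)⁻¹ +
      D * eLpNorm (fun x => gradient (u n) x - G x) p (volume.restrict Ω)) atTop (𝓝 0) := by
    simpa using hε0.add (ENNReal.Tendsto.const_mul huG (Or.inr hDt))
  refine ⟨w, hw, tendsto_of_tendsto_of_tendsto_of_le_of_le tendsto_const_nhds hb1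
    (fun _ => zero_le) fun n => ?_, tendsto_of_tendsto_of_tendsto_of_le_of_le
    tendsto_const_nhds hb2 (fun _ => zero_le) fun n => ?_,
    tendsto_of_tendsto_of_tendsto_of_le_of_le tendsto_const_nhds hε0 (fun _ => zero_le)
      fun n => (hw3 n).le⟩
  · have hTu := hη.aestronglyMeasurable_variableStepMollifier hρ hopen (hui n).1
    -- The error splits into the substitution error and the mollification of `u n - f`, bounded by
    -- the averaging estimate. Linearity is used only on `Ω`, where the integrals converge.
    have e : (fun x => w n x - variableStepMollifier ρ η f x) =ᵐ[volume.restrict Ω]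
        (fun x => w n x - variableStepMollifier ρ η (u n) x) +
          variableStepMollifier ρ η (fun y => u n y - f y) := by
      filter_upwards [ae_restrict_mem hopen.measurableSet] with x hx
      rw [Pi.add_apply, ← hη.variableStepMollifier_sub hρ hfi (hui n) hx]
      ring
    dsimp only
    rw [eLpNorm_congr_ae e]
    refine (eLpNorm_add_le ((hw n).continuous.aestronglyMeasurable.sub hTu)
      (hη.aestronglyMeasurable_variableStepMollifier hρ hopen ((hui n).1.sub hf.1)) hp).trans ?_
    exact add_le_add (hw1 n).le (hC _ _ ((hui n).1.sub hf.1) (hT _))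
  · have hSu := hη.aestronglyMeasurable_stepGradient hρ hopen (hgi n).1
    have e : (fun x => gradient (w n) x - stepGradient ρ (η x) (gradient η x) G x)
        =ᵐ[volume.restrict Ω]
        (fun x => gradient (w n) x - stepGradient ρ (η x) (gradient η x) (gradient (u n)) x) +
          fun x => stepGradient ρ (η x) (gradient η x) (fun y => gradient (u n) y - G y) x := by
      filter_upwards [ae_restrict_mem hopen.measurableSet] with x hx
      rw [Pi.add_apply, ← hη.stepGradient_sub hρ hGi (hgi n) hx]
      abel
    dsimp only
    rw [eLpNorm_congr_ae e]
    refine (eLpNorm_add_le ((measurable_gradient (w n)).aestronglyMeasurable.sub hSu)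
      (hη.aestronglyMeasurable_stepGradient hρ hopen ((hgi n).1.sub hG.1)) hp).trans ?_
    exact add_le_add (hw2 n).le (hD _ _ ((hgi n).1.sub hG.1) (hS _))

end StepApproximation

/-! ### Both classes of step functions are admissible -/

section AdmissibleSteps

variable {N : ℕ} {Ω : Set (EuclideanSpace ℝ (Fin N))} {η : EuclideanSpace ℝ (Fin N) → ℝ}

/-- A function smooth on the whole space whose zero set contains `∂Ω` and whose gradient vanishes
on `∂Ω`, lying strictly between zero and the distance to `∂Ω` elsewhere, is an admissible step. -/
theorem IsWhitneyStep.isAdmissibleStep (hη : IsWhitneyStep (frontier Ω) η) (hopen : IsOpen Ω)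
    (hbdd : Bornology.IsBounded Ω) : IsAdmissibleStep Ω η := by
  have hη1 : ContDiff ℝ 1 η := ContDiff.of_le (n := ((⊤ : ℕ∞) : WithTop ℕ∞)) (m := 1)
    hη.smooth (by simp)
  have hcf := hη1.continuous_fderiv one_ne_zero
  have hd := hη1.differentiable one_ne_zero
  have hnf : ∀ x ∈ Ω, x ∉ frontier Ω := fun x hx h => by
    rw [hopen.frontier_eq] at h; exact h.2 hx
  have hle : ∀ x ∈ Ω, η x ≤ Metric.infDist x (frontier Ω) := fun x hx =>
    (hη.lt_infDist x (hnf x hx)).le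
  have hpos : ∀ x ∈ Ω, 0 < η x := fun x hx =>
    lt_of_le_of_ne (hη.nonneg x) fun h => hnf x hx ((hη.eq_zero_iff x).1 h.symm)
  have hK := isCompact_frontier_of_isBounded hbdd
  obtain ⟨B, hB⟩ := hbdd.isCompact_closure.exists_bound_of_continuousOn
    hη1.continuous_gradient.continuousOn
  obtain ⟨B', hB'⟩ := hbdd.isCompact_closure.exists_bound_of_continuousOn
    hη.smooth.continuous.continuousOn
  refine ⟨hη.smooth.continuous.measurable, hpos, fun x hx => (hη.eq_zero_iff x).2 hx, hle, ?_,
    ⟨B, fun x hx => hB x (subset_closure hx)⟩,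
    fun _ => η, fun _ => hη.smooth, fun _ _ => tendsto_const_nhds, fun _ _ => tendsto_const_nhds,
    max B' B, fun _ => ⟨fun x hx => (hB' x hx).trans (le_max_left _ _),
      fun x hx => (hB x (subset_closure hx)).trans (le_max_right _ _)⟩⟩
  have hU : IsOpen {y | ‖fderiv ℝ η y‖ < 1 / 2} := isOpen_lt hcf.norm continuous_const
  have hKU : frontier Ω ⊆ {y | ‖fderiv ℝ η y‖ < 1 / 2} := fun y hy => by
    have h1 : ‖fderiv ℝ η y‖ = 0 := by
      rw [← norm_iteratedFDeriv_one, hη.deriv_eq_zero 1 y hy, norm_zero]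
    simp [h1]
  obtain ⟨δ, hδ, hsub⟩ := hK.exists_thickening_subset_open hU hKU
  have hc1 : Continuous fun x => Metric.infDist x (frontier Ω) := Metric.continuous_infDist_pt _
  have hS : IsCompact (closure Ω ∩ {x | δ / 2 ≤ Metric.infDist x (frontier Ω)}) :=
    hbdd.isCompact_closure.inter_right (isClosed_le continuous_const hc1)
  -- At distance at least `δ / 2` from the boundary, compactness gives a positive lower bound for
  -- `η`.
  obtain ⟨m, hm, hmle⟩ := hS.exists_forall_le' hη.smooth.continuous.continuousOn (a := 0)
    fun x hx => lt_of_le_of_ne (hη.nonneg x) fun h => by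
      have h1 := hx.2
      rw [Set.mem_ofPred_eq, Metric.infDist_zero_of_mem ((hη.eq_zero_iff x).1 h.symm)] at h1
      linarith
  refine ⟨2, two_pos, m, hm, fun x hx => ?_⟩
  rcases le_or_gt (δ / 2) (Metric.infDist x (frontier Ω)) with h | h
  · exact Or.inl (hmle x ⟨subset_closure hx, h⟩)
  refine Or.inr fun y hy => ?_
  -- The distance to the empty set is `0` by convention, so an empty frontier would force `η x ≤ 0`.
  have hne : (frontier Ω).Nonempty := by
    by_contra hne
    rw [Set.not_nonempty_iff_eq_empty] at hne
    have := hle x hx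
    rw [hne, Metric.infDist_empty] at this
    linarith [hpos x hx]
  -- As `η x` is at most the boundary distance of `x`, which is below `δ / 2`, the ball stays within
  -- `δ` of the boundary. There the slope of `η` is at most `1 / 2`, so `η` differs from `η x` by at
  -- most `η x / 2`.
  have hball : ∀ w ∈ Metric.ball x (η x), ‖fderiv ℝ η w‖ ≤ 1 / 2 := by
    intro w hw
    have hw2 : w ∈ {y | ‖fderiv ℝ η y‖ < 1 / 2} := by
      refine hsub (Metric.mem_thickening_iff.2 ?_)
      refine (Metric.infDist_lt_iff hne).1 ?_
      have h1 := Metric.infDist_le_infDist_add_dist (s := frontier Ω) (x := w) (y := x)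
      have h2 := hle x hx
      have h3 := Metric.mem_ball.1 hw
      linarith
    exact le_of_lt hw2
  have hlip := (convex_ball x (η x)).norm_image_sub_le_of_norm_fderiv_le
    (fun w _ => hd.differentiableAt) hball (Metric.mem_ball_self (hpos x hx)) hy
  rw [Real.norm_eq_abs, abs_le, ← dist_eq_norm] at hlip
  have h3 := Metric.mem_ball.1 hy
  constructor <;> linarith [hlip.1, hlip.2]

/-- A space of positive dimension is unbounded, so a segment from `Ω` leaves it. This ensures that
the boundary distance is positive on `Ω`, which fails by convention for an empty frontier. -/
theorem nonempty_frontier_of_isBounded (hN : 1 ≤ N) (hbdd : Bornology.IsBounded Ω)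
    (hne : Ω.Nonempty) : (frontier Ω).Nonempty := by
  obtain ⟨y, hy⟩ := hne
  have : Nonempty (Fin N) := ⟨⟨0, hN⟩⟩
  obtain ⟨R, hR⟩ := hbdd.exists_norm_le
  obtain ⟨x, hx⟩ := NormedSpace.exists_lt_norm ℝ (EuclideanSpace ℝ (Fin N)) R
  obtain ⟨b, -, hb⟩ := exists_mem_segment_frontier hy fun h => (hR x h).not_gt hx
  exact ⟨b, hb⟩

/-- The derivative of `h` is bounded but possibly discontinuous, so it is moved under the integral
by domination. -/
theorem hasFDerivAt_normed_convolution (φ : ContDiffBump (0 : EuclideanSpace ℝ (Fin N)))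
    {h : EuclideanSpace ℝ (Fin N) → ℝ} (hd : Differentiable ℝ h) {L : ℝ}
    (hL : ∀ x, ‖fderiv ℝ h x‖ ≤ L) (x : EuclideanSpace ℝ (Fin N)) :
    HasFDerivAt (MeasureTheory.convolution (φ.normed volume) h (ContinuousLinearMap.lsmul ℝ ℝ)
        volume)
      (MeasureTheory.convolution (φ.normed volume) (fderiv ℝ h) (ContinuousLinearMap.lsmul ℝ ℝ)
        volume x) x := by
  have hm : Continuous h := hd.continuous
  refine hasFDerivAt_integral_of_dominated_of_fderiv_le (s := Set.univ)
    (F := fun x t => ContinuousLinearMap.lsmul ℝ ℝ (φ.normed volume t) (h (x - t)))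
    (F' := fun x t => ContinuousLinearMap.lsmul ℝ ℝ (φ.normed volume t) (fderiv ℝ h (x - t)))
    (bound := fun t => φ.normed volume t * L) Filter.univ_mem
    (Eventually.of_forall fun y => ?_) ?_ ?_ ?_ (φ.integrable_normed.mul_const L) ?_
  · exact (φ.continuous_normed.mul (hm.comp (by fun_prop))).aestronglyMeasurable
  · exact (φ.continuous_normed.mul (hm.comp (f := fun t => x - t) (by fun_prop))
      ).integrable_of_hasCompactSupport φ.hasCompactSupport_normed.mul_right
  · exact φ.continuous_normed.aestronglyMeasurable.smul
      (((measurable_fderiv ℝ h).comp (measurable_const.sub measurable_id)).aestronglyMeasurable)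
  · refine ae_of_all _ fun t y _ => ?_
    rw [ContinuousLinearMap.lsmul_apply, norm_smul, Real.norm_of_nonneg (φ.nonneg_normed t)]
    exact mul_le_mul_of_nonneg_left (hL _) (φ.nonneg_normed t)
  · refine ae_of_all _ fun t y _ => ?_
    have h1 : HasFDerivAt (fun y => h (y - t)) (fderiv ℝ h (y - t)) y :=
      (hasFDerivAt_comp_sub t).2 (hd.differentiableAt (x := y - t)).hasFDerivAt
    exact h1.const_mul (φ.normed volume t)

theorem norm_normed_convolution_le (φ : ContDiffBump (0 : EuclideanSpace ℝ (Fin N))) {F : Type*}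
    [NormedAddCommGroup F] [NormedSpace ℝ F] {h : EuclideanSpace ℝ (Fin N) → F} {L : ℝ}
    (hL : ∀ x, ‖h x‖ ≤ L) (x : EuclideanSpace ℝ (Fin N)) :
    ‖MeasureTheory.convolution (φ.normed volume) h (ContinuousLinearMap.lsmul ℝ ℝ) volume x‖
      ≤ L := by
  refine (norm_integral_le_of_norm_le (φ.integrable_normed.mul_const L) (ae_of_all _ fun t => ?_)
    ).trans (by rw [integral_mul_const, φ.integral_normed, one_mul])
  rw [ContinuousLinearMap.lsmul_apply, norm_smul, Real.norm_of_nonneg (φ.nonneg_normed t)]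
  exact mul_le_mul_of_nonneg_left (hL _) (φ.nonneg_normed t)

/-- Bounded functions with a bounded derivative can be approximated by smooth functions, with
uniform bounds, pointwise and also in the gradient wherever the latter is continuous. -/
theorem Differentiable.exists_smooth_approx {h : EuclideanSpace ℝ (Fin N) → ℝ}
    (hd : Differentiable ℝ h) {L M : ℝ} (hM : ∀ x, |h x| ≤ M) (hL : ∀ x, ‖fderiv ℝ h x‖ ≤ L) :
    ∃ ζ : ℕ → EuclideanSpace ℝ (Fin N) → ℝ, (∀ k, ContDiff ℝ ∞ (ζ k)) ∧
      (∀ x, Tendsto (fun k => ζ k x) atTop (𝓝 (h x))) ∧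
      (∀ x, ContinuousAt (fderiv ℝ h) x →
        Tendsto (fun k => gradient (ζ k) x) atTop (𝓝 (gradient h x))) ∧
      ∀ k x, |ζ k x| ≤ M ∧ ‖gradient (ζ k) x‖ ≤ L := by
  let φ : ℕ → ContDiffBump (0 : EuclideanSpace ℝ (Fin N)) := fun k =>
    ⟨1 / ((k : ℝ) + 1) / 2, 1 / ((k : ℝ) + 1), by positivity, half_lt_self (by positivity)⟩
  have hφ : Tendsto (fun k => (φ k).rOut) atTop (𝓝 0) := tendsto_one_div_add_atTop_nhds_zero_nat
  have hf := fun k x => (hasFDerivAt_normed_convolution (φ k) hd hL x).fderiv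
  refine ⟨fun k => MeasureTheory.convolution ((φ k).normed volume) h
    (ContinuousLinearMap.lsmul ℝ ℝ) volume, fun k => ?_, fun x => ?_, fun x hx => ?_,
    fun k x => ⟨norm_normed_convolution_le (h := h) (φ k) hM x, ?_⟩⟩
  · exact (φ k).hasCompactSupport_normed.contDiff_convolution_left _ (φ k).contDiff_normed
      hd.continuous.locallyIntegrable
  · exact ContDiffBump.convolution_tendsto_right_of_continuous hφ hd.continuous x
  · refine ((InnerProductSpace.toDual ℝ (EuclideanSpace ℝ (Fin N))).symm.continuous.tendsto
      (fderiv ℝ h x)).comp ?_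
    simp only [hf]
    exact ContDiffBump.convolution_tendsto_right (g := fun _ => fderiv ℝ h) hφ
      (Eventually.of_forall fun _ => (measurable_fderiv ℝ h).aestronglyMeasurable)
      (hx.tendsto.comp tendsto_snd) tendsto_const_nhds
  · rw [norm_gradient_eq, hf]
    exact norm_normed_convolution_le (φ k) hL x

/-- At `x ∉ Ω` the extension by zero is bounded near `x` by the squared distance to `x`, because `η
≤ σ²`. It is thus differentiable everywhere with bounded derivative, and its mollifications are the
required smooth steps. Their gradients need to converge only in `Ω`, where the derivative is
continuous. -/
theorem IsQuadraticStep.isAdmissibleStep_indicator (hη : IsQuadraticStep Ω η) (hN : 1 ≤ N)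
    (hopen : IsOpen Ω) (hbdd : Bornology.IsBounded Ω) :
    IsAdmissibleStep Ω (Ω.indicator η) := by
  obtain ⟨κ, hκ, hlow⟩ := hη.quadratic_lower
  obtain ⟨L, hL⟩ := hη.bounded_gradient
  set σ : EuclideanSpace ℝ (Fin N) → ℝ := fun x => Metric.infDist x (frontier Ω) with hσ
  have hnf : ∀ x ∈ Ω, x ∉ frontier Ω := fun x hx h => by
    rw [hopen.frontier_eq] at h; exact h.2 hx
  have hσpos : ∀ x ∈ Ω, 0 < σ x := fun x hx =>
    (isClosed_frontier.notMem_iff_infDist_pos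
      (nonempty_frontier_of_isBounded hN hbdd ⟨x, hx⟩)).1 (hnf x hx)
  have hev : ∀ x ∈ Ω, Ω.indicator η =ᶠ[𝓝 x] η := fun x hx => by
    filter_upwards [hopen.mem_nhds hx] with y hy using Set.indicator_of_mem hy η
  have hpos : ∀ x ∈ Ω, 0 < η x := fun x hx =>
    (mul_pos hκ (pow_pos (hσpos x hx) 2)).trans_le (hlow x hx)
  have hη1 : ContDiffOn ℝ 1 η Ω := hη.smooth.of_le (by simp)
  have hdΩ : ∀ x ∈ Ω, DifferentiableAt ℝ η x := fun x hx =>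
    (hη1.differentiableOn one_ne_zero).differentiableAt (hopen.mem_nhds hx)
  have hout : ∀ x ∉ Ω, HasFDerivAt (Ω.indicator η)
      (0 : EuclideanSpace ℝ (Fin N) →L[ℝ] ℝ) x := by
    intro x hx
    refine Asymptotics.IsBigO.hasFDerivAt (n := 2) ?_ one_lt_two
    refine Asymptotics.IsBigO.of_bound 1 (Eventually.of_forall fun y => ?_)
    rw [one_mul, norm_pow, norm_norm]
    by_cases hy : y ∈ Ω
    · rw [Set.indicator_of_mem hy, Real.norm_of_nonneg (hpos y hy).le]
      refine (hη.quadratic_upper y hy).trans ?_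
      rw [← dist_eq_norm]
      exact pow_le_pow_left₀ Metric.infDist_nonneg (infDist_frontier_le_dist hy hx) 2
    · rw [Set.indicator_of_notMem hy, norm_zero]
      positivity
  have hd : Differentiable ℝ (Ω.indicator η) := fun x => by
    by_cases hx : x ∈ Ω
    · exact (hdΩ x hx).congr_of_eventuallyEq (hev x hx)
    · exact (hout x hx).differentiableAt
  have hgrad : ∀ x ∈ Ω, gradient (Ω.indicator η) x = gradient η x := fun x hx => by
    rw [gradient, gradient, (hev x hx).fderiv_eq]
  have hL' : ∀ x, ‖fderiv ℝ (Ω.indicator η) x‖ ≤ max L 0 := fun x => by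
    by_cases hx : x ∈ Ω
    · rw [← norm_gradient_eq, hgrad x hx]
      exact (hL x hx).trans (le_max_left _ _)
    · rw [(hout x hx).fderiv, norm_zero]
      exact le_max_right _ _
  obtain ⟨M, hM⟩ := hbdd.isCompact_closure.exists_bound_of_continuousOn
    hd.continuous.continuousOn
  have hM' : ∀ x, |Ω.indicator η x| ≤ max M 0 := fun x => by
    by_cases hx : x ∈ Ω
    · exact (hM x (subset_closure hx)).trans (le_max_left _ _)
    · rw [Set.indicator_of_notMem hx, abs_zero]
      exact le_max_right _ _
  obtain ⟨ζ, hζ, h1, h2, h3⟩ := hd.exists_smooth_approx hM' hL'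
  refine ⟨hd.continuous.measurable, fun x hx => ?_, fun x hx => ?_, fun x hx => ?_, ?_,
    ⟨max L 0, fun x hx => ?_⟩, ζ, hζ, fun x _ => h1 x,
    fun x hx => h2 x ?_, max (max M 0) (max L 0), fun k => ⟨fun x _ =>
      (h3 k x).1.trans (le_max_left _ _), fun x _ => (h3 k x).2.trans (le_max_right _ _)⟩⟩
  · rw [Set.indicator_of_mem hx]
    exact hpos x hx
  · exact Set.indicator_of_notMem (fun h => hnf x h hx) η
  · rw [Set.indicator_of_mem hx]
    exact hη.le_infDist x hx
  -- If `σ x ≥ 1/2`, then `η x ≥ κ / 4`. Otherwise `η x ≤ (σ x)^2 ≤ σ x / 2`, so `σ` changes by a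
  -- factor of at most `2` on the ball and `σ²` by at most `4`; passing between `κ σ²` and `σ²`
  -- costs `1 / κ`.
  · refine ⟨max 1 (4 / κ), by positivity, κ / 4, by positivity, fun x hx => ?_⟩
    rw [Set.indicator_of_mem hx]
    have hlx := hlow x hx
    have hux := hη.quadratic_upper x hx
    have hsx := hσpos x hx
    rcases le_or_gt (1 / 2) (σ x) with h | h
    · left
      have : (1 / 2 : ℝ) ^ 2 ≤ σ x ^ 2 := pow_le_pow_left₀ (by norm_num) h 2
      nlinarith
    · right
      intro y hy
      have hyΩ : y ∈ Ω := ball_infDist_frontier_subset hx (hη.le_infDist x hx) hy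
      rw [Set.indicator_of_mem hyΩ]
      have hly := hlow y hyΩ
      have huy := hη.quadratic_upper y hyΩ
      have hyd := Metric.mem_ball.1 hy
      have d1 : σ y ≤ σ x + dist y x := Metric.infDist_le_infDist_add_dist
      have d2 : σ x ≤ σ y + dist x y := Metric.infDist_le_infDist_add_dist
      rw [dist_comm x y] at d2
      have hsq : σ x ^ 2 ≤ σ x / 2 := by nlinarith
      have e1 : σ y ≤ 2 * σ x := by linarith
      have e2 : σ x ≤ 2 * σ y := by linarith
      have hsy := hσpos y hyΩ
      have f1 : σ y ^ 2 ≤ 4 * σ x ^ 2 := by nlinarith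
      have f2 : σ x ^ 2 ≤ 4 * σ y ^ 2 := by nlinarith
      have key : ∀ a b s t : ℝ, 0 < b → a ≤ s → s ≤ 4 * t → κ * t ≤ b →
          a ≤ max 1 (4 / κ) * b := by
        intro a b s t hb has hst htb
        have : t ≤ b / κ := by rw [le_div_iff₀ hκ]; linarith
        calc a ≤ 4 * (b / κ) := by linarith
          _ = 4 / κ * b := by ring
          _ ≤ _ := mul_le_mul_of_nonneg_right (le_max_right _ _) hb.le
      exact ⟨key _ _ _ _ (hpos x hx) huy f1 hlx, key _ _ _ _ (hpos y hyΩ) hux f2 hly⟩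
  · rw [norm_gradient_eq]
    exact hL' x
  · have hc : ContinuousAt (fderiv ℝ η) x :=
      (hη1.continuousOn_fderiv_of_isOpen hopen le_rfl).continuousAt
        (hopen.mem_nhds hx)
    exact hc.congr (((hev x hx).fderiv).symm)

theorem variableStepMollifier_indicator (ρ f : EuclideanSpace ℝ (Fin N) → ℝ)
    {x : EuclideanSpace ℝ (Fin N)} (hx : x ∈ Ω) :
    variableStepMollifier ρ (Ω.indicator η) f x = variableStepMollifier ρ η f x := by
  simp only [variableStepMollifier, Set.indicator_of_mem hx]

end AdmissibleSteps

/-! ### Existence, uniqueness and regularity of traces -/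

section Traces

variable {N : ℕ} {Ω : Set (EuclideanSpace ℝ (Fin N))} {p : ℝ≥0∞}

/-- The smooth functions `u n` converge to `f` in `L^p(Ω)`, and their gradients to `G`. -/
structure IsSmoothApprox (Ω : Set (EuclideanSpace ℝ (Fin N))) (p : ℝ≥0∞)
    (f : EuclideanSpace ℝ (Fin N) → ℝ) (G : EuclideanSpace ℝ (Fin N) → EuclideanSpace ℝ (Fin N))
    (u : ℕ → EuclideanSpace ℝ (Fin N) → ℝ) : Prop where
  smooth : ∀ n, ContDiff ℝ ∞ (u n)
  tendsto : Tendsto (fun n => eLpNorm (fun x => u n x - f x) p (volume.restrict Ω)) atTop (𝓝 0)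
  tendsto_gradient : Tendsto (fun n => eLpNorm (fun x => gradient (u n) x - G x) p
    (volume.restrict Ω)) atTop (𝓝 0)

variable {f : EuclideanSpace ℝ (Fin N) → ℝ} {G : EuclideanSpace ℝ (Fin N) → EuclideanSpace ℝ (Fin N)}
  {u : ℕ → EuclideanSpace ℝ (Fin N) → ℝ}

theorem IsSmoothApprox.contDiff_one (h : IsSmoothApprox Ω p f G u) (n : ℕ) : ContDiff ℝ 1 (u n) :=
  ContDiff.of_le (n := ((⊤ : ℕ∞) : WithTop ℕ∞)) (m := 1) (h.smooth n) (by simp)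

theorem IsSmoothApprox.congr_ae {f' : EuclideanSpace ℝ (Fin N) → ℝ}
    {G' : EuclideanSpace ℝ (Fin N) → EuclideanSpace ℝ (Fin N)} (h : IsSmoothApprox Ω p f G u)
    (hf : f =ᵐ[volume.restrict Ω] f') (hG : G =ᵐ[volume.restrict Ω] G') :
    IsSmoothApprox Ω p f' G' u := by
  refine ⟨h.smooth, h.tendsto.congr fun n => eLpNorm_congr_ae ?_,
    h.tendsto_gradient.congr fun n => eLpNorm_congr_ae ?_⟩
  · filter_upwards [hf] with x hx
    rw [hx]
  · filter_upwards [hG] with x hx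
    rw [hx]

theorem integral_smul_gradient_of_contDiff {u φ : EuclideanSpace ℝ (Fin N) → ℝ}
    (hu : ContDiff ℝ 1 u) (hφ : ContDiff ℝ 1 φ) (hc : HasCompactSupport φ)
    (hs : tsupport φ ⊆ Ω) :
    ∫ x in Ω, u x • gradient φ x = -∫ x in Ω, φ x • gradient u x := by
  have hgs : ∀ x ∉ tsupport φ, gradient φ x = 0 := fun x hx => by
    have : fderiv ℝ φ x = 0 := image_eq_zero_of_notMem_tsupport fun h =>
      hx (tsupport_fderiv_subset ℝ h)
    rw [gradient, this, map_zero]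
  rw [setIntegral_eq_integral_of_forall_compl_eq_zero fun x hx => by
      rw [hgs x fun h => hx (hs h), smul_zero],
    setIntegral_eq_integral_of_forall_compl_eq_zero fun x hx => by
      rw [image_eq_zero_of_notMem_tsupport fun h => hx (hs h), zero_smul]]
  have hgc : HasCompactSupport (gradient φ) := HasCompactSupport.intro hc hgs
  have i1 : Integrable fun x => u x • gradient φ x :=
    (hu.continuous.smul hφ.continuous_gradient).integrable_of_hasCompactSupport hgc.smul_left
  have i2 : Integrable fun x => φ x • gradient u x :=
    (hφ.continuous.smul hu.continuous_gradient).integrable_of_hasCompactSupport hc.smul_right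
  refine ext_inner_left ℝ fun w => ?_
  rw [inner_neg_right, ← integral_inner i1, ← integral_inner i2]
  have e1 : ∀ x, inner ℝ w (u x • gradient φ x) = u x * fderiv ℝ φ x w := fun x => by
    rw [inner_smul_right, real_inner_comm, inner_gradient_eq_fderiv]
  have e2 : ∀ x, inner ℝ w (φ x • gradient u x) = fderiv ℝ u x w * φ x := fun x => by
    rw [inner_smul_right, real_inner_comm, inner_gradient_eq_fderiv, mul_comm]
  have j1 := i1.const_inner (𝕜 := ℝ) w
  have j2 := i2.const_inner (𝕜 := ℝ) w
  simp only [e1, e2] at j1 j2 ⊢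
  exact integral_mul_fderiv_eq_neg_fderiv_mul_of_integrable j2 j1
    ((hu.continuous.mul hφ.continuous).integrable_of_hasCompactSupport hc.mul_left)
    (fun x _ => (hu.differentiable one_ne_zero).differentiableAt)
    fun x _ => (hφ.differentiable one_ne_zero).differentiableAt

theorem tendsto_eLpNorm_one_of_tendsto {α F : Type*} [MeasurableSpace α] {μ : Measure α}
    [IsFiniteMeasure μ] [NormedAddCommGroup F] (hp : 1 ≤ p) {v : ℕ → α → F}
    (hv : ∀ n, AEStronglyMeasurable (v n) μ)
    (h : Tendsto (fun n => eLpNorm (v n) p μ) atTop (𝓝 0)) :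
    Tendsto (fun n => eLpNorm (v n) 1 μ) atTop (𝓝 0) := by
  have hc : μ Set.univ ^ (1 / (1 : ℝ≥0∞).toReal - 1 / p.toReal) ≠ ⊤ := by
    refine ENNReal.rpow_ne_top_of_nonneg ?_ (measure_ne_top _ _)
    rcases eq_or_ne p ⊤ with rfl | hpt
    · simp
    · have := one_le_toReal hp hpt
      rw [ENNReal.toReal_one, one_div_one, sub_nonneg, div_le_one (by linarith)]
      exact this
  have h1 := ENNReal.Tendsto.mul_const h (Or.inr hc)
  rw [zero_mul] at h1
  exact tendsto_of_tendsto_of_tendsto_of_le_of_le tendsto_const_nhds h1 (fun _ => zero_le)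
    fun n => eLpNorm_le_eLpNorm_mul_rpow_measure_univ hp (hv n)

/-- Weak gradients are closed under `L^p` limits of smooth functions. -/
theorem IsSmoothApprox.hasWeakGradient (h : IsSmoothApprox Ω p f G u)
    (hbdd : Bornology.IsBounded Ω) (hp : 1 ≤ p) (hf : MemLp f p (volume.restrict Ω))
    (hG : MemLp G p (volume.restrict Ω)) : HasWeakGradient Ω f G := by
  have hfin : IsFiniteMeasure (volume.restrict Ω) :=
    ⟨by rw [Measure.restrict_apply_univ]; exact hbdd.measure_lt_top⟩
  have hfi := MemLp.integrableOn_of_isBounded hbdd hp hf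
  have hGi := MemLp.integrableOn_of_isBounded hbdd hp hG
  refine ⟨hfi.locallyIntegrableOn, hGi.locallyIntegrableOn, fun φ hφ hc hs => ?_⟩
  have hφ1 : ContDiff ℝ 1 φ :=
    ContDiff.of_le (n := ((⊤ : ℕ∞) : WithTop ℕ∞)) (m := 1) hφ (by simp)
  obtain ⟨A, hA⟩ := hc.exists_bound_of_continuous hφ.continuous
  obtain ⟨D, hD⟩ := hφ1.exists_bound_gradient hc
  have huc := fun n => (h.smooth n).continuous
  have hgc := fun n => (h.contDiff_one n).continuous_gradient
  have hKi : ∀ {F : Type} [NormedAddCommGroup F] {v : EuclideanSpace ℝ (Fin N) → F},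
      Continuous v → IntegrableOn v Ω := fun hv =>
    (hv.continuousOn.integrableOn_compact hbdd.isCompact_closure).mono_set subset_closure
  have t1 := tendsto_eLpNorm_one_of_tendsto hp
    (fun n => (huc n).aestronglyMeasurable.sub hf.1) h.tendsto
  have t2 := tendsto_eLpNorm_one_of_tendsto hp
    (fun n => (hgc n).aestronglyMeasurable.sub hG.1) h.tendsto_gradient
  have l1 : Tendsto (fun n => ∫ x in Ω, u n x • gradient φ x) atTop
      (𝓝 (∫ x in Ω, f x • gradient φ x)) := by
    refine tendsto_integral_of_L1' _
      (hfi.smul_bdd D hφ1.continuous_gradient.aestronglyMeasurable (ae_of_all _ hD)).1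
      (Eventually.of_forall fun n => hKi ((huc n).smul hφ1.continuous_gradient)) ?_
    have h2 := ENNReal.Tendsto.const_mul t1 (Or.inr (ENNReal.ofReal_ne_top (r := D)))
    rw [mul_zero] at h2
    refine tendsto_of_tendsto_of_tendsto_of_le_of_le tendsto_const_nhds h2 (fun _ => zero_le)
      fun n => eLpNorm_le_mul_eLpNorm_of_ae_le_mul (ae_of_all _ fun x => ?_) _
    rw [Pi.sub_apply, Pi.smul_apply', ← sub_smul, norm_smul, mul_comm]
    exact mul_le_mul_of_nonneg_right (hD x) (norm_nonneg _)
  have l2 : Tendsto (fun n => ∫ x in Ω, φ x • gradient (u n) x) atTop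
      (𝓝 (∫ x in Ω, φ x • G x)) := by
    refine tendsto_integral_of_L1' _
      (hGi.bdd_smul A hφ.continuous.aestronglyMeasurable (ae_of_all _ hA)).1
      (Eventually.of_forall fun n => hKi (hφ.continuous.smul (hgc n))) ?_
    have h2 := ENNReal.Tendsto.const_mul t2 (Or.inr (ENNReal.ofReal_ne_top (r := A)))
    rw [mul_zero] at h2
    refine tendsto_of_tendsto_of_tendsto_of_le_of_le tendsto_const_nhds h2 (fun _ => zero_le)
      fun n => eLpNorm_le_mul_eLpNorm_of_ae_le_mul (ae_of_all _ fun x => ?_) _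
    rw [Pi.sub_apply, Pi.smul_apply', ← smul_sub, norm_smul]
    exact mul_le_mul_of_nonneg_right (hA x) (norm_nonneg _)
  refine tendsto_nhds_unique l1 (l2.neg.congr fun n => ?_)
  rw [integral_smul_gradient_of_contDiff (h.contDiff_one n) hφ1 hc hs]

/-- The fundamental lemma of the calculus of variations. It lets a trace witnessed with another weak
gradient be compared with the given one. -/
theorem HasWeakGradient.ae_eq {G' : EuclideanSpace ℝ (Fin N) → EuclideanSpace ℝ (Fin N)}
    (h : HasWeakGradient Ω f G) (h' : HasWeakGradient Ω f G') (hopen : IsOpen Ω)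
    (hG : IntegrableOn G Ω) (hG' : IntegrableOn G' Ω) : G =ᵐ[volume.restrict Ω] G' := by
  have h0 : ∀ᵐ x, x ∈ Ω → G x - G' x = 0 := by
    refine hopen.ae_eq_zero_of_integral_contDiff_smul_eq_zero (h.2.1.sub h'.2.1)
      fun φ hφ hc hs => ?_
    obtain ⟨A, hA⟩ := hc.exists_bound_of_continuous hφ.continuous
    have i1 : IntegrableOn (fun x => φ x • G x) Ω :=
      hG.bdd_smul A hφ.continuous.aestronglyMeasurable (ae_of_all _ hA)
    have i2 : IntegrableOn (fun x => φ x • G' x) Ω :=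
      hG'.bdd_smul A hφ.continuous.aestronglyMeasurable (ae_of_all _ hA)
    rw [← setIntegral_eq_integral_of_forall_compl_eq_zero (s := Ω) fun x hx => by
      rw [image_eq_zero_of_notMem_tsupport fun h => hx (hs h), zero_smul]]
    simp only [smul_sub]
    rw [integral_sub i1 i2, sub_eq_zero]
    have e1 := h.2.2 φ hφ hc hs
    rw [h'.2.2 φ hφ hc hs] at e1
    exact (neg_injective e1).symm
  filter_upwards [(ae_restrict_iff' hopen.measurableSet).2 h0] with x hx using sub_eq_zero.1 hx

/-- The trace inequality for smooth functions. -/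
theorem HasLipschitzBoundary.exists_eLpNorm_surfaceMeasure_le (hN : 1 ≤ N) (hopen : IsOpen Ω)
    (hbdd : Bornology.IsBounded Ω) (hlip : HasLipschitzBoundary Ω) (hp : 1 ≤ p) (hpt : p ≠ ⊤) :
    ∃ C : ℝ≥0∞, C ≠ ⊤ ∧ ∀ v : EuclideanSpace ℝ (Fin N) → ℝ, ContDiff ℝ 1 v →
      eLpNorm v p (surfaceMeasure Ω) ≤
        C * (eLpNorm v p (volume.restrict Ω) + eLpNorm (gradient v) p (volume.restrict Ω)) := by
  have hq := one_le_toReal hp hpt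
  have hq0 : 0 < p.toReal := by linarith
  obtain ⟨C, hC⟩ := hlip.exists_lintegral_boundary_le hN hopen hbdd hq
  refine ⟨(C : ℝ≥0∞) ^ (p.toReal)⁻¹, ENNReal.rpow_ne_top_of_nonneg (by positivity)
    ENNReal.coe_ne_top, fun v hv => eLpNorm_le_of_lintegral_le hp hpt ((hC v hv).trans ?_)⟩
  rw [ENNReal.mul_rpow_of_nonneg _ _ hq0.le, ENNReal.rpow_inv_rpow hq0.ne',
    ← eLpNorm_rpow_toReal hp hpt, ← eLpNorm_rpow_toReal hp hpt]
  exact mul_le_mul_right (ENNReal.add_rpow_le_rpow_add _ _ hq) _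

theorem gradient_sub_of_contDiff {u v : EuclideanSpace ℝ (Fin N) → ℝ} (hu : ContDiff ℝ 1 u)
    (hv : ContDiff ℝ 1 v) (x : EuclideanSpace ℝ (Fin N)) :
    gradient (fun y => u y - v y) x = gradient u x - gradient v x := by
  rw [gradient, fderiv_fun_sub (hu.differentiable one_ne_zero).differentiableAt
    (hv.differentiable one_ne_zero).differentiableAt, map_sub, gradient, gradient]

theorem eLpNorm_sub_le_add {α F : Type*} [MeasurableSpace α] {μ : Measure α}
    [NormedAddCommGroup F] (hp : 1 ≤ p) {a b c : α → F} (ha : AEStronglyMeasurable a μ)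
    (hb : AEStronglyMeasurable b μ) (hc : AEStronglyMeasurable c μ) :
    eLpNorm (fun x => a x - c x) p μ ≤
      eLpNorm (fun x => a x - b x) p μ + eLpNorm (fun x => c x - b x) p μ := by
  have e : (fun x => a x - c x) = (fun x => a x - b x) - fun x => c x - b x := by
    funext x
    simp
  rw [e]
  exact eLpNorm_sub_le (ha.sub hb) (hc.sub hb) hp

/-- The differences of two smooth approximations of the same function are controlled on the
boundary by the errors of approximation. -/
theorem IsSmoothApprox.exists_eLpNorm_sub_le {v : ℕ → EuclideanSpace ℝ (Fin N) → ℝ}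
    (hu : IsSmoothApprox Ω p f G u) (hv : IsSmoothApprox Ω p f G v) (hN : 1 ≤ N) (hopen : IsOpen Ω)
    (hbdd : Bornology.IsBounded Ω) (hlip : HasLipschitzBoundary Ω) (hp : 1 ≤ p) (hpt : p ≠ ⊤)
    (hf : MemLp f p (volume.restrict Ω)) (hG : MemLp G p (volume.restrict Ω)) :
    ∃ a b : ℕ → ℝ≥0∞, Tendsto a atTop (𝓝 0) ∧ Tendsto b atTop (𝓝 0) ∧ ∀ n m,
      eLpNorm (fun x => u n x - v m x) p (surfaceMeasure Ω) ≤ a n + b m := by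
  obtain ⟨C, hCt, hC⟩ := hlip.exists_eLpNorm_surfaceMeasure_le hN hopen hbdd hp hpt
  have ha := ENNReal.Tendsto.const_mul (hu.tendsto.add hu.tendsto_gradient) (Or.inr hCt)
  have hb := ENNReal.Tendsto.const_mul (hv.tendsto.add hv.tendsto_gradient) (Or.inr hCt)
  rw [add_zero, mul_zero] at ha hb
  refine ⟨_, _, ha, hb, fun n m => ?_⟩
  have hu1 := hu.contDiff_one n
  have hv1 := hv.contDiff_one m
  refine (hC _ (hu1.sub hv1)).trans ?_
  rw [← mul_add]
  refine mul_le_mul_right ?_ _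
  have e : gradient (fun y => u n y - v m y) = fun x => gradient (u n) x - gradient (v m) x :=
    funext fun x => gradient_sub_of_contDiff hu1 hv1 x
  rw [e]
  refine (add_le_add (eLpNorm_sub_le_add hp hu1.continuous.aestronglyMeasurable hf.1
    hv1.continuous.aestronglyMeasurable)
    (eLpNorm_sub_le_add hp hu1.continuous_gradient.aestronglyMeasurable hG.1
    hv1.continuous_gradient.aestronglyMeasurable)).trans (le_of_eq ?_)
  abel

theorem Continuous.memLp_surfaceMeasure [IsFiniteMeasure (surfaceMeasure Ω)]
    (hbdd : Bornology.IsBounded Ω) {v : EuclideanSpace ℝ (Fin N) → ℝ} (hv : Continuous v) :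
    MemLp v p (surfaceMeasure Ω) := by
  obtain ⟨B, hB⟩ := (isCompact_frontier_of_isBounded hbdd).exists_bound_of_continuousOn
    hv.continuousOn
  refine MemLp.of_bound hv.aestronglyMeasurable B ?_
  exact (ae_restrict_iff' isClosed_frontier.measurableSet).2 (ae_of_all _ hB)

/-- By the trace inequality, convergence in `W^{1,p}(Ω)` makes the boundary values a Cauchy sequence
in `L^p(∂Ω)`. -/
theorem IsSmoothApprox.exists_boundary_limit [IsFiniteMeasure (surfaceMeasure Ω)]
    (hu : IsSmoothApprox Ω p f G u) (hN : 1 ≤ N) (hopen : IsOpen Ω)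
    (hbdd : Bornology.IsBounded Ω) (hlip : HasLipschitzBoundary Ω) (hp : 1 ≤ p) (hpt : p ≠ ⊤)
    (hf : MemLp f p (volume.restrict Ω)) (hG : MemLp G p (volume.restrict Ω)) :
    ∃ g, MemLp g p (surfaceMeasure Ω) ∧
      Tendsto (fun n => eLpNorm (fun x => u n x - g x) p (surfaceMeasure Ω)) atTop (𝓝 0) := by
  obtain ⟨a, b, ha, hb, hab⟩ := hu.exists_eLpNorm_sub_le hu hN hopen hbdd hlip hp hpt hf hG
  have hp' : Fact (1 ≤ p) := ⟨hp⟩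
  have hm : ∀ n, MemLp (u n) p (surfaceMeasure Ω) := fun n =>
    (hu.smooth n).continuous.memLp_surfaceMeasure hbdd
  have hcs : CauchySeq fun n => (hm n).toLp (u n) := by
    rw [EMetric.cauchySeq_iff]
    intro ε hε
    have h2 : 0 < ε / 2 := ENNReal.half_pos hε.ne'
    obtain ⟨K, hK⟩ := eventually_atTop.1
      ((ha.eventually (gt_mem_nhds h2)).and (hb.eventually (gt_mem_nhds h2)))
    refine ⟨K, fun m hm' n hn' => ?_⟩
    rw [Lp.edist_toLp_toLp]
    refine (hab m n).trans_lt ?_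
    rw [← ENNReal.add_halves ε]
    exact ENNReal.add_lt_add (hK m hm').1 (hK n hn').2
  obtain ⟨g, hg⟩ := cauchySeq_tendsto_of_complete hcs
  refine ⟨g, Lp.memLp g, ?_⟩
  rw [← Lp.toLp_coeFn g (Lp.memLp g)] at hg
  exact (Lp.tendsto_Lp_iff_tendsto_eLpNorm'' _ hm _ (Lp.memLp g)).1 hg

theorem IsSmoothApprox.boundary_limit_ae_eq {v : ℕ → EuclideanSpace ℝ (Fin N) → ℝ}
    {g h : EuclideanSpace ℝ (Fin N) → ℝ}
    (hu : IsSmoothApprox Ω p f G u) (hv : IsSmoothApprox Ω p f G v) (hN : 1 ≤ N) (hopen : IsOpen Ω)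
    (hbdd : Bornology.IsBounded Ω) (hlip : HasLipschitzBoundary Ω) (hp : 1 ≤ p) (hpt : p ≠ ⊤)
    (hf : MemLp f p (volume.restrict Ω)) (hG : MemLp G p (volume.restrict Ω))
    (hg : AEStronglyMeasurable g (surfaceMeasure Ω))
    (hh : AEStronglyMeasurable h (surfaceMeasure Ω))
    (hug : Tendsto (fun n => eLpNorm (fun x => u n x - g x) p (surfaceMeasure Ω)) atTop (𝓝 0))
    (hvh : Tendsto (fun n => eLpNorm (fun x => v n x - h x) p (surfaceMeasure Ω)) atTop (𝓝 0)) :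
    h =ᵐ[surfaceMeasure Ω] g := by
  obtain ⟨a, b, ha, hb, hab⟩ := hu.exists_eLpNorm_sub_le hv hN hopen hbdd hlip hp hpt hf hG
  have hle : ∀ n, eLpNorm (fun x => h x - g x) p (surfaceMeasure Ω) ≤
      eLpNorm (fun x => v n x - h x) p (surfaceMeasure Ω) +
        (eLpNorm (fun x => u n x - g x) p (surfaceMeasure Ω) + (a n + b n)) := by
    intro n
    have mu := (hu.smooth n).continuous.aestronglyMeasurable (μ := surfaceMeasure Ω)
    have mv := (hv.smooth n).continuous.aestronglyMeasurable (μ := surfaceMeasure Ω)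
    refine (eLpNorm_sub_le_add hp hh mv hg).trans ?_
    have e1 : eLpNorm (fun x => h x - v n x) p (surfaceMeasure Ω) =
        eLpNorm (fun x => v n x - h x) p (surfaceMeasure Ω) := eLpNorm_sub_comm _ _ _ _
    have e2 : eLpNorm (fun x => g x - u n x) p (surfaceMeasure Ω) =
        eLpNorm (fun x => u n x - g x) p (surfaceMeasure Ω) := eLpNorm_sub_comm _ _ _ _
    have e3 : eLpNorm (fun x => v n x - u n x) p (surfaceMeasure Ω) =
        eLpNorm (fun x => u n x - v n x) p (surfaceMeasure Ω) := eLpNorm_sub_comm _ _ _ _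
    rw [e1]
    refine add_le_add le_rfl ((eLpNorm_sub_le_add hp hg mu mv).trans ?_)
    rw [e2, e3]
    exact add_le_add le_rfl (hab n n)
  have hlim := hvh.add (hug.add (ha.add hb))
  simp only [add_zero] at hlim
  have h0 : eLpNorm (fun x => h x - g x) p (surfaceMeasure Ω) = 0 :=
    le_antisymm (ge_of_tendsto' hlim hle) zero_le
  filter_upwards [(eLpNorm_eq_zero_iff (hh.sub hg) (one_pos.trans_le hp).ne').1 h0] with x hx using sub_eq_zero.1 hx

/-- The trace can be computed from any single smooth approximation. -/
theorem IsSmoothApprox.hasTrace_iff {g : EuclideanSpace ℝ (Fin N) → ℝ}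
    (hu : IsSmoothApprox Ω p f G u) (hN : 1 ≤ N) (hopen : IsOpen Ω)
    (hbdd : Bornology.IsBounded Ω) (hlip : HasLipschitzBoundary Ω) (hp : 1 ≤ p) (hpt : p ≠ ⊤)
    (hf : MemLp f p (volume.restrict Ω)) (hG : MemLp G p (volume.restrict Ω))
    (hg : MemLp g p (surfaceMeasure Ω))
    (hug : Tendsto (fun n => eLpNorm (fun x => u n x - g x) p (surfaceMeasure Ω)) atTop (𝓝 0))
    (h : EuclideanSpace ℝ (Fin N) → ℝ) : HasTrace Ω p f h ↔ h =ᵐ[surfaceMeasure Ω] g := by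
  have hw := hu.hasWeakGradient hbdd hp hf hG
  constructor
  · rintro ⟨-, hh, G', hw', hG', v, hv, hv1, hv2, hv3⟩
    have e := hw'.ae_eq hw hopen (MemLp.integrableOn_of_isBounded hbdd hp hG')
      (MemLp.integrableOn_of_isBounded hbdd hp hG)
    exact hu.boundary_limit_ae_eq (IsSmoothApprox.congr_ae ⟨hv, hv1, hv2⟩ (ae_eq_refl f) e)
      hN hopen hbdd hlip hp hpt hf hG hg.1 hh.1 hug hv3
  · intro e
    refine ⟨hf, hg.ae_eq e.symm, G, hw, hG, u, hu.smooth, hu.tendsto, hu.tendsto_gradient, ?_⟩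
    refine hug.congr fun n => eLpNorm_congr_ae ?_
    filter_upwards [e] with x hx
    rw [hx]

/-- The Gagliardo seminorm is lower semicontinuous along smooth functions. -/
theorem lintegral_gagliardo_le_liminf {α : Type*} [MeasurableSpace α] [PseudoMetricSpace α]
    [OpensMeasurableSpace α] [SecondCountableTopology α] {μ : Measure α} [SFinite μ]
    {u : ℕ → α → ℝ} (hu : ∀ n, Continuous (u n)) {g : α → ℝ}
    (hlim : ∀ᵐ x ∂μ, Tendsto (fun n => u n x) atTop (𝓝 (g x))) {q : ℝ} (hq : 0 ≤ q) (e : ℝ) :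
    ∫⁻ x, ∫⁻ y, ENNReal.ofReal (|g x - g y| ^ q / dist x y ^ e) ∂μ ∂μ ≤
      liminf (fun n => ∫⁻ x, ∫⁻ y, ENNReal.ofReal (|u n x - u n y| ^ q / dist x y ^ e) ∂μ ∂μ)
        atTop := by
  have hm : ∀ n, Measurable fun a : α × α =>
      ENNReal.ofReal (|u n a.1 - u n a.2| ^ q / dist a.1 a.2 ^ e) := fun n => by
    have := (hu n).measurable
    fun_prop
  have h1 : ∀ᵐ x ∂μ, ∫⁻ y, ENNReal.ofReal (|g x - g y| ^ q / dist x y ^ e) ∂μ ≤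
      liminf (fun n => ∫⁻ y, ENNReal.ofReal (|u n x - u n y| ^ q / dist x y ^ e) ∂μ) atTop := by
    filter_upwards [hlim] with x hx
    have hmx : ∀ n, Measurable fun y =>
        ENNReal.ofReal (|u n x - u n y| ^ q / dist x y ^ e) := fun n => by
      have := (hu n).measurable
      fun_prop
    refine le_trans (lintegral_mono_ae ?_) (lintegral_liminf_le hmx)
    filter_upwards [hlim] with y hy
    have ht : Tendsto (fun n => ENNReal.ofReal (|u n x - u n y| ^ q / dist x y ^ e)) atTop
        (𝓝 (ENNReal.ofReal (|g x - g y| ^ q / dist x y ^ e))) :=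
      ENNReal.tendsto_ofReal ((((hx.sub hy).abs).rpow_const (Or.inr hq)).div_const _)
    exact ht.liminf_eq.ge
  have hmi : ∀ n, Measurable fun x =>
      ∫⁻ y, ENNReal.ofReal (|u n x - u n y| ^ q / dist x y ^ e) ∂μ := fun n =>
    (hm n).lintegral_prod_right'
  exact (lintegral_mono_ae h1).trans (lintegral_liminf_le hmi)

/-- The Gagliardo energies of the `u n` are controlled by their convergent `W^{1,p}` norms. A
subsequence converges almost everywhere on the boundary, and lower semicontinuity passes the bound
to the limit. -/
theorem IsSmoothApprox.memBoundaryWsp [IsFiniteMeasure (surfaceMeasure Ω)]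
    {g : EuclideanSpace ℝ (Fin N) → ℝ}
    (hu : IsSmoothApprox Ω p f G u) (hN : 1 ≤ N) (hopen : IsOpen Ω)
    (hbdd : Bornology.IsBounded Ω) (hlip : HasLipschitzBoundary Ω) (hp : 1 < p) (hpt : p ≠ ⊤)
    (hf : MemLp f p (volume.restrict Ω)) (hG : MemLp G p (volume.restrict Ω))
    (hg : MemLp g p (surfaceMeasure Ω))
    (hug : Tendsto (fun n => eLpNorm (fun x => u n x - g x) p (surfaceMeasure Ω)) atTop (𝓝 0)) :
    MemBoundaryWsp Ω (1 - 1 / p.toReal) p g := by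
  refine ⟨hg, ?_⟩
  set q := p.toReal with hq'
  have hq : 1 < q := by
    rw [hq', ← ENNReal.toReal_one]
    exact (ENNReal.toReal_lt_toReal ENNReal.one_ne_top hpt).2 hp
  have hq0 : 0 ≤ q := by linarith
  have he : (N : ℝ) - 1 + (1 - 1 / q) * q = N - 2 + q := by
    have : q ≠ 0 := by linarith
    field_simp
    ring
  obtain ⟨C, hC⟩ := hlip.exists_gagliardo_le hN hopen hbdd hq he
  obtain ⟨ns, hns, hlim⟩ := (tendstoInMeasure_of_tendsto_eLpNorm (one_pos.trans hp).ne'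
    (fun n => (hu.smooth n).continuous.aestronglyMeasurable) hg.1 hug).exists_seq_tendsto_ae
  refine (lintegral_gagliardo_le_liminf (fun n => (hu.smooth (ns n)).continuous) hlim hq0
    _).trans_lt ?_
  have hb : Tendsto (fun n => (C : ℝ≥0∞) *
      ((eLpNorm (fun x => u n x - f x) p (volume.restrict Ω) + eLpNorm f p (volume.restrict Ω)) ^ q +
      (eLpNorm (fun x => gradient (u n) x - G x) p (volume.restrict Ω) +
        eLpNorm G p (volume.restrict Ω)) ^ q)) atTop
      (𝓝 (C * ((0 + eLpNorm f p (volume.restrict Ω)) ^ q +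
        (0 + eLpNorm G p (volume.restrict Ω)) ^ q))) :=
    ENNReal.Tendsto.const_mul (((hu.tendsto.add_const _).ennrpow_const q).add
      ((hu.tendsto_gradient.add_const _).ennrpow_const q)) (Or.inr ENNReal.coe_ne_top)
  refine (liminf_le_liminf (Eventually.of_forall fun n => (hC (u (ns n))
    (hu.contDiff_one (ns n))).trans ?_)).trans_lt
    ((hb.comp hns.tendsto_atTop).liminf_eq.trans_lt ?_)
  · refine mul_le_mul_right ?_ _
    rw [hq', ← eLpNorm_rpow_toReal hp.le hpt, ← eLpNorm_rpow_toReal hp.le hpt, ← hq']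
    have huc := (hu.smooth (ns n)).continuous.aestronglyMeasurable (μ := volume.restrict Ω)
    have hgc := (hu.contDiff_one (ns n)).continuous_gradient.aestronglyMeasurable
      (μ := volume.restrict Ω)
    refine add_le_add (ENNReal.rpow_le_rpow ?_ hq0) (ENNReal.rpow_le_rpow ?_ hq0)
    · refine le_trans (le_of_eq ?_) (eLpNorm_add_le (huc.sub hf.1) hf.1 hp.le)
      congr 1
      funext x
      simp
    · refine le_trans (le_of_eq ?_) (eLpNorm_add_le (hgc.sub hG.1) hG.1 hp.le)
      congr 1
      funext x
      simp
  · rw [zero_add, zero_add]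
    exact ENNReal.mul_lt_top ENNReal.coe_lt_top (ENNReal.add_lt_top.2
      ⟨ENNReal.rpow_lt_top_of_nonneg hq0 hf.2.ne, ENNReal.rpow_lt_top_of_nonneg hq0 hG.2.ne⟩)

/-- Variable step mollification with an admissible step preserves `W^{1,p}` and boundary traces. -/
theorem IsAdmissibleStep.exists_trace {η ρ : EuclideanSpace ℝ (Fin N) → ℝ}
    (hη : IsAdmissibleStep Ω η) (hρ : IsMollifierKernel ρ) (hN : 1 ≤ N) (hopen : IsOpen Ω)
    (hbdd : Bornology.IsBounded Ω) (hlip : HasLipschitzBoundary Ω) (hp : 1 ≤ p) (hpt : p ≠ ⊤)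
    (hf : MemW1p Ω p f) {T : EuclideanSpace ℝ (Fin N) → ℝ}
    (hT : ∀ x ∈ Ω, variableStepMollifier ρ η f x = T x) :
    MemW1p Ω p T ∧ ∃ g, MemLp g p (surfaceMeasure Ω) ∧
      (1 < p → MemBoundaryWsp Ω (1 - 1 / p.toReal) p g) ∧
      (∀ h, HasTrace Ω p f h ↔ h =ᵐ[surfaceMeasure Ω] g) ∧
      (∀ h, HasTrace Ω p T h ↔ h =ᵐ[surfaceMeasure Ω] g) := by
  have hfin := hlip.isFiniteMeasure_surfaceMeasure hN hopen hbdd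
  obtain ⟨hfp, G, hG, hGp⟩ := hf
  obtain ⟨u, hu1, hu2, hu3⟩ := hG.exists_smooth_approx hopen hbdd hlip hp hpt hfp hGp
  have hu : IsSmoothApprox Ω p f G u := ⟨hu1, hu2, hu3⟩
  obtain ⟨hTp, hSp, w, hw1, hw2, hw3, hwu⟩ :=
    hη.exists_smooth_approx hρ hopen hbdd hp hpt hfp hGp hu1 hu2 hu3
  have hTe : variableStepMollifier ρ η f =ᵐ[volume.restrict Ω] T :=
    (ae_restrict_iff' hopen.measurableSet).2 (ae_of_all _ hT)
  have hTp' := hTp.ae_eq hTe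
  have hw : IsSmoothApprox Ω p T (fun x => stepGradient ρ (η x) (gradient η x) G x) w :=
    IsSmoothApprox.congr_ae ⟨hw1, hw2, hw3⟩ hTe (ae_eq_refl _)
  obtain ⟨g, hg, hug⟩ := hu.exists_boundary_limit hN hopen hbdd hlip hp hpt hfp hGp
  -- The approximants of `f` and of its mollification differ on the boundary by a null sequence, so
  -- they have the same boundary limit; this is the equality of traces.
  have hwg : Tendsto (fun n => eLpNorm (fun x => w n x - g x) p (surfaceMeasure Ω)) atTop
      (𝓝 0) := by
    have hlim := hwu.add hug
    rw [add_zero] at hlim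
    refine tendsto_of_tendsto_of_tendsto_of_le_of_le tendsto_const_nhds hlim (fun _ => zero_le)
      fun n => ?_
    have mu := (hu1 n).continuous.aestronglyMeasurable (μ := surfaceMeasure Ω)
    have mw := (hw1 n).continuous.aestronglyMeasurable (μ := surfaceMeasure Ω)
    refine le_trans (le_of_eq ?_) (eLpNorm_add_le (mw.sub mu) (mu.sub hg.1) hp)
    congr 1
    funext x
    simp
  exact ⟨⟨hTp', _, hw.hasWeakGradient hbdd hp hTp' hSp, hSp⟩, g, hg,
    fun hp1 => hu.memBoundaryWsp hN hopen hbdd hlip hp1 hpt hfp hGp hg hug,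
    hu.hasTrace_iff hN hopen hbdd hlip hp hpt hfp hGp hg hug,
    hw.hasTrace_iff hN hopen hbdd hlip hp hpt hTp' hSp hg hwg⟩

end Traces

theorem proposition4p3 {N : ℕ} (hN : 1 ≤ N) (Ω : Set (EuclideanSpace ℝ (Fin N)))
    (hΩ_open : IsOpen Ω) (hΩ_bdd : Bornology.IsBounded Ω) (hΩ_lip : HasLipschitzBoundary Ω)
    (ρ : EuclideanSpace ℝ (Fin N) → ℝ) (hρ : IsMollifierKernel ρ) :
    (∀ η : EuclideanSpace ℝ (Fin N) → ℝ, IsWhitneyStep (frontier Ω) η →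
      ∀ p : ℝ≥0∞, 1 < p → p < ⊤ →
      ∀ f : EuclideanSpace ℝ (Fin N) → ℝ, MemW1p Ω p f →
        MemW1p Ω p (variableStepMollifier ρ η f) ∧
        ∃ g : EuclideanSpace ℝ (Fin N) → ℝ,
          MemBoundaryWsp Ω (1 - 1 / p.toReal) p g ∧
          (∀ h, HasTrace Ω p f h ↔ h =ᵐ[surfaceMeasure Ω] g) ∧
          (∀ h, HasTrace Ω p (variableStepMollifier ρ η f) h ↔ h =ᵐ[surfaceMeasure Ω] g)) ∧
    (∀ η : EuclideanSpace ℝ (Fin N) → ℝ, IsQuadraticStep Ω η →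
      ∀ f : EuclideanSpace ℝ (Fin N) → ℝ, MemW1p Ω 1 f →
        MemW1p Ω 1 (variableStepMollifier ρ η f) ∧
        ∃ g : EuclideanSpace ℝ (Fin N) → ℝ,
          MemLp g 1 (surfaceMeasure Ω) ∧
          (∀ h, HasTrace Ω 1 f h ↔ h =ᵐ[surfaceMeasure Ω] g) ∧
          (∀ h, HasTrace Ω 1 (variableStepMollifier ρ η f) h ↔ h =ᵐ[surfaceMeasure Ω] g)) := by
  refine ⟨fun η hη p hp hpt f hf => ?_, fun η hη f hf => ?_⟩
  · obtain ⟨h1, g, -, h2, h3, h4⟩ := (hη.isAdmissibleStep hΩ_open hΩ_bdd).exists_trace hρ hN hΩ_open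
      hΩ_bdd hΩ_lip hp.le hpt.ne hf fun _ _ => rfl
    exact ⟨h1, g, h2 hp, h3, h4⟩
  -- Since `η` is unconstrained outside `Ω`, it is replaced by its extension by zero, which gives
  -- the same mollification at points of `Ω`.
  · obtain ⟨h1, g, h2, -, h3, h4⟩ := (hη.isAdmissibleStep_indicator hN hΩ_open hΩ_bdd).exists_trace
      hρ hN hΩ_open hΩ_bdd hΩ_lip le_rfl ENNReal.one_ne_top hf
      fun _ hx => variableStepMollifier_indicator ρ f hx
    exact ⟨h1, g, h2, h3, h4⟩
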